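/- **Setting.** Let $\rho>0$, $0\le\theta_0<\pi$, $\sigma>0$. In $\mathbb R^3$ with unit vector $\mathbf z=(0,0,1)$ let $\mathcal C=\{x^2+y^2=1,\ 0\le z\le\rho\}$, with unit normal $\mathbf r=(x,y,0)$ pointing away from the axis, let $\mathcal W_1=\{(0,s,0):|s|\le1\}$, $\mathcal W_2=\{(-s\sin\theta_0,s\cos\theta_0,\rho):|s|\le1\}$ (the wires) and $\mathcal W=\mathcal W_1\cup\mathcal W_2$. Let $\mathcal S_0=[-1,1]\times[0,\rho]$, with coordinates $(y,z)$, let $\mathcal W_0$ be the union of its two closed edges $z=0$ and $z=\rho$, and let $\mathcal Y_0=\partial\mathcal S_0\setminus\mathcal W_0$. Let $\mathcal A$ be the class of regular $C^2$ surfaces $\mathcal S=f(\mathcal S_0)$, where $f\in C^2(\mathcal S_0,\mathbb R^3)$ is an injective immersion with $f(\mathcal W_0)=\mathcal W$ and $f(\mathcal Y_0)\subset\mathcal C$. Put $\mathcal Y=f(\mathcal Y_0)=\partial\mathcal S\setminus\mathcal W$. A field on $\mathcal S$ is of class $C^2$ if its composition with $f$ is of class $C^2$ on the closed rectangle $\mathcal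 S_0$. Let $\mathbf n$ be a unit normal field of $\mathcal S$, $\mathbf t$ a unit tangent field along $\mathcal Y$, $\nabla_{\mathcal S}$ the surface gradient (the gradient of an extension that is constant in the normal direction), $\mathbf L=-\nabla_{\mathcal S}\mathbf n$, and $K=\frac12[(\operatorname{tr}\mathbf L)^2-\operatorname{tr}(\mathbf L^2)]$ the Gaussian curvature. The energy of $\mathcal S$ is $E(\mathcal S)=\int_{\mathcal S}\sigma\,\mathrm{da}$. Let $V$ be the set of $C^2$ vector fields $\mathbf v:\mathcal S\to\mathbb R^3$ that are tangent to the wires on $\mathcal W$ and satisfy $\mathbf v\cdot\mathbf r=0$ on $\mathcal Y$. For an open interval $I\ni0$, a family $F\in C^2(I,C^2(\mathcal S_0,\mathbb R^3))$ with $F(0,\cdot)=f$ has initial velocity $\mathbf v$ if $\partial_tF(0,q)=\mathbf v(f(q))$ for all $q\in\mathcal S_0$; we write $E(F(t,\cdot))=\int_{\mathcal S_0}\sigma\,|\partial_yF(t,\cdot)\times\partial_zF(t,\cdot)|\,\mathrm dy\,\mathrm dz$. * $\mathcal S$ is *critical* if the first variation of $E$ vanishes for every $\mathbf v\in V$: $\frac{d}{dt}E(F(t,\cdot))|_{t=0}=0$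 for every such family $F$ with initial velocity $\mathbf v\in V$. * $\mathcal S$ satisfies the *second-variation stability condition* if, for every $\mathbf v\in V$, $\frac{d^2}{dt^2}E(F(t,\cdot))|_{t=0}\ge0$ for every such family $F$ with initial velocity $\mathbf v$ for which each $F(t,\cdot)$, $t\in I$, is an injective immersion with $F(t,\mathcal W_0)=\mathcal W$ and $F(t,\mathcal Y_0)\subset\mathcal C$. **Proposition.** A critical surface $\mathcal S\in\mathcal A$ satisfies the second-variation stability condition if and only if $$\int_{\mathcal Y}(\mathbf t\cdot\mathbf z)^2c^2\,\mathrm{dl}\ \le\ \int_{\mathcal S}\bigl(|\nabla_{\mathcal S}c|^2+2Kc^2\bigr)\,\mathrm{da}$$ for every $C^2$ function $c:\mathcal S\to\mathbb R$ that vanishes on $\mathcal W$. -/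

import Mathlib

open Set MeasureTheory

noncomputable section

namespace SoapFilm

/-- Euclidean three-space, with Cartesian coordinates `x = p 0`, `y = p 1`, `z = p 2`. -/
abbrev E3 : Type := EuclideanSpace ℝ (Fin 3)

/-- The cross product of `ℝ³`. -/
def cross (u v : E3) : E3 := WithLp.toLp 2 (crossProduct u.ofLp v.ofLp)

/-- The unit vector `z` along the axis of the tube. -/
def zAxis : E3 := !₂[0, 0, 1]

/-- At a point `p` of the unit cylinder about the `z`-axis, the unit normal `r` pointing away from
the axis. -/
def radial (p : E3) : E3 := !₂[p 0, p 1, 0]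

/-! ### The tube, the wires and the reference rectangle -/

/-- The inner wall of the tube: the cylinder of radius `1` and length `ρ`. -/
def tubeWall (ρ : ℝ) : Set E3 := {p | p 0 ^ 2 + p 1 ^ 2 = 1 ∧ 0 ≤ p 2 ∧ p 2 ≤ ρ}

/-- The horizontal unit vector that makes the (counter-clockwise) angle `θ` with the `y`-axis. -/
def wireDir (θ : ℝ) : E3 := !₂[-Real.sin θ, Real.cos θ, 0]

/-- The wire at height `h` that makes the angle `θ` with the `y`-axis: a segment of length `2`
centred on the axis of the tube. -/
def wire (h θ : ℝ) : Set E3 := {p | ∃ s ∈ Icc (-1 : ℝ) 1, p = s • wireDir θ + h • zAxis}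

/-- The union of the two wires. -/
def wires (ρ θ₀ : ℝ) : Set E3 := wire 0 0 ∪ wire ρ θ₀

/-- The flat surface `S₀ = {x = 0, -1 ≤ y ≤ 1, 0 ≤ z ≤ ρ}` in the coordinates `(y, z)`. -/
def rect (ρ : ℝ) : Set (ℝ × ℝ) := Icc (-1) 1 ×ˢ Icc 0 ρ

/-- The two edges `z = 0` and `z = ρ` of `S₀`, which are mapped to the wires. -/
def wireEdges (ρ : ℝ) : Set (ℝ × ℝ) := {q | q.1 ∈ Icc (-1 : ℝ) 1 ∧ (q.2 = 0 ∨ q.2 = ρ)}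

/-- The rest `Y₀` of the boundary of `S₀`: the two edges `y = ±1` without their end points. -/
def sideEdges (ρ : ℝ) : Set (ℝ × ℝ) := {q | (q.1 = -1 ∨ q.1 = 1) ∧ q.2 ∈ Ioo (0 : ℝ) ρ}

/-! ### Surfaces -/

/-- `f` parametrizes a surface of the admissible class: `S = f(S₀)` is an injectively parametrized
regular `C²` surface whose boundary consists of the two wires and of two curves
`Y = f(Y₀)` on the inner wall of the tube. -/
structure IsAdmissible (ρ θ₀ : ℝ) (f : ℝ × ℝ → E3) : Prop where
  contDiffOn : ContDiffOn ℝ 2 f (rect ρ)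
  injOn : InjOn f (rect ρ)
  immersion : ∀ q ∈ rect ρ, Function.Injective (fderivWithin ℝ f (rect ρ) q)
  image_wireEdges : f '' wireEdges ρ = wires ρ θ₀
  mapsTo_sideEdges : MapsTo f (sideEdges ρ) (tubeWall ρ)

section Geometry

variable {F : Type*} [NormedAddCommGroup F] [NormedSpace ℝ F]

/-- Partial derivative in `y` on the closed rectangle. -/
def dy (ρ : ℝ) (g : ℝ × ℝ → F) (q : ℝ × ℝ) : F := fderivWithin ℝ g (rect ρ) q (1, 0)

/-- Partial derivative in `z` on the closed rectangle. -/
def dz (ρ : ℝ) (g : ℝ × ℝ → F) (q : ℝ × ℝ) : F := fderivWithin ℝ g (rect ρ) q (0, 1)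

/-- The area element `|f_y × f_z|`. -/
def areaElement (ρ : ℝ) (f : ℝ × ℝ → E3) (q : ℝ × ℝ) : ℝ := ‖cross (dy ρ f q) (dz ρ f q)‖

/-- The unit normal `n` at `f q`. -/
def unitNormal (ρ : ℝ) (f : ℝ × ℝ → E3) (q : ℝ × ℝ) : E3 :=
  (areaElement ρ f q)⁻¹ • cross (dy ρ f q) (dz ρ f q)

/-- First vector of the frame of the tangent plane dual to `(f_y, f_z)`:
it is orthogonal to `f_z` and `n` and its inner product with `f_y` is `1`. -/
def dualY (ρ : ℝ) (f : ℝ × ℝ → E3) (q : ℝ × ℝ) : E3 :=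
  (areaElement ρ f q)⁻¹ • cross (dz ρ f q) (unitNormal ρ f q)

/-- Second vector of the frame of the tangent plane dual to `(f_y, f_z)`:
it is orthogonal to `f_y` and `n` and its inner product with `f_z` is `1`. -/
def dualZ (ρ : ℝ) (f : ℝ × ℝ → E3) (q : ℝ × ℝ) : E3 :=
  (areaElement ρ f q)⁻¹ • cross (unitNormal ρ f q) (dy ρ f q)

/-- The surface gradient `∇_S φ` at `f q` of a field `φ` on `S`, given as `g = φ ∘ f`, as a linear
map on `ℝ³`: it sends `f_y` to `g_y`, `f_z` to `g_z`, and the normal `n` to `0`, so it is the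
derivative of an extension of `φ` that is constant in the normal direction. -/
def surfGrad (ρ : ℝ) (f : ℝ × ℝ → E3) (g : ℝ × ℝ → F) (q : ℝ × ℝ) : E3 →L[ℝ] F :=
  (innerSL ℝ (dualY ρ f q)).smulRight (dy ρ g q) + (innerSL ℝ (dualZ ρ f q)).smulRight (dz ρ g q)

end Geometry

/-- The curvature tensor `L = -∇_S n` at `f q`. -/
def curvTensor (ρ : ℝ) (f : ℝ × ℝ → E3) (q : ℝ × ℝ) : E3 →L[ℝ] E3 :=
  -surfGrad ρ f (unitNormal ρ f) q

/-- The Gaussian curvature `K = ((tr L)² - tr (L²)) / 2` at `f q`. -/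
def gaussCurv (ρ : ℝ) (f : ℝ × ℝ → E3) (q : ℝ × ℝ) : ℝ :=
  (LinearMap.trace ℝ E3 (curvTensor ρ f q : E3 →ₗ[ℝ] E3) ^ 2
    - LinearMap.trace ℝ E3 (curvTensor ρ f q ∘L curvTensor ρ f q : E3 →ₗ[ℝ] E3)) / 2

/-- The surface integral `∫_S φ da`, where `φ` is given on `S₀` as `h = φ ∘ f`. -/
def surfIntegral (ρ : ℝ) (f : ℝ × ℝ → E3) (h : ℝ × ℝ → ℝ) : ℝ :=
  ∫ q in rect ρ, h q * areaElement ρ f q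

/-- The unit tangent `t` to the side curves `s ↦ f (±1, s)` (its orientation plays no role below,
where only the square of `t · z` occurs). -/
def sideTangent (ρ : ℝ) (f : ℝ × ℝ → E3) (q : ℝ × ℝ) : E3 := ‖dz ρ f q‖⁻¹ • dz ρ f q

/-- The line integral `∫_Y φ dl` over the two side curves, where `φ` is given as `h = φ ∘ f`. -/
def sideIntegral (ρ : ℝ) (f : ℝ × ℝ → E3) (h : ℝ × ℝ → ℝ) : ℝ :=
  (∫ s in (0 : ℝ)..ρ, h (-1, s) * ‖dz ρ f (-1, s)‖) + ∫ s in (0 : ℝ)..ρ, h (1, s) * ‖dz ρ f (1, s)‖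

/-- The free energy `E(S) = ∫_S σ da`. -/
def energy (ρ σ : ℝ) (f : ℝ × ℝ → E3) : ℝ := surfIntegral ρ f fun _ => σ

/-- `φ` is a field of class `C²` on the surface parametrized by `f`. -/
def IsC2OnSurface {F : Type*} [NormedAddCommGroup F] [NormedSpace ℝ F]
    (ρ : ℝ) (f : ℝ × ℝ → E3) (φ : E3 → F) : Prop :=
  ContDiffOn ℝ 2 (φ ∘ f) (rect ρ)

/-! ### Variations -/

/-- The one-parameter family `F` belongs to `C²(I, C²(S₀, ℝ³))`, `I = (a, b)`: with `G i` the `i`-th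
derivative in the parameter, all derivatives on `S₀` of order at most two of `G 0 = F`, `G 1`, `G 2`
exist and are continuous on `I × S₀`. -/
def IsC2Family (ρ a b : ℝ) (F : ℝ → ℝ × ℝ → E3) : Prop :=
  ∃ G : ℕ → ℝ → ℝ × ℝ → E3, G 0 = F ∧
    (∀ i < 2, ∀ t ∈ Ioo a b, ∀ q ∈ rect ρ, HasDerivAt (fun s => G i s q) (G (i + 1) t q) t) ∧
    (∀ i ≤ 2, ∀ t ∈ Ioo a b, ContDiffOn ℝ 2 (G i t) (rect ρ)) ∧
    ∀ i ≤ 2, ∀ j ≤ 2, ContinuousOn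
      (fun x : ℝ × ℝ × ℝ => iteratedFDerivWithin ℝ j (G i x.1) (rect ρ) x.2) (Ioo a b ×ˢ rect ρ)

/-- `F` starts from the surface parametrized by `f`, and `v`, a vector field on that surface, is its
initial velocity. -/
def HasInitialVelocity (ρ : ℝ) (f : ℝ × ℝ → E3) (F : ℝ → ℝ × ℝ → E3) (v : E3 → E3) : Prop :=
  ∀ q ∈ rect ρ, F 0 q = f q ∧ HasDerivAt (fun t => F t q) (v (f q)) 0

/-- The set `V` of admissible velocities: `C²` vector fields on the surface that are tangent to the
wires on the wires, and satisfy `v · r = 0` on the side curves `Y`. -/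
structure IsAdmissibleVelocity (ρ θ₀ : ℝ) (f : ℝ × ℝ → E3) (v : E3 → E3) : Prop where
  isC2 : IsC2OnSurface ρ f v
  lowerWire : ∀ p ∈ wire 0 0, v p = inner ℝ (v p) (wireDir 0) • wireDir 0
  upperWire : ∀ p ∈ wire ρ θ₀, v p = inner ℝ (v p) (wireDir θ₀) • wireDir θ₀
  side : ∀ p ∈ f '' sideEdges ρ, inner ℝ (v p) (radial p) = 0

/-- The surface parametrized by `f` is a critical point of the energy: the first variation with
respect to every admissible velocity vanishes. -/
def IsCritical (ρ θ₀ σ : ℝ) (f : ℝ × ℝ → E3) : Prop :=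
  ∀ v : E3 → E3, IsAdmissibleVelocity ρ θ₀ f v →
    ∀ (a b : ℝ) (F : ℝ → ℝ × ℝ → E3), a < 0 → 0 < b → IsC2Family ρ a b F →
      HasInitialVelocity ρ f F v → HasDerivAt (fun t => energy ρ σ (F t)) 0 0

/-- The second-variation stability condition: for every `v` in `V`, the second derivative of the
energy at `0` is nonnegative along every family of admissible surfaces that starts from the
surface with initial velocity `v`. -/
def IsSecondVariationStable (ρ θ₀ σ : ℝ) (f : ℝ × ℝ → E3) : Prop :=
  ∀ v : E3 → E3, IsAdmissibleVelocity ρ θ₀ f v →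
    ∀ (a b : ℝ) (F : ℝ → ℝ × ℝ → E3), a < 0 → 0 < b → IsC2Family ρ a b F →
      (∀ t ∈ Ioo a b, IsAdmissible ρ θ₀ (F t)) → HasInitialVelocity ρ f F v →
        0 ≤ deriv (deriv fun t => energy ρ σ (F t)) 0

end SoapFilm

end

noncomputable section

set_option linter.unusedSectionVars false

namespace SoapFilm

/-! ### The cross product and the triple product -/

/-! Velocities are pulled back to fields g = v ∘ f on the rectangle. On a critical surface
`firstVar` vanishes on every admissible field (`firstVar_eq_zero`), and this yields the geometry
that is needed. The mean curvature vanishes (`meanDensity_eq_zero`). The surface meets the tube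
orthogonally (`inner_unitNormal_radial_side`). It lies inside the tube, so that on the sides its
outward conormal is r rather than -r (`radial_sq_le_one`, `inner_radial_dy_side_pos`). Its side
curves stay strictly between the rims (`height_mem_Ioo_of_mem_sideEdges`).

Along a family of admissible surfaces with velocity g, the second derivative of the area is a
quadratic form in g plus the first variation in the direction of the acceleration. The acceleration
itself need not be admissible, because the cylinder is curved: on the sides its component along r is
-|radial g|². Adding |radial g|² r makes it admissible, so criticality expresses its contribution
through the velocity alone. With c = g · n, the quadratic form differs from the integral of |∇c|² +
2Kc² by that of the two exact forms d(n × g) ∧ dg and d(c n × g) ∧ dn (`secondVariation_pointwise`),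
and Green's theorem moves these to the boundary. On the wires all the vectors involved are parallel
to the wire and nothing remains. On the sides the tangential part of g cancels against the
centripetal term, and -(t · z)²c² is left (`side_pointwise`). Hence E'' = σ Q(c), where Q is
`stabilityForm` (`deriv_deriv_energy_eq`).

It remains to compare two classes of functions: normal components of velocities, and C² functions
that vanish on the wires. They differ because n is only C¹. If Q ≥ 0 on the second class, then Q ≥ 0
on the C¹ functions that vanish on the wires, by C¹ approximation and continuity of Q
(`stabilityForm_nonneg_of_c1`), hence on all normal components. Conversely, for u in the second
class, n is approximated by C² fields N_k tangent to the cylinder on the sides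
(`exists_c1Lim_unitNormal`), and u is replaced by a soft threshold w that vanishes near the corners.
The explicit family `cylinderShift` with velocity w N_k keeps the sides on the cylinder; it respects
the bounds 0 ≤ z ≤ ρ because on the part of the sides that moves these bounds are strict. Letting k
tend to infinity and then the threshold to 0 gives Q(u) ≥ 0.

The strict bounds on the height take the place of a Hopf lemma
(`affineHeight_pos_of_mem_sideEdges`). The height is weakly harmonic with a natural boundary
condition on the sides. At a contact with a rim its gradient would vanish, so it would be at most
quadratic in the distance r; but its logarithm has bounded local Dirichlet energy, and this forbids
a decay like 2 log r on a whole cone of segments. -/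

@[simp] lemma cross_zero_coord (u v : E3) : cross u v 0 = u 1 * v 2 - u 2 * v 1 := rfl
@[simp] lemma cross_one_coord (u v : E3) : cross u v 1 = u 2 * v 0 - u 0 * v 2 := rfl
@[simp] lemma cross_two_coord (u v : E3) : cross u v 2 = u 0 * v 1 - u 1 * v 0 := rfl

lemma inner_coord (u v : E3) : inner ℝ u v = u 0 * v 0 + u 1 * v 1 + u 2 * v 2 := by
  simp [PiLp.inner_apply, Fin.sum_univ_three, mul_comm]

lemma ext_coord {u v : E3} (h0 : u 0 = v 0) (h1 : u 1 = v 1) (h2 : u 2 = v 2) : u = v := by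
  ext i; fin_cases i <;> assumption

/-- The triple product `a · (b × c)`. -/
def tri (a b c : E3) : ℝ := inner ℝ a (cross b c)

lemma tri_coord (a b c : E3) : tri a b c =
    a 0 * (b 1 * c 2 - b 2 * c 1) + a 1 * (b 2 * c 0 - b 0 * c 2) + a 2 * (b 0 * c 1 - b 1 * c 0) := by
  simp [tri, inner_coord]

/-- The cross product as a continuous bilinear map. -/
def crossL : E3 →L[ℝ] E3 →L[ℝ] E3 :=
  LinearMap.mkContinuous₂
    (LinearMap.mk₂ ℝ cross
      (fun a b c => by apply ext_coord <;> simp <;> ring)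
      (fun r a b => by apply ext_coord <;> simp <;> ring)
      (fun a b c => by apply ext_coord <;> simp <;> ring)
      (fun r a b => by apply ext_coord <;> simp <;> ring)) 1 (by
    intro x y
    simp only [LinearMap.mk₂_apply, one_mul]
    refine le_of_sq_le_sq ?_ (by positivity)
    rw [mul_pow, ← real_inner_self_eq_norm_sq, ← real_inner_self_eq_norm_sq,
      ← real_inner_self_eq_norm_sq]
    simp only [inner_coord, cross_zero_coord, cross_one_coord, cross_two_coord]
    nlinarith [sq_nonneg (x 0 * y 0 + x 1 * y 1 + x 2 * y 2)])

@[simp] lemma crossL_apply (u v : E3) : crossL u v = cross u v := rfl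

lemma tri_eq_inner_cross (a b c : E3) : tri a b c = inner ℝ (cross a b) c := by
  simp [tri_coord, inner_coord]; ring

/-! ### The rectangle -/

section Rect
variable {ρ : ℝ}

lemma convex_rect (ρ : ℝ) : Convex ℝ (rect ρ) := (convex_Icc _ _).prod (convex_Icc _ _)
lemma isCompact_rect (ρ : ℝ) : IsCompact (rect ρ) := isCompact_Icc.prod isCompact_Icc
lemma isClosed_rect (ρ : ℝ) : IsClosed (rect ρ) := (isCompact_rect ρ).isClosed
lemma measurableSet_rect (ρ : ℝ) : MeasurableSet (rect ρ) := (isClosed_rect ρ).measurableSet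
lemma uniqueDiffOn_rect (hρ : 0 < ρ) : UniqueDiffOn ℝ (rect ρ) :=
  (uniqueDiffOn_Icc (by norm_num)).prod (uniqueDiffOn_Icc hρ)
lemma interior_rect (ρ : ℝ) : interior (rect ρ) = Ioo (-1) 1 ×ˢ Ioo 0 ρ := by
  rw [rect, interior_prod_eq, interior_Icc, interior_Icc]
lemma rect_eq_Icc (ρ : ℝ) : rect ρ = Icc ((-1 : ℝ), (0 : ℝ)) ((1 : ℝ), ρ) := by
  rw [rect, Icc_prod_Icc]
lemma closure_interior_rect (hρ : 0 < ρ) : closure (interior (rect ρ)) = rect ρ := by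
  rw [interior_rect, closure_prod_eq, closure_Ioo (by norm_num), closure_Ioo hρ.ne, rect]
-- The frontier of a convex set is null. Derivatives in the parameter are therefore needed only at
-- interior points.
lemma ae_mem_interior_rect (ρ : ℝ) :
    ∀ᵐ q ∂(volume.restrict (rect ρ)), q ∈ interior (rect ρ) := by
  have h0 : volume (frontier (rect ρ)) = 0 := (convex_rect ρ).addHaar_frontier _
  rw [ae_restrict_iff' (measurableSet_rect ρ)]
  have : ∀ᵐ q ∂(volume : Measure (ℝ × ℝ)), q ∉ frontier (rect ρ) := by
    rw [ae_iff]; simpa using h0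
  filter_upwards [this] with q hq hqr
  by_contra h
  exact hq ⟨subset_closure hqr, h⟩
end Rect

/-! ### Calculus of partial derivatives on the closed rectangle. -/

section Calculus
variable {ρ : ℝ} {F : Type*} [NormedAddCommGroup F] [NormedSpace ℝ F]
  {G : Type*} [NormedAddCommGroup G] [NormedSpace ℝ G]
  {H : Type*} [NormedAddCommGroup H] [NormedSpace ℝ H]

/-- `g` is of class `C¹` on the closed rectangle. -/
abbrev C1 (ρ : ℝ) (g : ℝ × ℝ → F) : Prop := ContDiffOn ℝ 1 g (rect ρ)
/-- `g` is of class `C²` on the closed rectangle. -/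
abbrev C2 (ρ : ℝ) (g : ℝ × ℝ → F) : Prop := ContDiffOn ℝ 2 g (rect ρ)

lemma C2.c1 {g : ℝ × ℝ → F} (hg : C2 ρ g) : C1 ρ g := hg.of_le (by norm_num)

lemma C1.diff {g : ℝ × ℝ → F} (hg : C1 ρ g) {q : ℝ × ℝ} (hq : q ∈ rect ρ) :
    DifferentiableWithinAt ℝ g (rect ρ) q := hg.differentiableOn (by norm_num) q hq

lemma C1.continuousOn_fderivWithin (hρ : 0 < ρ) {g : ℝ × ℝ → F} (hg : C1 ρ g) :
    ContinuousOn (fderivWithin ℝ g (rect ρ)) (rect ρ) :=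
  ContDiffOn.continuousOn_fderivWithin hg (uniqueDiffOn_rect hρ) le_rfl

lemma C1.continuousOn_dy (hρ : 0 < ρ) {g : ℝ × ℝ → F} (hg : C1 ρ g) :
    ContinuousOn (dy ρ g) (rect ρ) :=
  (hg.continuousOn_fderivWithin hρ).clm_apply continuousOn_const
lemma C1.continuousOn_dz (hρ : 0 < ρ) {g : ℝ × ℝ → F} (hg : C1 ρ g) :
    ContinuousOn (dz ρ g) (rect ρ) :=
  (hg.continuousOn_fderivWithin hρ).clm_apply continuousOn_const

lemma C2.fderivWithin (hρ : 0 < ρ) {g : ℝ × ℝ → F} (hg : C2 ρ g) :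
    C1 ρ (fderivWithin ℝ g (rect ρ)) :=
  ContDiffOn.fderivWithin hg (uniqueDiffOn_rect hρ) (by norm_num)
lemma C2.dy (hρ : 0 < ρ) {g : ℝ × ℝ → F} (hg : C2 ρ g) : C1 ρ (dy ρ g) :=
  (hg.fderivWithin hρ).clm_apply contDiffOn_const
lemma C2.dz (hρ : 0 < ρ) {g : ℝ × ℝ → F} (hg : C2 ρ g) : C1 ρ (dz ρ g) :=
  (hg.fderivWithin hρ).clm_apply contDiffOn_const

lemma fderivWithin_eq_dy_dz (g : ℝ × ℝ → F) (q a : ℝ × ℝ) :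
    _root_.fderivWithin ℝ g (rect ρ) q a = a.1 • SoapFilm.dy ρ g q + a.2 • SoapFilm.dz ρ g q := by
  have : a = a.1 • ((1 : ℝ), (0 : ℝ)) + a.2 • ((0 : ℝ), (1 : ℝ)) := by ext <;> simp
  conv_lhs => rw [this]
  rw [map_add, map_smul, map_smul]; rfl

/-- Symmetry of the second derivative within a set holds at points in the closure of its interior,
and the closed rectangle is the closure of its interior, so edges and corners are included. -/
lemma dz_dy_eq_dy_dz (hρ : 0 < ρ) {g : ℝ × ℝ → F} (hg : C2 ρ g) {q : ℝ × ℝ} (hq : q ∈ rect ρ) :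
    dz ρ (dy ρ g) q = dy ρ (dz ρ g) q := by
  have hs := ContDiffWithinAt.isSymmSndFDerivWithinAt (hg q hq) (by simp)
    (uniqueDiffOn_rect hρ) (by rw [closure_interior_rect hρ]; exact hq) hq
  have hd := (hg.fderivWithin hρ).diff hq
  have key (a b : ℝ × ℝ) : _root_.fderivWithin ℝ
      (fun p => _root_.fderivWithin ℝ g (rect ρ) p a) (rect ρ) q b =
      _root_.fderivWithin ℝ (_root_.fderivWithin ℝ g (rect ρ)) (rect ρ) q b a := by
    rw [fderivWithin_clm_apply (uniqueDiffOn_rect hρ q hq) hd (differentiableWithinAt_const _)]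
    simp
  show _root_.fderivWithin ℝ (fun p => _root_.fderivWithin ℝ g (rect ρ) p (1, 0)) (rect ρ) q (0, 1)
    = _root_.fderivWithin ℝ (fun p => _root_.fderivWithin ℝ g (rect ρ) p (0, 1)) (rect ρ) q (1, 0)
  rw [key, key]
  exact hs.eq _ _

lemma dy_congr {u v : ℝ × ℝ → F} (h : EqOn u v (rect ρ)) {q : ℝ × ℝ} (hq : q ∈ rect ρ) :
    dy ρ u q = dy ρ v q := by
  unfold dy; rw [fderivWithin_congr h (h hq)]
lemma dz_congr {u v : ℝ × ℝ → F} (h : EqOn u v (rect ρ)) {q : ℝ × ℝ} (hq : q ∈ rect ρ) :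
    dz ρ u q = dz ρ v q := by
  unfold dz; rw [fderivWithin_congr h (h hq)]

lemma dy_const (c : F) (q : ℝ × ℝ) : dy ρ (fun _ => c) q = 0 := by simp [dy]
lemma dz_const (c : F) (q : ℝ × ℝ) : dz ρ (fun _ => c) q = 0 := by simp [dz]

lemma dy_bilin (hρ : 0 < ρ) (B : F →L[ℝ] G →L[ℝ] H) {u : ℝ × ℝ → F} {v : ℝ × ℝ → G}
    (hu : C1 ρ u) (hv : C1 ρ v) {q : ℝ × ℝ} (hq : q ∈ rect ρ) :
    dy ρ (fun p => B (u p) (v p)) q = B (dy ρ u q) (v q) + B (u q) (dy ρ v q) := by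
  unfold dy
  rw [B.fderivWithin_of_bilinear (hu.diff hq) (hv.diff hq) (uniqueDiffOn_rect hρ q hq)]
  simp [add_comm]
lemma dz_bilin (hρ : 0 < ρ) (B : F →L[ℝ] G →L[ℝ] H) {u : ℝ × ℝ → F} {v : ℝ × ℝ → G}
    (hu : C1 ρ u) (hv : C1 ρ v) {q : ℝ × ℝ} (hq : q ∈ rect ρ) :
    dz ρ (fun p => B (u p) (v p)) q = B (dz ρ u q) (v q) + B (u q) (dz ρ v q) := by
  unfold dz
  rw [B.fderivWithin_of_bilinear (hu.diff hq) (hv.diff hq) (uniqueDiffOn_rect hρ q hq)]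
  simp [add_comm]

lemma dy_clm (hρ : 0 < ρ) (B : F →L[ℝ] G) {u : ℝ × ℝ → F}
    (hu : C1 ρ u) {q : ℝ × ℝ} (hq : q ∈ rect ρ) :
    dy ρ (fun p => B (u p)) q = B (dy ρ u q) := by
  have := (B.hasFDerivAt.comp_hasFDerivWithinAt q (hu.diff hq).hasFDerivWithinAt).fderivWithin
    (uniqueDiffOn_rect hρ q hq)
  simpa [dy, Function.comp_def] using congrArg (fun l => l (1, 0)) this
lemma dz_clm (hρ : 0 < ρ) (B : F →L[ℝ] G) {u : ℝ × ℝ → F}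
    (hu : C1 ρ u) {q : ℝ × ℝ} (hq : q ∈ rect ρ) :
    dz ρ (fun p => B (u p)) q = B (dz ρ u q) := by
  have := (B.hasFDerivAt.comp_hasFDerivWithinAt q (hu.diff hq).hasFDerivWithinAt).fderivWithin
    (uniqueDiffOn_rect hρ q hq)
  simpa [dz, Function.comp_def] using congrArg (fun l => l (0, 1)) this

lemma dy_comp_real (hρ : 0 < ρ) {T : ℝ → F} {u : ℝ × ℝ → ℝ} {q : ℝ × ℝ} {T' : F}
    (hT : HasDerivAt T T' (u q)) (hu : C1 ρ u) (hq : q ∈ rect ρ) :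
    dy ρ (fun p => T (u p)) q = dy ρ u q • T' := by
  have := (hT.hasFDerivAt.comp_hasFDerivWithinAt q (hu.diff hq).hasFDerivWithinAt).fderivWithin
    (uniqueDiffOn_rect hρ q hq)
  simpa [dy, Function.comp_def] using congrArg (fun l => l (1, 0)) this
lemma dz_comp_real (hρ : 0 < ρ) {T : ℝ → F} {u : ℝ × ℝ → ℝ} {q : ℝ × ℝ} {T' : F}
    (hT : HasDerivAt T T' (u q)) (hu : C1 ρ u) (hq : q ∈ rect ρ) :
    dz ρ (fun p => T (u p)) q = dz ρ u q • T' := by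
  have := (hT.hasFDerivAt.comp_hasFDerivWithinAt q (hu.diff hq).hasFDerivWithinAt).fderivWithin
    (uniqueDiffOn_rect hρ q hq)
  simpa [dz, Function.comp_def] using congrArg (fun l => l (0, 1)) this

lemma dy_add (hρ : 0 < ρ) {u v : ℝ × ℝ → F} (hu : C1 ρ u) (hv : C1 ρ v) {q : ℝ × ℝ}
    (hq : q ∈ rect ρ) : dy ρ (fun p => u p + v p) q = dy ρ u q + dy ρ v q := by
  unfold dy
  rw [fderivWithin_fun_add (uniqueDiffOn_rect hρ q hq) (hu.diff hq) (hv.diff hq)]; rfl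
lemma dz_add (hρ : 0 < ρ) {u v : ℝ × ℝ → F} (hu : C1 ρ u) (hv : C1 ρ v) {q : ℝ × ℝ}
    (hq : q ∈ rect ρ) : dz ρ (fun p => u p + v p) q = dz ρ u q + dz ρ v q := by
  unfold dz
  rw [fderivWithin_fun_add (uniqueDiffOn_rect hρ q hq) (hu.diff hq) (hv.diff hq)]; rfl
lemma dy_sub (hρ : 0 < ρ) {u v : ℝ × ℝ → F} (hu : C1 ρ u) (hv : C1 ρ v) {q : ℝ × ℝ}
    (hq : q ∈ rect ρ) : dy ρ (fun p => u p - v p) q = dy ρ u q - dy ρ v q := by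
  unfold dy
  rw [fderivWithin_fun_sub (uniqueDiffOn_rect hρ q hq) (hu.diff hq) (hv.diff hq)]; rfl
lemma dz_sub (hρ : 0 < ρ) {u v : ℝ × ℝ → F} (hu : C1 ρ u) (hv : C1 ρ v) {q : ℝ × ℝ}
    (hq : q ∈ rect ρ) : dz ρ (fun p => u p - v p) q = dz ρ u q - dz ρ v q := by
  unfold dz
  rw [fderivWithin_fun_sub (uniqueDiffOn_rect hρ q hq) (hu.diff hq) (hv.diff hq)]; rfl

lemma dy_inner (hρ : 0 < ρ) {u v : ℝ × ℝ → E3} (hu : C1 ρ u) (hv : C1 ρ v) {q : ℝ × ℝ}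
    (hq : q ∈ rect ρ) : dy ρ (fun p => inner ℝ (u p) (v p)) q =
      inner ℝ (dy ρ u q) (v q) + inner ℝ (u q) (dy ρ v q) :=
  dy_bilin hρ (innerSL ℝ) hu hv hq
lemma dz_inner (hρ : 0 < ρ) {u v : ℝ × ℝ → E3} (hu : C1 ρ u) (hv : C1 ρ v) {q : ℝ × ℝ}
    (hq : q ∈ rect ρ) : dz ρ (fun p => inner ℝ (u p) (v p)) q =
      inner ℝ (dz ρ u q) (v q) + inner ℝ (u q) (dz ρ v q) :=
  dz_bilin hρ (innerSL ℝ) hu hv hq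
lemma dy_cross (hρ : 0 < ρ) {u v : ℝ × ℝ → E3} (hu : C1 ρ u) (hv : C1 ρ v) {q : ℝ × ℝ}
    (hq : q ∈ rect ρ) : dy ρ (fun p => cross (u p) (v p)) q =
      cross (dy ρ u q) (v q) + cross (u q) (dy ρ v q) := dy_bilin hρ crossL hu hv hq
lemma dz_cross (hρ : 0 < ρ) {u v : ℝ × ℝ → E3} (hu : C1 ρ u) (hv : C1 ρ v) {q : ℝ × ℝ}
    (hq : q ∈ rect ρ) : dz ρ (fun p => cross (u p) (v p)) q =
      cross (dz ρ u q) (v q) + cross (u q) (dz ρ v q) := dz_bilin hρ crossL hu hv hq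
lemma dy_smul (hρ : 0 < ρ) {u : ℝ × ℝ → ℝ} {v : ℝ × ℝ → F} (hu : C1 ρ u) (hv : C1 ρ v)
    {q : ℝ × ℝ} (hq : q ∈ rect ρ) : dy ρ (fun p => u p • v p) q =
      dy ρ u q • v q + u q • dy ρ v q :=
  dy_bilin hρ (ContinuousLinearMap.lsmul ℝ ℝ) hu hv hq
lemma dz_smul (hρ : 0 < ρ) {u : ℝ × ℝ → ℝ} {v : ℝ × ℝ → F} (hu : C1 ρ u) (hv : C1 ρ v)
    {q : ℝ × ℝ} (hq : q ∈ rect ρ) : dz ρ (fun p => u p • v p) q =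
      dz ρ u q • v q + u q • dz ρ v q :=
  dz_bilin hρ (ContinuousLinearMap.lsmul ℝ ℝ) hu hv hq
lemma dy_mul (hρ : 0 < ρ) {u v : ℝ × ℝ → ℝ} (hu : C1 ρ u) (hv : C1 ρ v) {q : ℝ × ℝ}
    (hq : q ∈ rect ρ) : dy ρ (fun p => u p * v p) q = dy ρ u q * v q + u q * dy ρ v q :=
  dy_bilin hρ (ContinuousLinearMap.mul ℝ ℝ) hu hv hq
lemma dz_mul (hρ : 0 < ρ) {u v : ℝ × ℝ → ℝ} (hu : C1 ρ u) (hv : C1 ρ v) {q : ℝ × ℝ}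
    (hq : q ∈ rect ρ) : dz ρ (fun p => u p * v p) q = dz ρ u q * v q + u q * dz ρ v q :=
  dz_bilin hρ (ContinuousLinearMap.mul ℝ ℝ) hu hv hq

lemma contDiffOn_cross {n : WithTop ℕ∞} {s : Set (ℝ × ℝ)} {u v : ℝ × ℝ → E3}
    (hu : ContDiffOn ℝ n u s) (hv : ContDiffOn ℝ n v s) :
    ContDiffOn ℝ n (fun p => cross (u p) (v p)) s :=
  (crossL.isBoundedBilinearMap.contDiff (n := n)).comp_contDiffOn (hu.prodMk hv)
lemma continuousOn_cross {X : Type*} [TopologicalSpace X] {s : Set X} {u v : X → E3}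
    (hu : ContinuousOn u s) (hv : ContinuousOn v s) :
    ContinuousOn (fun p => cross (u p) (v p)) s :=
  crossL.isBoundedBilinearMap.continuous.comp_continuousOn (hu.prodMk hv)
lemma continuousOn_tri {X : Type*} [TopologicalSpace X] {s : Set X} {u v w : X → E3}
    (hu : ContinuousOn u s) (hv : ContinuousOn v s) (hw : ContinuousOn w s) :
    ContinuousOn (fun p => tri (u p) (v p) (w p)) s :=
  hu.inner (continuousOn_cross hv hw)

/-! ### Restriction to segments -/

lemma hasDerivWithinAt_slice_z {g : ℝ × ℝ → F} (hg : C1 ρ g) {y z : ℝ}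
    (hy : y ∈ Icc (-1 : ℝ) 1) (hz : z ∈ Icc 0 ρ) :
    HasDerivWithinAt (fun s => g (y, s)) (dz ρ g (y, z)) (Icc 0 ρ) z := by
  have h := (hg.diff (q := (y, z)) ⟨hy, hz⟩).hasFDerivWithinAt
  have h2 : HasDerivWithinAt (fun s : ℝ => (y, s)) ((0 : ℝ), (1 : ℝ)) (Icc 0 ρ) z :=
    (hasDerivWithinAt_const _ _ _).prodMk (hasDerivWithinAt_id _ _)
  exact h.comp_hasDerivWithinAt z h2 (fun s (hs : s ∈ Icc 0 ρ) => show (y, s) ∈ rect ρ from ⟨hy, hs⟩)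
lemma hasDerivWithinAt_slice_y {g : ℝ × ℝ → F} (hg : C1 ρ g) {y z : ℝ}
    (hy : y ∈ Icc (-1 : ℝ) 1) (hz : z ∈ Icc 0 ρ) :
    HasDerivWithinAt (fun s => g (s, z)) (dy ρ g (y, z)) (Icc (-1) 1) y := by
  have h := (hg.diff (q := (y, z)) ⟨hy, hz⟩).hasFDerivWithinAt
  have h2 : HasDerivWithinAt (fun s : ℝ => (s, z)) ((1 : ℝ), (0 : ℝ)) (Icc (-1) 1) y :=
    (hasDerivWithinAt_id _ _).prodMk (hasDerivWithinAt_const _ _ _)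
  exact HasFDerivWithinAt.comp_hasDerivWithinAt (t := rect ρ) y h h2
    (fun s (hs : s ∈ Icc (-1 : ℝ) 1) => show (s, z) ∈ rect ρ from ⟨hs, hz⟩)
lemma hasDerivAt_slice_z {g : ℝ × ℝ → F} (hg : C1 ρ g) {y z : ℝ}
    (hy : y ∈ Icc (-1 : ℝ) 1) (hz : z ∈ Ioo 0 ρ) :
    HasDerivAt (fun s => g (y, s)) (dz ρ g (y, z)) z :=
  (hasDerivWithinAt_slice_z hg hy (Ioo_subset_Icc_self hz)).hasDerivAt
    (Icc_mem_nhds hz.1 hz.2)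

end Calculus

section Slices
variable {ρ : ℝ} {F : Type*} [NormedAddCommGroup F]

lemma continuousOn_slice_z {g : ℝ × ℝ → F} (hg : ContinuousOn g (rect ρ)) {y : ℝ}
    (hy : y ∈ Icc (-1 : ℝ) 1) : ContinuousOn (fun s => g (y, s)) (Icc 0 ρ) :=
  hg.comp (by fun_prop) (fun s hs => ⟨hy, hs⟩)
lemma continuousOn_slice_y {g : ℝ × ℝ → F} (hg : ContinuousOn g (rect ρ)) {z : ℝ}
    (hz : z ∈ Icc 0 ρ) : ContinuousOn (fun s => g (s, z)) (Icc (-1) 1) :=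
  hg.comp (by fun_prop) (fun s hs => ⟨hs, hz⟩)

lemma integrableOn_rect {u : ℝ × ℝ → F} (hu : ContinuousOn u (rect ρ)) :
    IntegrableOn u (rect ρ) := hu.integrableOn_compact (isCompact_rect ρ)

end Slices

/-! ### Approximation of `C¹` functions -/

section Approx
open scoped ContDiff Topology
variable {F : Type*} [NormedAddCommGroup F] [NormedSpace ℝ F] [CompleteSpace F]

/-- Mollification of a compactly supported `C¹` function on the plane. -/
lemma exists_contDiff_near_of_hasCompactSupport {g : ℝ × ℝ → F} (hg : ContDiff ℝ 1 g)
    (hs : HasCompactSupport g) {ε : ℝ} (hε : 0 < ε) :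
    ∃ u : ℝ × ℝ → F, ContDiff ℝ 2 u ∧
      ∀ x, ‖u x - g x‖ ≤ ε ∧ ‖fderiv ℝ u x - fderiv ℝ g x‖ ≤ ε := by
  have hgc := hg.continuous
  have hdc : Continuous (fderiv ℝ g) := hg.continuous_fderiv (by norm_num)
  obtain ⟨δ₁, hδ₁, h1⟩ := Metric.uniformContinuous_iff.1
    (hs.uniformContinuous_of_continuous hgc) ε hε
  obtain ⟨δ₂, hδ₂, h2⟩ := Metric.uniformContinuous_iff.1
    ((hs.fderiv ℝ).uniformContinuous_of_continuous hdc) ε hε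
  have hδ : 0 < min δ₁ δ₂ := lt_min hδ₁ hδ₂
  -- The radius of the mollifier is below the moduli of continuity of both g and its derivative for
  -- ε.
  let φ : ContDiffBump (0 : ℝ × ℝ) := ⟨min δ₁ δ₂ / 2, min δ₁ δ₂, half_pos hδ, half_lt_self hδ⟩
  have hφc : HasCompactSupport (φ.normed volume) := φ.hasCompactSupport_normed
  have hφd : ContDiff ℝ 2 (φ.normed volume) := φ.contDiff_normed
  refine ⟨convolution (φ.normed volume) g (ContinuousLinearMap.lsmul ℝ ℝ) volume, ?_, ?_⟩
  · exact hφc.contDiff_convolution_left (n := 2) _ hφd hgc.locallyIntegrable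
  · intro x
    constructor
    · rw [← dist_eq_norm]
      refine φ.dist_normed_convolution_le hgc.aestronglyMeasurable fun y hy => (h1 ?_).le
      exact lt_of_lt_of_le hy (min_le_left _ _)
    -- The derivative falls on g, so the estimate for values applies verbatim to the derivative.
    · have hd := hs.hasFDerivAt_convolution_right (ContinuousLinearMap.lsmul ℝ ℝ)
        (μ := volume) (hφd.continuous.locallyIntegrable) hg x
      rw [hd.fderiv]
      have : convolution (φ.normed volume) (fderiv ℝ g)
          (ContinuousLinearMap.precompR (ℝ × ℝ) (ContinuousLinearMap.lsmul ℝ ℝ)) volume x =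
          convolution (φ.normed volume) (fderiv ℝ g) (ContinuousLinearMap.lsmul ℝ ℝ) volume x := by
        unfold convolution
        congr 1
      rw [this, ← dist_eq_norm]
      refine φ.dist_normed_convolution_le hdc.aestronglyMeasurable fun y hy => (h2 ?_).le
      exact lt_of_lt_of_le hy (min_le_right _ _)

/-- A `C¹` function on the closed rectangle is, on the rectangle, a limit in `C¹` of functions of
class `C²` on the plane. -/
lemma exists_contDiff_near {ρ : ℝ} (hρ : 0 < ρ) {g : ℝ × ℝ → F} (hg : C1 ρ g) {ε : ℝ}
    (hε : 0 < ε) :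
    ∃ u : ℝ × ℝ → F, ContDiff ℝ 2 u ∧ ∀ q ∈ rect ρ, ‖u q - g q‖ ≤ ε ∧
      ‖fderiv ℝ u q - fderivWithin ℝ g (rect ρ) q‖ ≤ ε := by
  set D := fderivWithin ℝ g (rect ρ) with hD
  have hDc : ContinuousOn D (rect ρ) := hg.continuousOn_fderivWithin hρ
  obtain ⟨c, hc⟩ : (interior (rect ρ)).Nonempty := by
    rw [interior_rect]; exact ⟨(0, ρ / 2), by simp, by simp [hρ]⟩
  obtain ⟨M, hM⟩ := (isCompact_rect ρ).exists_bound_of_continuousOn hDc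
  obtain ⟨δ₁, hδ₁, h1⟩ := Metric.uniformContinuousOn_iff.1
    ((isCompact_rect ρ).uniformContinuousOn_of_continuous hg.continuousOn) (ε / 2) (half_pos hε)
  obtain ⟨δ₂, hδ₂, h2⟩ := Metric.uniformContinuousOn_iff.1
    ((isCompact_rect ρ).uniformContinuousOn_of_continuous hDc) (ε / 4) (by positivity)
  obtain ⟨R, hR⟩ := (isCompact_rect ρ).isBounded.subset_closedBall c
  have hlim : ∀ᶠ l : ℝ in 𝓝[<] 1, (1 - l) * R < δ₁ ∧ (1 - l) * R < δ₂ ∧ (1 - l) * M < ε / 4 ∧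
      0 < l := by
    have e (K d : ℝ) (hd : 0 < d) : ∀ᶠ l : ℝ in 𝓝[<] 1, (1 - l) * K < d := by
      have : Filter.Tendsto (fun l : ℝ => (1 - l) * K) (𝓝[<] 1) (𝓝 ((1 - 1) * K)) :=
        (Continuous.tendsto (by fun_prop) 1).mono_left nhdsWithin_le_nhds
      exact this.eventually_lt_const (by simpa using hd)
    have e0 : ∀ᶠ l : ℝ in 𝓝[<] 1, 0 < l :=
      nhdsWithin_le_nhds (lt_mem_nhds (by norm_num))
    filter_upwards [e R δ₁ hδ₁, e R δ₂ hδ₂, e M (ε / 4) (by positivity), e0] with l a b c d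
    exact ⟨a, b, c, d⟩
  obtain ⟨l, ⟨hl1, hl2, hl3, hl0⟩, hl⟩ := (hlim.and self_mem_nhdsWithin).exists
  have hl' : l < 1 := hl
  -- The homothety of ratio l < 1 about an interior point maps the closed rectangle into its
  -- interior. Thus g ∘ T is C¹ on a neighbourhood of the rectangle, with no extension of g across
  -- the boundary, and it is C¹-close to g for l close to 1.
  set T : ℝ × ℝ → ℝ × ℝ := fun q => (1 - l) • c + l • q with hT
  have hTc : ContDiff ℝ 1 T := contDiff_const.add (contDiff_id.const_smul l)
  have hTd (q) : HasFDerivAt T (l • ContinuousLinearMap.id ℝ (ℝ × ℝ)) q :=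
    ((hasFDerivAt_id q).const_smul l).const_add _
  have hTint {q} (hq : q ∈ rect ρ) : T q ∈ interior (rect ρ) :=
    (convex_rect ρ).combo_interior_self_mem_interior hc hq (by linarith) hl0.le (by ring)
  have hTdist {q} (hq : q ∈ rect ρ) : dist (T q) q ≤ (1 - l) * R := by
    have : T q - q = (1 - l) • (c - q) := by simp only [hT]; module
    rw [dist_eq_norm, this, norm_smul, Real.norm_of_nonneg (by linarith), ← dist_eq_norm, dist_comm]
    exact mul_le_mul_of_nonneg_left (hR hq) (by linarith)
  set U : Set (ℝ × ℝ) := T ⁻¹' interior (rect ρ) with hU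
  have hUo : IsOpen U := isOpen_interior.preimage hTc.continuous
  obtain ⟨r, hr, hrU⟩ := (isCompact_rect ρ).exists_cthickening_subset_open hUo fun q => hTint
  set K := Metric.cthickening r (rect ρ) with hK
  have hKc : IsCompact K := (isCompact_rect ρ).cthickening
  -- A cutoff equal to 1 near the rectangle turns g ∘ T into a compactly supported C¹ function on
  -- the plane, which can be mollified.
  obtain ⟨χ, hχ1, hχ0, -⟩ := exists_contMDiffMap_one_nhds_of_subset_interior
    (modelWithCornersSelf ℝ (ℝ × ℝ)) (n := ⊤) (isClosed_rect ρ) (t := K)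
    ((Metric.self_subset_thickening hr _).trans
      (interior_maximal (Metric.thickening_subset_cthickening _ _) Metric.isOpen_thickening))
  have hχd : ContDiff ℝ 1 χ := χ.contMDiff.contDiff.of_le (by exact_mod_cast le_top)
  have hχs : tsupport χ ⊆ K := closure_minimal
    (fun x hx => by by_contra h; exact hx (hχ0 x h)) hKc.isClosed
  set G : ℝ × ℝ → F := fun q => χ q • g (T q) with hG
  have hgT {q} (hq : q ∈ U) : ContDiffAt ℝ 1 (fun q => g (T q)) q :=
    ((hg (T q) (interior_subset hq)).contDiffAt
      (mem_interior_iff_mem_nhds.1 hq)).comp q hTc.contDiffAt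
  have hGd : ContDiff ℝ 1 G := by
    rw [contDiff_iff_contDiffAt]
    intro q
    by_cases hq : q ∈ U
    · exact hχd.contDiffAt.smul (hgT hq)
    · have : G =ᶠ[𝓝 q] fun _ => 0 := by
        have hq' : q ∉ tsupport χ := fun h => hq (hrU (hχs h))
        filter_upwards [notMem_tsupport_iff_eventuallyEq.1 hq'] with x hx
        simp [hG, hx]
      exact contDiffAt_const.congr_of_eventuallyEq this
  have hGs : HasCompactSupport G := HasCompactSupport.of_support_subset_isCompact hKc fun q hq => by
    by_contra h
    exact hq (by simp [hG, hχ0 q h])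
  obtain ⟨u, hu, hu2⟩ := exists_contDiff_near_of_hasCompactSupport hGd hGs
    (show 0 < ε / 2 by positivity)
  refine ⟨u, hu, fun q hq => ?_⟩
  have hGe : G =ᶠ[𝓝 q] fun q => g (T q) := by
    filter_upwards [(Filter.eventually_iff_exists_mem.1 hχ1).elim
      (fun s hs => Filter.mem_of_superset (mem_nhdsSet_iff_forall.1 hs.1 q hq) hs.2)] with x hx
    have : χ x = 1 := hx
    simp [hG, this]
  have hfd : fderiv ℝ G q = l • D (T q) := by
    rw [hGe.fderiv_eq]
    have h3 : HasFDerivAt g (D (T q)) (T q) :=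
      (hg.diff (interior_subset (hTint hq))).hasFDerivWithinAt.hasFDerivAt
        (mem_interior_iff_mem_nhds.1 (hTint hq))
    change fderiv ℝ (g ∘ T) q = _
    rw [(h3.comp q (hTd q)).fderiv]
    ext <;> simp
  constructor
  · have h3 := h1 _ (interior_subset (hTint hq)) q hq ((hTdist hq).trans_lt hl1)
    rw [dist_eq_norm] at h3
    have h4 := (hu2 q).1
    rw [hGe.self_of_nhds] at h4
    calc ‖u q - g q‖ = ‖(u q - g (T q)) + (g (T q) - g q)‖ := by congr 1; abel
      _ ≤ _ := norm_add_le _ _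
      _ ≤ ε := by linarith
  · have h3 := h2 _ (interior_subset (hTint hq)) q hq ((hTdist hq).trans_lt hl2)
    rw [dist_eq_norm] at h3
    have h4 := (hu2 q).2
    rw [hfd] at h4
    have h5 : ‖l • D (T q) - D (T q)‖ ≤ (1 - l) * M := by
      have : l • D (T q) - D (T q) = -((1 - l) • D (T q)) := by module
      rw [this, norm_neg, norm_smul, Real.norm_of_nonneg (by linarith)]
      exact mul_le_mul_of_nonneg_left (hM _ (interior_subset (hTint hq))) (by linarith)
    calc ‖fderiv ℝ u q - D q‖ = ‖(fderiv ℝ u q - l • D (T q)) + (l • D (T q) - D (T q)) +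
          (D (T q) - D q)‖ := by congr 1; abel
      _ ≤ _ := norm_add₃_le
      _ ≤ ε := by linarith

end Approx

/-! ### Bounded C¹ convergence and Green's theorem on the rectangle. -/

section Limits
open Filter
open scoped Topology
variable {ρ : ℝ} {F G H : Type*} [NormedAddCommGroup F] [NormedSpace ℝ F]
  [NormedAddCommGroup G] [NormedSpace ℝ G] [NormedAddCommGroup H] [NormedSpace ℝ H]

/-- Bounded pointwise convergence on the rectangle. -/
structure BddLim (ρ : ℝ) (u : ℕ → ℝ × ℝ → F) (g : ℝ × ℝ → F) : Prop where
  tendsto : ∀ q ∈ rect ρ, Tendsto (fun k => u k q) atTop (𝓝 (g q))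
  bound : ∃ M, ∀ k, ∀ q ∈ rect ρ, ‖u k q‖ ≤ M

lemma BddLim.const {g : ℝ × ℝ → F} (hg : ContinuousOn g (rect ρ)) : BddLim ρ (fun _ => g) g := by
  obtain ⟨M, hM⟩ := (isCompact_rect ρ).exists_bound_of_continuousOn hg
  exact ⟨fun q _ => tendsto_const_nhds, M, fun _ => hM⟩

lemma BddLim.bilin (B : F →L[ℝ] G →L[ℝ] H) {u : ℕ → ℝ × ℝ → F} {v : ℕ → ℝ × ℝ → G}
    {a : ℝ × ℝ → F} {b : ℝ × ℝ → G} (hu : BddLim ρ u a) (hv : BddLim ρ v b) :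
    BddLim ρ (fun k q => B (u k q) (v k q)) (fun q => B (a q) (b q)) := by
  obtain ⟨M, hM⟩ := hu.bound
  obtain ⟨N, hN⟩ := hv.bound
  refine ⟨fun q hq => ?_, ‖B‖ * M * N, fun k q hq => ?_⟩
  · exact (B.isBoundedBilinearMap.continuous.tendsto (a q, b q)).comp
      ((hu.tendsto q hq).prodMk_nhds (hv.tendsto q hq))
  · refine (B.le_opNorm₂ _ _).trans ?_
    have := (norm_nonneg (u k q)).trans (hM k q hq)
    gcongr
    exacts [hM k q hq, hN k q hq]

lemma BddLim.add {u v : ℕ → ℝ × ℝ → F} {a b : ℝ × ℝ → F} (hu : BddLim ρ u a)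
    (hv : BddLim ρ v b) : BddLim ρ (fun k q => u k q + v k q) (fun q => a q + b q) := by
  obtain ⟨M, hM⟩ := hu.bound
  obtain ⟨N, hN⟩ := hv.bound
  exact ⟨fun q hq => (hu.tendsto q hq).add (hv.tendsto q hq), M + N, fun k q hq =>
    (norm_add_le _ _).trans (add_le_add (hM k q hq) (hN k q hq))⟩

lemma BddLim.sub {u v : ℕ → ℝ × ℝ → F} {a b : ℝ × ℝ → F} (hu : BddLim ρ u a)
    (hv : BddLim ρ v b) : BddLim ρ (fun k q => u k q - v k q) (fun q => a q - b q) := by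
  obtain ⟨M, hM⟩ := hu.bound
  obtain ⟨N, hN⟩ := hv.bound
  exact ⟨fun q hq => (hu.tendsto q hq).sub (hv.tendsto q hq), M + N, fun k q hq =>
    (norm_sub_le _ _).trans (add_le_add (hM k q hq) (hN k q hq))⟩

lemma BddLim.mul {u v : ℕ → ℝ × ℝ → ℝ} {a b : ℝ × ℝ → ℝ} (hu : BddLim ρ u a)
    (hv : BddLim ρ v b) : BddLim ρ (fun k q => u k q * v k q) (fun q => a q * b q) :=
  hu.bilin (ContinuousLinearMap.mul ℝ ℝ) hv

lemma BddLim.inner {u v : ℕ → ℝ × ℝ → E3} {a b : ℝ × ℝ → E3} (hu : BddLim ρ u a)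
    (hv : BddLim ρ v b) : BddLim ρ (fun k q => inner ℝ (u k q) (v k q))
      (fun q => inner ℝ (a q) (b q)) :=
  hu.bilin (innerSL ℝ) hv

lemma BddLim.congr {u u' : ℕ → ℝ × ℝ → F} {a a' : ℝ × ℝ → F} (hu : BddLim ρ u a)
    (h : ∀ k, ∀ q ∈ rect ρ, u' k q = u k q) (h' : ∀ q ∈ rect ρ, a' q = a q) :
    BddLim ρ u' a' := by
  obtain ⟨M, hM⟩ := hu.bound
  refine ⟨fun q hq => ?_, M, fun k q hq => by rw [h k q hq]; exact hM k q hq⟩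
  simp only [h _ q hq, h' q hq]
  exact hu.tendsto q hq

lemma BddLim.integral {u : ℕ → ℝ × ℝ → F} {a : ℝ × ℝ → F} (hu : BddLim ρ u a)
    (hc : ∀ k, ContinuousOn (u k) (rect ρ)) :
    Tendsto (fun k => ∫ q in rect ρ, u k q) atTop (𝓝 (∫ q in rect ρ, a q)) := by
  obtain ⟨M, hM⟩ := hu.bound
  refine tendsto_integral_of_dominated_convergence (fun _ => M)
    (fun k => (hc k).aestronglyMeasurable (measurableSet_rect ρ))
    (continuousOn_const.integrableOn_compact (isCompact_rect ρ)) (fun k => ?_) ?_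
  · filter_upwards [ae_restrict_mem (measurableSet_rect ρ)] with q hq using hM k q hq
  · filter_upwards [ae_restrict_mem (measurableSet_rect ρ)] with q hq using hu.tendsto q hq

lemma BddLim.integral_z {u : ℕ → ℝ × ℝ → F} {a : ℝ × ℝ → F} (hu : BddLim ρ u a) (hρ : 0 < ρ)
    (hc : ∀ k, ContinuousOn (u k) (rect ρ)) {y : ℝ} (hy : y ∈ Icc (-1 : ℝ) 1) :
    Tendsto (fun k => ∫ s in (0 : ℝ)..ρ, u k (y, s)) atTop (𝓝 (∫ s in (0 : ℝ)..ρ, a (y, s))) := by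
  obtain ⟨M, hM⟩ := hu.bound
  have hm {s : ℝ} (hs : s ∈ uIoc 0 ρ) : (y, s) ∈ rect ρ := by
    rw [uIoc_of_le hρ.le] at hs; exact ⟨hy, hs.1.le, hs.2⟩
  refine intervalIntegral.tendsto_integral_filter_of_dominated_convergence (fun _ => M)
    (.of_forall fun k => ?_) (.of_forall fun k => ?_) intervalIntegrable_const ?_
  · rw [uIoc_of_le hρ.le]
    exact ((continuousOn_slice_z (hc k) hy).mono Ioc_subset_Icc_self).aestronglyMeasurable
      measurableSet_Ioc
  · exact .of_forall fun s hs => hM k _ (hm hs)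
  · exact .of_forall fun s hs => hu.tendsto _ (hm hs)

lemma BddLim.integral_y {u : ℕ → ℝ × ℝ → F} {a : ℝ × ℝ → F} (hu : BddLim ρ u a)
    (hc : ∀ k, ContinuousOn (u k) (rect ρ)) {z : ℝ} (hz : z ∈ Icc 0 ρ) :
    Tendsto (fun k => ∫ s in (-1 : ℝ)..1, u k (s, z)) atTop
      (𝓝 (∫ s in (-1 : ℝ)..1, a (s, z))) := by
  obtain ⟨M, hM⟩ := hu.bound
  have h1 : (-1 : ℝ) ≤ 1 := by norm_num
  have hm {s : ℝ} (hs : s ∈ uIoc (-1) 1) : (s, z) ∈ rect ρ := by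
    rw [uIoc_of_le h1] at hs; exact ⟨⟨hs.1.le, hs.2⟩, hz⟩
  refine intervalIntegral.tendsto_integral_filter_of_dominated_convergence (fun _ => M)
    (.of_forall fun k => ?_) (.of_forall fun k => ?_) intervalIntegrable_const ?_
  · rw [uIoc_of_le h1]
    exact ((continuousOn_slice_y (hc k) hz).mono Ioc_subset_Icc_self).aestronglyMeasurable
      measurableSet_Ioc
  · exact .of_forall fun s hs => hM k _ (hm hs)
  · exact .of_forall fun s hs => hu.tendsto _ (hm hs)

/-- Bounded pointwise convergence on the rectangle together with the first derivatives. -/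
structure C1Lim (ρ : ℝ) (u : ℕ → ℝ × ℝ → F) (g : ℝ × ℝ → F) : Prop where
  lim : BddLim ρ u g
  lim_dy : BddLim ρ (fun k => dy ρ (u k)) (dy ρ g)
  lim_dz : BddLim ρ (fun k => dz ρ (u k)) (dz ρ g)

lemma C1Lim.const (hρ : 0 < ρ) {g : ℝ × ℝ → F} (hg : C1 ρ g) : C1Lim ρ (fun _ => g) g :=
  ⟨.const hg.continuousOn, .const (hg.continuousOn_dy hρ), .const (hg.continuousOn_dz hρ)⟩

lemma C1Lim.bilin (hρ : 0 < ρ) (B : F →L[ℝ] G →L[ℝ] H) {u : ℕ → ℝ × ℝ → F} {v : ℕ → ℝ × ℝ → G}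
    {a : ℝ × ℝ → F} {b : ℝ × ℝ → G} (hu : C1Lim ρ u a) (hv : C1Lim ρ v b)
    (hu' : ∀ k, C1 ρ (u k)) (hv' : ∀ k, C1 ρ (v k)) (ha : C1 ρ a) (hb : C1 ρ b) :
    C1Lim ρ (fun k q => B (u k q) (v k q)) (fun q => B (a q) (b q)) where
  lim := hu.lim.bilin B hv.lim
  lim_dy := ((hu.lim_dy.bilin B hv.lim).add (hu.lim.bilin B hv.lim_dy)).congr
    (fun k _ hq => dy_bilin hρ B (hu' k) (hv' k) hq) (fun _ hq => dy_bilin hρ B ha hb hq)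
  lim_dz := ((hu.lim_dz.bilin B hv.lim).add (hu.lim.bilin B hv.lim_dz)).congr
    (fun k _ hq => dz_bilin hρ B (hu' k) (hv' k) hq) (fun _ hq => dz_bilin hρ B ha hb hq)

lemma C1Lim.sub (hρ : 0 < ρ) {u v : ℕ → ℝ × ℝ → F} {a b : ℝ × ℝ → F} (hu : C1Lim ρ u a)
    (hv : C1Lim ρ v b) (hu' : ∀ k, C1 ρ (u k)) (hv' : ∀ k, C1 ρ (v k)) (ha : C1 ρ a)
    (hb : C1 ρ b) : C1Lim ρ (fun k q => u k q - v k q) (fun q => a q - b q) where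
  lim := hu.lim.sub hv.lim
  lim_dy := (hu.lim_dy.sub hv.lim_dy).congr
    (fun k _ hq => dy_sub hρ (hu' k) (hv' k) hq) (fun _ hq => dy_sub hρ ha hb hq)
  lim_dz := (hu.lim_dz.sub hv.lim_dz).congr
    (fun k _ hq => dz_sub hρ (hu' k) (hv' k) hq) (fun _ hq => dz_sub hρ ha hb hq)

lemma C1Lim.congr {u : ℕ → ℝ × ℝ → F} {a a' : ℝ × ℝ → F} (hu : C1Lim ρ u a)
    (h : EqOn a' a (rect ρ)) : C1Lim ρ u a' :=
  ⟨hu.lim.congr (fun _ _ _ => rfl) h, hu.lim_dy.congr (fun _ _ _ => rfl) fun _ hq => dy_congr h hq,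
    hu.lim_dz.congr (fun _ _ _ => rfl) fun _ hq => dz_congr h hq⟩

/-- The approximants are C² on the whole plane, so composing them with affine maps or correcting
them on edges keeps them C². This is how the merely C¹ fields, the unit normal above all, are
handled. -/
lemma exists_c1Lim [CompleteSpace F] (hρ : 0 < ρ) {g : ℝ × ℝ → F} (hg : C1 ρ g) :
    ∃ u : ℕ → ℝ × ℝ → F, (∀ k, ContDiff ℝ 2 (u k)) ∧ C1Lim ρ u g := by
  have hpos (k : ℕ) : (0 : ℝ) < 1 / ((k : ℝ) + 1) := Nat.one_div_pos_of_nat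
  choose u hu hu2 using fun k : ℕ => exists_contDiff_near hρ hg (hpos k)
  have key {X : Type _} [NormedAddCommGroup X] [NormedSpace ℝ X] {v : ℕ → ℝ × ℝ → X}
      {w : ℝ × ℝ → X} (hw : ContinuousOn w (rect ρ))
      (h : ∀ k : ℕ, ∀ q ∈ rect ρ, ‖v k q - w q‖ ≤ 1 / ((k : ℝ) + 1)) : BddLim ρ v w := by
    obtain ⟨M, hM⟩ := (isCompact_rect ρ).exists_bound_of_continuousOn hw
    refine ⟨fun q hq => ?_, M + 1, fun k q hq => ?_⟩
    · rw [tendsto_iff_norm_sub_tendsto_zero]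
      exact squeeze_zero (fun _ => norm_nonneg _) (fun k => h k q hq)
        tendsto_one_div_add_atTop_nhds_zero_nat
    · have h1 : 1 / ((k : ℝ) + 1) ≤ 1 := by
        rw [div_le_one (by positivity)]; linarith [k.cast_nonneg (α := ℝ)]
      calc ‖v k q‖ = ‖w q + (v k q - w q)‖ := by congr 1; abel
        _ ≤ _ := norm_add_le _ _
        _ ≤ M + 1 := add_le_add (hM q hq) ((h k q hq).trans h1)
  have hd (k : ℕ) (q) (hq : q ∈ rect ρ) (e : ℝ × ℝ) (he : ‖e‖ ≤ 1) :
      ‖fderivWithin ℝ (u k) (rect ρ) q e - fderivWithin ℝ g (rect ρ) q e‖ ≤ 1 / ((k : ℝ) + 1) := by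
    have h1 : fderivWithin ℝ (u k) (rect ρ) q = fderiv ℝ (u k) q :=
      fderivWithin_eq_fderiv (uniqueDiffOn_rect hρ q hq)
        ((hu k).differentiable (by norm_num) q)
    rw [h1, ← sub_apply]
    refine (ContinuousLinearMap.le_opNorm _ _).trans ?_
    calc _ ≤ 1 / ((k : ℝ) + 1) * 1 := by
          gcongr
          exact (hu2 k q hq).2
      _ = _ := mul_one _
  exact ⟨u, hu, key hg.continuousOn fun k q hq => (hu2 k q hq).1,
    key (hg.continuousOn_dy hρ) fun k q hq => hd k q hq (1, 0) (by simp [Prod.norm_def]),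
    key (hg.continuousOn_dz hρ) fun k q hq => hd k q hq (0, 1) (by simp [Prod.norm_def])⟩

/-- The line integral `∮ u · dw` around the rectangle, counter-clockwise. -/
def bdryIntegral (ρ : ℝ) (u w : ℝ × ℝ → E3) : ℝ :=
  (∫ s in (0 : ℝ)..ρ, inner ℝ (u (1, s)) (dz ρ w (1, s)))
    - (∫ s in (0 : ℝ)..ρ, inner ℝ (u (-1, s)) (dz ρ w (-1, s)))
    - (∫ s in (-1 : ℝ)..1, inner ℝ (u (s, ρ)) (dy ρ w (s, ρ)))
    + ∫ s in (-1 : ℝ)..1, inner ℝ (u (s, 0)) (dy ρ w (s, 0))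

/-- Divergence theorem for the field (u · w_z, -u · w_y). The two terms with mixed derivatives of w
cancel; this is the only use of the second derivatives of w. -/
lemma integral_green_of_c2 (hρ : 0 < ρ) {u w : ℝ × ℝ → E3} (hu : C1 ρ u) (hw : C2 ρ w) :
    ∫ q in rect ρ, (inner ℝ (dy ρ u q) (dz ρ w q) - inner ℝ (dz ρ u q) (dy ρ w q)) =
      bdryIntegral ρ u w := by
  have hP : C1 ρ (fun q => inner ℝ (u q) (dz ρ w q)) := hu.inner ℝ (hw.dz hρ)
  have hQ : C1 ρ (fun q => -inner ℝ (u q) (dy ρ w q)) := (hu.inner ℝ (hw.dy hρ)).neg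
  have hint {v : ℝ × ℝ → ℝ} (hv : C1 ρ v) (q) (hq : q ∈ Ioo (-1 : ℝ) 1 ×ˢ Ioo 0 ρ) :
      HasFDerivAt v (fderivWithin ℝ v (rect ρ) q) q := by
    rw [← interior_rect] at hq
    exact (hv.diff (interior_subset hq)).hasFDerivWithinAt.hasFDerivAt
      (mem_interior_iff_mem_nhds.1 hq)
  have h := integral_divergence_prod_Icc_of_hasFDerivAt_of_le _ _ _ _ ((-1 : ℝ), (0 : ℝ))
    ((1 : ℝ), ρ) ⟨by norm_num, hρ.le⟩ (by rw [← rect_eq_Icc]; exact hP.continuousOn)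
    (by rw [← rect_eq_Icc]; exact hQ.continuousOn) (hint hP) (hint hQ)
    (by
      rw [← rect_eq_Icc]
      exact integrableOn_rect ((hP.continuousOn_dy hρ).add (hQ.continuousOn_dz hρ)))
  rw [← rect_eq_Icc] at h
  have h2 : ∫ q in rect ρ, (inner ℝ (dy ρ u q) (dz ρ w q) - inner ℝ (dz ρ u q) (dy ρ w q)) =
      ∫ q in rect ρ, (dy ρ (fun q => inner ℝ (u q) (dz ρ w q)) q +
        dz ρ (fun q => -inner ℝ (u q) (dy ρ w q)) q) := by
    refine setIntegral_congr_fun (measurableSet_rect ρ) fun q hq => ?_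
    have e : dz ρ (fun q => -inner ℝ (u q) (dy ρ w q)) q =
        -dz ρ (fun q => inner ℝ (u q) (dy ρ w q)) q := by
      simp only [dz]
      rw [fderivWithin_fun_neg (uniqueDiffOn_rect hρ q hq)]; rfl
    simp only [e]
    rw [dy_inner hρ hu (hw.dz hρ) hq, dz_inner hρ hu (hw.dy hρ) hq, dz_dy_eq_dy_dz hρ hw hq]
    ring
  rw [h2]
  refine h.trans ?_
  simp only [bdryIntegral, intervalIntegral.integral_neg]
  ring

/-- Green's theorem for the rectangle: both factors need only be of class `C¹`. -/
lemma integral_green (hρ : 0 < ρ) {u w : ℝ × ℝ → E3} (hu : C1 ρ u) (hw : C1 ρ w) :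
    ∫ q in rect ρ, (inner ℝ (dy ρ u q) (dz ρ w q) - inner ℝ (dz ρ u q) (dy ρ w q)) =
      bdryIntegral ρ u w := by
  -- Both sides contain only first derivatives of w and pass to the limit. The gain matters because
  -- the theorem is applied with w the unit normal.
  obtain ⟨v, hv, hlim⟩ := exists_c1Lim hρ hw
  have hv2 (k) : C2 ρ (v k) := (hv k).contDiffOn
  have cuy := BddLim.const (hu.continuousOn_dy hρ)
  have cuz := BddLim.const (hu.continuousOn_dz hρ)
  have cu := BddLim.const hu.continuousOn
  have l1 := ((cuy.inner hlim.lim_dz).sub (cuz.inner hlim.lim_dy)).integral fun k =>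
    ((hu.continuousOn_dy hρ).inner ((hv2 k).c1.continuousOn_dz hρ)).sub
      ((hu.continuousOn_dz hρ).inner ((hv2 k).c1.continuousOn_dy hρ))
  have hcz (k) := hu.continuousOn.inner (𝕜 := ℝ) ((hv2 k).c1.continuousOn_dz hρ)
  have hcy (k) := hu.continuousOn.inner (𝕜 := ℝ) ((hv2 k).c1.continuousOn_dy hρ)
  have l2 : Tendsto (fun k => bdryIntegral ρ u (v k)) atTop (𝓝 (bdryIntegral ρ u w)) :=
    ((((cu.inner hlim.lim_dz).integral_z hρ hcz (y := 1) (by simp)).sub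
      ((cu.inner hlim.lim_dz).integral_z hρ hcz (y := -1) (by simp))).sub
      ((cu.inner hlim.lim_dy).integral_y hcy (z := ρ) ⟨hρ.le, le_rfl⟩)).add
      ((cu.inner hlim.lim_dy).integral_y hcy (z := 0) ⟨le_rfl, hρ.le⟩)
  refine tendsto_nhds_unique l1 (l2.congr fun k => ?_)
  exact (integral_green_of_c2 hρ hu (hv2 k)).symm

end Limits

/-! ### Differentiation of integrals over the rectangle with respect to a parameter -/

section Parameter
open Filter
open scoped Topology
variable {ρ a b : ℝ} {F : Type*} [NormedAddCommGroup F] [NormedSpace ℝ F]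

lemma continuousOn_param_left {Φ : ℝ → ℝ × ℝ → F}
    (hc : ContinuousOn (fun x : ℝ × ℝ × ℝ => Φ x.1 x.2) (Ioo a b ×ˢ rect ρ)) {q : ℝ × ℝ}
    (hq : q ∈ rect ρ) : ContinuousOn (fun t => Φ t q) (Ioo a b) :=
  hc.comp (f := fun t : ℝ => (t, q)) (by fun_prop) fun t ht => ⟨ht, hq⟩

lemma continuousOn_param_right {Φ : ℝ → ℝ × ℝ → F}
    (hc : ContinuousOn (fun x : ℝ × ℝ × ℝ => Φ x.1 x.2) (Ioo a b ×ˢ rect ρ)) {t : ℝ}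
    (ht : t ∈ Ioo a b) : ContinuousOn (Φ t) (rect ρ) :=
  hc.comp (f := fun q : ℝ × ℝ => (t, q)) (by fun_prop) fun q hq => ⟨ht, hq⟩

/-- A smaller compact interval of parameters times the compact rectangle provides the constant
dominating bound. The pointwise derivative is required only in the interior because the boundary is
null. -/
lemma hasDerivAt_integral_rect {Φ Φ' : ℝ → ℝ × ℝ → ℝ}
    (hc : ContinuousOn (fun x : ℝ × ℝ × ℝ => Φ x.1 x.2) (Ioo a b ×ˢ rect ρ))
    (hc' : ContinuousOn (fun x : ℝ × ℝ × ℝ => Φ' x.1 x.2) (Ioo a b ×ˢ rect ρ))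
    (hd : ∀ t ∈ Ioo a b, ∀ q ∈ interior (rect ρ), HasDerivAt (fun s => Φ s q) (Φ' t q) t)
    {t : ℝ} (ht : t ∈ Ioo a b) :
    HasDerivAt (fun s => ∫ q in rect ρ, Φ s q) (∫ q in rect ρ, Φ' t q) t := by
  obtain ⟨a', ha'⟩ := exists_between ht.1
  obtain ⟨b', hb'⟩ := exists_between ht.2
  have hsub : Icc a' b' ⊆ Ioo a b := Icc_subset_Ioo ha'.1 hb'.2
  obtain ⟨M, hM⟩ := (isCompact_Icc.prod (isCompact_rect ρ)).exists_bound_of_continuousOn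
    (hc'.mono (prod_mono hsub subset_rfl))
  have hnhds : Ioo a' b' ∈ 𝓝 t := Ioo_mem_nhds ha'.2 hb'.1
  refine (hasDerivAt_integral_of_dominated_loc_of_deriv_le (F' := Φ') (bound := fun _ => M) hnhds
    ?_ (integrableOn_rect (continuousOn_param_right hc ht))
    ((continuousOn_param_right hc' ht).aestronglyMeasurable (measurableSet_rect ρ)) ?_
    (continuousOn_const.integrableOn_compact (isCompact_rect ρ)) ?_).2
  · filter_upwards [hnhds] with s hs
    exact (continuousOn_param_right hc (hsub (Ioo_subset_Icc_self hs))).aestronglyMeasurable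
      (measurableSet_rect ρ)
  · filter_upwards [ae_restrict_mem (measurableSet_rect ρ)] with q hq s hs
    exact hM (s, q) ⟨Ioo_subset_Icc_self hs, hq⟩
  · filter_upwards [ae_mem_interior_rect ρ] with q hq s hs
    exact hd s (hsub (Ioo_subset_Icc_self hs)) q hq

/-- The parameter derivative and the spatial derivative commute. -/
lemma hasDerivAt_fderivWithin_param [CompleteSpace F] {G G' : ℝ → ℝ × ℝ → F}
    (hG : ∀ t ∈ Ioo a b, ∀ q ∈ rect ρ, HasDerivAt (fun s => G s q) (G' t q) t)
    (hd : ∀ t ∈ Ioo a b, C1 ρ (G t)) (hd' : ∀ t ∈ Ioo a b, C1 ρ (G' t))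
    (hc : ContinuousOn (fun x : ℝ × ℝ × ℝ => G' x.1 x.2) (Ioo a b ×ˢ rect ρ))
    (hc' : ContinuousOn (fun x : ℝ × ℝ × ℝ => fderivWithin ℝ (G' x.1) (rect ρ) x.2)
      (Ioo a b ×ˢ rect ρ)) {t : ℝ} (ht : t ∈ Ioo a b) {q : ℝ × ℝ} (hq : q ∈ interior (rect ρ)) :
    HasDerivAt (fun s => fderivWithin ℝ (G s) (rect ρ) q) (fderivWithin ℝ (G' t) (rect ρ) q) t := by
  have hint {v : ℝ × ℝ → F} (hv : C1 ρ v) {p} (hp : p ∈ interior (rect ρ)) :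
      HasFDerivAt v (fderivWithin ℝ v (rect ρ) p) p :=
    (hv.diff (interior_subset hp)).hasFDerivWithinAt.hasFDerivAt (mem_interior_iff_mem_nhds.1 hp)
  have hcq := continuousOn_param_left (Φ := fun s p => fderivWithin ℝ (G' s) (rect ρ) p) hc'
    (interior_subset hq)
  -- Integrate G' in the parameter and differentiate the integral in space: the spatial derivative
  -- of G then satisfies the fundamental theorem of calculus in s, with integrand the spatial
  -- derivative of G'.
  have key (s : ℝ) (hs : s ∈ Ioo a b) : fderivWithin ℝ (G s) (rect ρ) q =
      fderivWithin ℝ (G t) (rect ρ) q + ∫ r in t..s, fderivWithin ℝ (G' r) (rect ρ) q := by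
    have hsub : uIcc t s ⊆ Ioo a b := ordConnected_Ioo.uIcc_subset ht hs
    obtain ⟨M, hM⟩ := (isCompact_uIcc.prod (isCompact_rect ρ)).exists_bound_of_continuousOn
      (hc'.mono (prod_mono hsub subset_rfl))
    have hGi (p) (hp : p ∈ rect ρ) : ContinuousOn (fun r => G' r p) (uIcc t s) :=
      (continuousOn_param_left hc hp).mono hsub
    have h1 : HasFDerivAt (fun p => ∫ r in t..s, G' r p)
        (∫ r in t..s, fderivWithin ℝ (G' r) (rect ρ) q) q := by
      refine intervalIntegral.hasFDerivAt_integral_of_dominated_of_fderiv_le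
        (F := fun p r => G' r p) (F' := fun p r => fderivWithin ℝ (G' r) (rect ρ) p)
        (s := interior (rect ρ)) (bound := fun _ => M) (isOpen_interior.mem_nhds hq) ?_
        (hGi q (interior_subset hq)).intervalIntegrable ?_ ?_ intervalIntegrable_const ?_
      · filter_upwards [isOpen_interior.mem_nhds hq] with p hp
        exact ((hGi p (interior_subset hp)).mono uIoc_subset_uIcc).aestronglyMeasurable
          measurableSet_uIoc
      · exact (hcq.mono (uIoc_subset_uIcc.trans hsub)).aestronglyMeasurable measurableSet_uIoc
      · exact .of_forall fun r hr p hp => hM (r, p) ⟨uIoc_subset_uIcc hr, interior_subset hp⟩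
      · exact .of_forall fun r hr p hp => hint (hd' r (hsub (uIoc_subset_uIcc hr))) hp
    have h2 := (hint (hd t ht) hq).add h1
    refine (hint (hd s hs) hq).unique (h2.congr_of_eventuallyEq ?_)
    filter_upwards [isOpen_interior.mem_nhds hq] with p hp
    have := intervalIntegral.integral_eq_sub_of_hasDerivAt
      (fun r hr => hG r (hsub hr) p (interior_subset hp))
      (hGi p (interior_subset hp)).intervalIntegrable
    simp [this]
  have h3 : HasDerivAt (fun s => ∫ r in t..s, fderivWithin ℝ (G' r) (rect ρ) q)
      (fderivWithin ℝ (G' t) (rect ρ) q) t :=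
    intervalIntegral.integral_hasDerivAt_right (by simp)
      (hcq.stronglyMeasurableAtFilter isOpen_Ioo t ht) (hcq.continuousAt (Ioo_mem_nhds ht.1 ht.2))
  refine (h3.const_add (fderivWithin ℝ (G t) (rect ρ) q)).congr_of_eventuallyEq ?_
  filter_upwards [Ioo_mem_nhds ht.1 ht.2] with s hs using key s hs

end Parameter

/-! ### The first two derivatives of the energy along a C² family. -/

section Energy
open Filter
open scoped Topology
variable {ρ a b : ℝ}

/-- The derivatives in the parameter of a `C²` family, as in `IsC2Family`. -/
structure C2Jet (ρ a b : ℝ) (G : ℕ → ℝ → ℝ × ℝ → E3) : Prop where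
  hasDerivAt : ∀ i < 2, ∀ t ∈ Ioo a b, ∀ q ∈ rect ρ,
    HasDerivAt (fun s => G i s q) (G (i + 1) t q) t
  c2 : ∀ i ≤ 2, ∀ t ∈ Ioo a b, C2 ρ (G i t)
  cont : ∀ i ≤ 2, ∀ j ≤ 2, ContinuousOn
      (fun x : ℝ × ℝ × ℝ => iteratedFDerivWithin ℝ j (G i x.1) (rect ρ) x.2) (Ioo a b ×ˢ rect ρ)

lemma IsC2Family.exists_jet {F : ℝ → ℝ × ℝ → E3} (h : IsC2Family ρ a b F) :
    ∃ G, C2Jet ρ a b G ∧ G 0 = F := by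
  obtain ⟨G, h0, h1, h2, h3⟩ := h
  exact ⟨G, ⟨h1, h2, h3⟩, h0⟩

variable {G : ℕ → ℝ → ℝ × ℝ → E3}

lemma C2Jet.continuousOn (hG : C2Jet ρ a b G) {i : ℕ} (hi : i ≤ 2) :
    ContinuousOn (fun x : ℝ × ℝ × ℝ => G i x.1 x.2) (Ioo a b ×ˢ rect ρ) :=
  ((ContinuousMultilinearMap.apply ℝ (fun _ : Fin 0 => ℝ × ℝ) E3 0).continuous.comp_continuousOn
    (hG.cont i hi 0 (by norm_num))).congr fun x hx => by simp [iteratedFDerivWithin_zero_apply]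

lemma C2Jet.continuousOn_fderivWithin_apply (hρ : 0 < ρ) (hG : C2Jet ρ a b G) {i : ℕ} (hi : i ≤ 2)
    (e : ℝ × ℝ) : ContinuousOn (fun x : ℝ × ℝ × ℝ => fderivWithin ℝ (G i x.1) (rect ρ) x.2 e)
      (Ioo a b ×ˢ rect ρ) :=
  ((ContinuousMultilinearMap.apply ℝ (fun _ : Fin 1 => ℝ × ℝ) E3 fun _ => e).continuous
    |>.comp_continuousOn (hG.cont i hi 1 (by norm_num))).congr fun x hx => by
      simp [iteratedFDerivWithin_one_apply (uniqueDiffOn_rect hρ x.2 hx.2)]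

lemma C2Jet.continuousOn_dy (hρ : 0 < ρ) (hG : C2Jet ρ a b G) {i : ℕ} (hi : i ≤ 2) :
    ContinuousOn (fun x : ℝ × ℝ × ℝ => dy ρ (G i x.1) x.2) (Ioo a b ×ˢ rect ρ) :=
  hG.continuousOn_fderivWithin_apply hρ hi (1, 0)
lemma C2Jet.continuousOn_dz (hρ : 0 < ρ) (hG : C2Jet ρ a b G) {i : ℕ} (hi : i ≤ 2) :
    ContinuousOn (fun x : ℝ × ℝ × ℝ => dz ρ (G i x.1) x.2) (Ioo a b ×ˢ rect ρ) :=
  hG.continuousOn_fderivWithin_apply hρ hi (0, 1)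

lemma C2Jet.continuousOn_fderivWithin (hρ : 0 < ρ) (hG : C2Jet ρ a b G) {i : ℕ} (hi : i ≤ 2) :
    ContinuousOn (fun x : ℝ × ℝ × ℝ => fderivWithin ℝ (G i x.1) (rect ρ) x.2)
      (Ioo a b ×ˢ rect ρ) := by
  have h (x : ℝ × ℝ × ℝ) : fderivWithin ℝ (G i x.1) (rect ρ) x.2 =
      ContinuousLinearMap.smulRightL ℝ (ℝ × ℝ) E3 (ContinuousLinearMap.fst ℝ ℝ ℝ)
        (dy ρ (G i x.1) x.2) +
      ContinuousLinearMap.smulRightL ℝ (ℝ × ℝ) E3 (ContinuousLinearMap.snd ℝ ℝ ℝ)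
        (dz ρ (G i x.1) x.2) := by
    refine ContinuousLinearMap.ext fun e => ?_
    rw [fderivWithin_eq_dy_dz]
    rfl
  simp only [h]
  exact ((ContinuousLinearMap.continuous _).comp_continuousOn (hG.continuousOn_dy hρ hi)).add
    ((ContinuousLinearMap.continuous _).comp_continuousOn (hG.continuousOn_dz hρ hi))

lemma C2Jet.hasDerivAt_fderivWithin (hρ : 0 < ρ) (hG : C2Jet ρ a b G) {i : ℕ} (hi : i < 2)
    {t : ℝ} (ht : t ∈ Ioo a b) {q : ℝ × ℝ} (hq : q ∈ interior (rect ρ)) :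
    HasDerivAt (fun s => fderivWithin ℝ (G i s) (rect ρ) q)
      (fderivWithin ℝ (G (i + 1) t) (rect ρ) q) t :=
  hasDerivAt_fderivWithin_param (hG.hasDerivAt i hi) (fun t ht => (hG.c2 i (by omega) t ht).c1)
    (fun t ht => (hG.c2 (i + 1) (by omega) t ht).c1) (hG.continuousOn (by omega))
    (hG.continuousOn_fderivWithin hρ (by omega)) ht hq

lemma C2Jet.hasDerivAt_dy (hρ : 0 < ρ) (hG : C2Jet ρ a b G) {i : ℕ} (hi : i < 2)
    {t : ℝ} (ht : t ∈ Ioo a b) {q : ℝ × ℝ} (hq : q ∈ interior (rect ρ)) :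
    HasDerivAt (fun s => dy ρ (G i s) q) (dy ρ (G (i + 1) t) q) t := by
  have h := (hG.hasDerivAt_fderivWithin hρ hi ht hq).clm_apply (hasDerivAt_const t ((1, 0) : ℝ × ℝ))
  rw [map_zero, add_zero] at h
  exact h
lemma C2Jet.hasDerivAt_dz (hρ : 0 < ρ) (hG : C2Jet ρ a b G) {i : ℕ} (hi : i < 2)
    {t : ℝ} (ht : t ∈ Ioo a b) {q : ℝ × ℝ} (hq : q ∈ interior (rect ρ)) :
    HasDerivAt (fun s => dz ρ (G i s) q) (dz ρ (G (i + 1) t) q) t := by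
  have h := (hG.hasDerivAt_fderivWithin hρ hi ht hq).clm_apply (hasDerivAt_const t ((0, 1) : ℝ × ℝ))
  rw [map_zero, add_zero] at h
  exact h

lemma hasDerivAt_cross {u v : ℝ → E3} {u' v' : E3} {t : ℝ} (hu : HasDerivAt u u' t)
    (hv : HasDerivAt v v' t) :
    HasDerivAt (fun s => cross (u s) (v s)) (cross u' (v t) + cross (u t) v') t := by
  have := (crossL.hasFDerivAt_of_bilinear hu.hasFDerivAt hv.hasFDerivAt).hasDerivAt
  simpa [add_comm] using this

lemma hasDerivAt_norm {u : ℝ → E3} {u' : E3} {t : ℝ} (hu : HasDerivAt u u' t) (h0 : u t ≠ 0) :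
    HasDerivAt (fun s => ‖u s‖) (inner ℝ (u t) u' / ‖u t‖) t := by
  have h1 := hu.norm_sq.sqrt (by simpa using h0)
  simp only [norm_nonneg, Real.sqrt_sq] at h1
  convert h1 using 1
  field_simp

/-- The (non-normalized) normal `F_y × F_z` of the members of a family, and its derivatives. -/
def normalJet (ρ : ℝ) (G : ℕ → ℝ → ℝ × ℝ → E3) : ℕ → ℝ → ℝ × ℝ → E3
  | 0, t, q => cross (dy ρ (G 0 t) q) (dz ρ (G 0 t) q)
  | 1, t, q => cross (dy ρ (G 1 t) q) (dz ρ (G 0 t) q) + cross (dy ρ (G 0 t) q) (dz ρ (G 1 t) q)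
  | _, t, q => (cross (dy ρ (G 2 t) q) (dz ρ (G 0 t) q) + cross (dy ρ (G 1 t) q) (dz ρ (G 1 t) q))
      + (cross (dy ρ (G 1 t) q) (dz ρ (G 1 t) q) + cross (dy ρ (G 0 t) q) (dz ρ (G 2 t) q))

lemma C2Jet.continuousOn_normalJet (hρ : 0 < ρ) (hG : C2Jet ρ a b G) (i : ℕ) :
    ContinuousOn (fun x : ℝ × ℝ × ℝ => normalJet ρ G i x.1 x.2) (Ioo a b ×ˢ rect ρ) := by
  have y0 := hG.continuousOn_dy hρ (i := 0) (by norm_num)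
  have y1 := hG.continuousOn_dy hρ (i := 1) (by norm_num)
  have y2 := hG.continuousOn_dy hρ (i := 2) (by norm_num)
  have z0 := hG.continuousOn_dz hρ (i := 0) (by norm_num)
  have z1 := hG.continuousOn_dz hρ (i := 1) (by norm_num)
  have z2 := hG.continuousOn_dz hρ (i := 2) (by norm_num)
  match i with
  | 0 => exact continuousOn_cross y0 z0
  | 1 => exact (continuousOn_cross y1 z0).add (continuousOn_cross y0 z1)
  | n + 2 =>
    exact ((continuousOn_cross y2 z0).add (continuousOn_cross y1 z1)).add
      ((continuousOn_cross y1 z1).add (continuousOn_cross y0 z2))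

lemma C2Jet.hasDerivAt_normalJet (hρ : 0 < ρ) (hG : C2Jet ρ a b G) {i : ℕ} (hi : i < 2)
    {t : ℝ} (ht : t ∈ Ioo a b) {q : ℝ × ℝ} (hq : q ∈ interior (rect ρ)) :
    HasDerivAt (fun s => normalJet ρ G i s q) (normalJet ρ G (i + 1) t q) t := by
  have y0 := hG.hasDerivAt_dy hρ (i := 0) (by norm_num) ht hq
  have y1 := hG.hasDerivAt_dy hρ (i := 1) (by norm_num) ht hq
  have z0 := hG.hasDerivAt_dz hρ (i := 0) (by norm_num) ht hq
  have z1 := hG.hasDerivAt_dz hρ (i := 1) (by norm_num) ht hq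
  match i with
  | 0 => exact hasDerivAt_cross y0 z0
  | 1 => exact (hasDerivAt_cross y1 z0).add (hasDerivAt_cross y0 z1)

variable {σ : ℝ}

/-- The first derivative of the energy along a family of immersions. -/
lemma C2Jet.hasDerivAt_energy (hρ : 0 < ρ) (hG : C2Jet ρ a b G)
    (h0 : ∀ t ∈ Ioo a b, ∀ q ∈ rect ρ, normalJet ρ G 0 t q ≠ 0) {t : ℝ} (ht : t ∈ Ioo a b) :
    HasDerivAt (fun s => energy ρ σ (G 0 s)) (∫ q in rect ρ, σ *
      (inner ℝ (normalJet ρ G 0 t q) (normalJet ρ G 1 t q) / ‖normalJet ρ G 0 t q‖)) t := by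
  have c0 := hG.continuousOn_normalJet hρ 0
  have c1 := hG.continuousOn_normalJet hρ 1
  refine hasDerivAt_integral_rect (Φ := fun s q => σ * areaElement ρ (G 0 s) q)
    (continuousOn_const.mul c0.norm)
    (Φ' := fun t q => σ *
      (inner ℝ (normalJet ρ G 0 t q) (normalJet ρ G 1 t q) / ‖normalJet ρ G 0 t q‖))
    (continuousOn_const.mul ((c0.inner c1).div c0.norm fun x hx =>
      norm_ne_zero_iff.2 (h0 x.1 hx.1 x.2 hx.2))) ?_ ht
  intro s hs q hq
  exact (hasDerivAt_norm (hG.hasDerivAt_normalJet hρ (i := 0) (by norm_num) hs hq)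
    (h0 s hs q (interior_subset hq))).const_mul σ

/-- The second derivative of the energy along a family of immersions. -/
lemma C2Jet.deriv_deriv_energy (hρ : 0 < ρ) (hG : C2Jet ρ a b G)
    (h0 : ∀ t ∈ Ioo a b, ∀ q ∈ rect ρ, normalJet ρ G 0 t q ≠ 0) {t : ℝ} (ht : t ∈ Ioo a b) :
    deriv (deriv fun s => energy ρ σ (G 0 s)) t = ∫ q in rect ρ, σ *
      (((inner ℝ (normalJet ρ G 0 t q) (normalJet ρ G 2 t q) +
          inner ℝ (normalJet ρ G 1 t q) (normalJet ρ G 1 t q)) * ‖normalJet ρ G 0 t q‖ -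
        inner ℝ (normalJet ρ G 0 t q) (normalJet ρ G 1 t q) *
          (inner ℝ (normalJet ρ G 0 t q) (normalJet ρ G 1 t q) / ‖normalJet ρ G 0 t q‖)) /
        ‖normalJet ρ G 0 t q‖ ^ 2) := by
  have c0 := hG.continuousOn_normalJet hρ 0
  have c1 := hG.continuousOn_normalJet hρ 1
  have c2 := hG.continuousOn_normalJet hρ 2
  have hn (x : ℝ × ℝ × ℝ) (hx : x ∈ Ioo a b ×ˢ rect ρ) : ‖normalJet ρ G 0 x.1 x.2‖ ≠ 0 :=
    norm_ne_zero_iff.2 (h0 x.1 hx.1 x.2 hx.2)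
  have hev : (deriv fun s => energy ρ σ (G 0 s)) =ᶠ[𝓝 t] fun t => ∫ q in rect ρ, σ *
      (inner ℝ (normalJet ρ G 0 t q) (normalJet ρ G 1 t q) / ‖normalJet ρ G 0 t q‖) := by
    filter_upwards [Ioo_mem_nhds ht.1 ht.2] with s hs
    exact (hG.hasDerivAt_energy hρ h0 hs).deriv
  rw [hev.deriv_eq]
  refine HasDerivAt.deriv (hasDerivAt_integral_rect
    (Φ := fun t q => σ *
      (inner ℝ (normalJet ρ G 0 t q) (normalJet ρ G 1 t q) / ‖normalJet ρ G 0 t q‖))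
    (Φ' := fun t q => σ *
      (((inner ℝ (normalJet ρ G 0 t q) (normalJet ρ G 2 t q) +
          inner ℝ (normalJet ρ G 1 t q) (normalJet ρ G 1 t q)) * ‖normalJet ρ G 0 t q‖ -
        inner ℝ (normalJet ρ G 0 t q) (normalJet ρ G 1 t q) *
          (inner ℝ (normalJet ρ G 0 t q) (normalJet ρ G 1 t q) / ‖normalJet ρ G 0 t q‖)) /
        ‖normalJet ρ G 0 t q‖ ^ 2))
    (continuousOn_const.mul ((c0.inner c1).div c0.norm hn))
    (continuousOn_const.mul (((((c0.inner c2).add (c1.inner c1)).mul c0.norm).sub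
      ((c0.inner c1).mul ((c0.inner c1).div c0.norm hn))).div (c0.norm.pow 2)
      fun x hx => pow_ne_zero 2 (hn x hx))) ?_ ht)
  intro s hs q hq
  have d0 := hG.hasDerivAt_normalJet hρ (i := 0) (by norm_num) hs hq
  have d1 := hG.hasDerivAt_normalJet hρ (i := 1) (by norm_num) hs hq
  exact ((d0.inner ℝ d1).div (hasDerivAt_norm d0 (h0 s hs q (interior_subset hq)))
    (hn (s, q) ⟨hs, interior_subset hq⟩)).const_mul σ

end Energy

/-! ### Construction of families of surfaces -/

section Families
open Filter
open scoped Topology Pointwise ContDiff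
variable {ρ a b : ℝ}

/-- The derivatives of a slice are the derivatives of Φ on the product, evaluated on purely spatial
directions; these are jointly continuous. -/
lemma continuousOn_iteratedFDerivWithin_slice (hρ : 0 < ρ) {Φ : ℝ × ℝ × ℝ → E3}
    (hΦ : ContDiffOn ℝ 2 Φ (Ioo a b ×ˢ rect ρ)) {j : ℕ} (hj : j ≤ 2) :
    ContinuousOn (fun x : ℝ × ℝ × ℝ =>
      iteratedFDerivWithin ℝ j (fun p => Φ (x.1, p)) (rect ρ) x.2) (Ioo a b ×ˢ rect ρ) := by
  have hj' : (j : WithTop ℕ∞) ≤ 2 := by exact_mod_cast hj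
  have hu : UniqueDiffOn ℝ (Ioo a b ×ˢ rect ρ) :=
    (uniqueDiffOn_Ioo a b).prod (uniqueDiffOn_rect hρ)
  refine ((ContinuousMultilinearMap.compContinuousLinearMapL
    (fun _ : Fin j => ContinuousLinearMap.inr ℝ ℝ (ℝ × ℝ))).continuous.comp_continuousOn
    (hΦ.continuousOn_iteratedFDerivWithin hj' hu)).congr fun x hx => ?_
  obtain ⟨t, q⟩ := x
  obtain ⟨ht, hq⟩ := hx
  simp only at ht hq
  -- Translating the time t to 0 makes the inclusion of the slice linear instead of affine, so the
  -- chain rule for composition with a linear map applies.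
  set s : Set (ℝ × ℝ × ℝ) := Ioo (a - t) (b - t) ×ˢ rect ρ with hs
  have hvs : (t, (0 : ℝ × ℝ)) +ᵥ s = Ioo a b ×ˢ rect ρ := by
    ext y
    rw [mem_vadd_set_iff_neg_vadd_mem]
    simp only [hs, mem_prod, vadd_eq_add, Prod.neg_mk, Prod.fst_add, Prod.snd_add, neg_zero,
      zero_add, mem_Ioo]
    constructor
    · rintro ⟨⟨h1, h2⟩, h3⟩; exact ⟨⟨by linarith, by linarith⟩, h3⟩
    · rintro ⟨⟨h1, h2⟩, h3⟩; exact ⟨⟨by linarith, by linarith⟩, h3⟩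
  have hus : UniqueDiffOn ℝ s := (uniqueDiffOn_Ioo _ _).prod (uniqueDiffOn_rect hρ)
  have hpre : (ContinuousLinearMap.inr ℝ ℝ (ℝ × ℝ)) ⁻¹' s = rect ρ := by
    ext p
    simp only [hs, mem_preimage, ContinuousLinearMap.inr_apply, mem_prod, mem_Ioo]
    exact ⟨fun h => h.2, fun h => ⟨⟨by linarith [ht.1], by linarith [ht.2]⟩, h⟩⟩
  have hmaps : ContDiffOn ℝ 2 (fun y => Φ ((t, 0) + y)) s := by
    refine hΦ.comp (contDiff_const.add contDiff_id).contDiffOn fun y hy => ?_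
    rw [← hvs]
    exact vadd_mem_vadd_set hy
  have h1 := (ContinuousLinearMap.inr ℝ ℝ (ℝ × ℝ)).iteratedFDerivWithin_comp_right hmaps hus
    (by rw [hpre]; exact uniqueDiffOn_rect hρ) (x := q)
    (by have : q ∈ (ContinuousLinearMap.inr ℝ ℝ (ℝ × ℝ)) ⁻¹' s := by rwa [hpre]
        exact this) hj'
  rw [hpre, iteratedFDerivWithin_comp_add_left, hvs] at h1
  have h2 : (fun y => Φ ((t, 0) + y)) ∘ (ContinuousLinearMap.inr ℝ ℝ (ℝ × ℝ)) =
      fun p => Φ (t, p) := by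
    ext1 p; simp
  rw [h2] at h1
  simpa using h1

/-- The iterated derivatives of `Ψ` in its first variable. -/
def timeDeriv (Ψ : ℝ × E3 × E3 → E3) : ℕ → ℝ × E3 × E3 → E3
  | 0 => Ψ
  | i + 1 => fun x => fderiv ℝ (timeDeriv Ψ i) x (1, 0)

lemma contDiff_timeDeriv {Ψ : ℝ × E3 × E3 → E3} (hΨ : ContDiff ℝ ∞ Ψ) (i : ℕ) :
    ContDiff ℝ ∞ (timeDeriv Ψ i) := by
  induction i with
  | zero => exact hΨ
  | succ i ih => exact (ih.fderiv_right (by simp)).clm_apply contDiff_const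

lemma hasDerivAt_timeDeriv {Ψ : ℝ × E3 × E3 → E3} (hΨ : ContDiff ℝ ∞ Ψ) (i : ℕ) (t : ℝ)
    (w : E3 × E3) :
    HasDerivAt (fun s => timeDeriv Ψ i (s, w)) (timeDeriv Ψ (i + 1) (t, w)) t :=
  (((contDiff_timeDeriv hΨ i).differentiable (by simp)) (t, w)).hasFDerivAt.comp_hasDerivAt t
    ((hasDerivAt_id t).prodMk (hasDerivAt_const t w))

/-- Smooth superpositions of `C²` fields are `C²` families. -/
lemma c2Jet_of_contDiff (hρ : 0 < ρ) {Ψ : ℝ × E3 × E3 → E3} (hΨ : ContDiff ℝ ∞ Ψ)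
    {f g : ℝ × ℝ → E3} (hf : C2 ρ f) (hg : C2 ρ g) :
    C2Jet ρ a b fun i t q => timeDeriv Ψ i (t, f q, g q) where
  hasDerivAt i hi t ht q hq := hasDerivAt_timeDeriv hΨ i t _
  c2 i hi t ht := ((contDiff_timeDeriv hΨ i).of_le (WithTop.coe_le_coe.2 (le_top : (2 : ℕ∞) ≤ ⊤))).comp_contDiffOn
    (contDiffOn_const.prodMk (hf.prodMk hg))
  cont i hi j hj := by
    refine continuousOn_iteratedFDerivWithin_slice hρ
      (Φ := fun x => timeDeriv Ψ i (x.1, f x.2, g x.2)) ?_ hj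
    have h2 : MapsTo (Prod.snd : ℝ × ℝ × ℝ → ℝ × ℝ) (Ioo a b ×ˢ rect ρ) (rect ρ) :=
      fun x hx => hx.2
    exact ((contDiff_timeDeriv hΨ i).of_le (WithTop.coe_le_coe.2 (le_top : (2 : ℕ∞) ≤ ⊤))).comp_contDiffOn
      (contDiff_fst.contDiffOn.prodMk
        ((hf.comp contDiff_snd.contDiffOn h2).prodMk (hg.comp contDiff_snd.contDiffOn h2)))

lemma C2Jet.isC2Family {G : ℕ → ℝ → ℝ × ℝ → E3} (hG : C2Jet ρ a b G) :
    IsC2Family ρ a b (G 0) :=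
  ⟨G, rfl, hG.hasDerivAt, hG.c2, hG.cont⟩

lemma C2Jet.mono {G : ℕ → ℝ → ℝ × ℝ → E3} (hG : C2Jet ρ a b G) {a' b' : ℝ} (ha : a ≤ a')
    (hb : b' ≤ b) : C2Jet ρ a' b' G := by
  have h : Ioo a' b' ⊆ Ioo a b := Ioo_subset_Ioo ha hb
  exact ⟨fun i hi t ht => hG.hasDerivAt i hi t (h ht), fun i hi t ht => hG.c2 i hi t (h ht),
    fun i hi j hj => (hG.cont i hi j hj).mono (prod_mono h subset_rfl)⟩

/-! ### Immersions and injectivity under small perturbations -/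

/-- If u × v = 0, then |u|²v - (u · v)u = -u × (u × v) = 0 exhibits a kernel vector, or u = 0.
Conversely, a relation between u and v, multiplied by v and by u in the cross product, kills both
coefficients. Immersions thus become an open condition on the normal. -/
lemma injective_iff_cross_ne_zero (f : ℝ × ℝ → E3) (q : ℝ × ℝ) :
    Function.Injective (fderivWithin ℝ f (rect ρ) q) ↔ cross (dy ρ f q) (dz ρ f q) ≠ 0 := by
  set u := dy ρ f q
  set v := dz ρ f q
  have hD (x : ℝ × ℝ) : fderivWithin ℝ f (rect ρ) q x = x.1 • u + x.2 • v :=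
    fderivWithin_eq_dy_dz f q x
  rw [injective_iff_map_eq_zero]
  constructor
  · intro h h0
    have h1 : ‖u‖ ^ 2 • v - inner ℝ u v • u = 0 := by
      have e : ‖u‖ ^ 2 • v - inner ℝ u v • u = -cross u (cross u v) := by
        rw [← real_inner_self_eq_norm_sq]
        apply ext_coord <;>
          simp only [inner_coord, PiLp.sub_apply, PiLp.smul_apply, PiLp.neg_apply, smul_eq_mul,
            cross_zero_coord, cross_one_coord, cross_two_coord] <;> ring
      rw [e, h0]
      apply ext_coord <;> simp
    have h2 := h (-inner ℝ u v, ‖u‖ ^ 2) (by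
      rw [hD]; simp only; rw [← h1]; module)
    have h3 : ‖u‖ ^ 2 = 0 := congrArg Prod.snd h2
    have h4 : u = 0 := by simpa using h3
    have h5 := h (1, 0) (by rw [hD]; simp [h4])
    simpa using congrArg Prod.fst h5
  · intro h x hx
    rw [hD] at hx
    have e1 : x.1 • cross u v = 0 := by
      have : x.1 • cross u v = cross (x.1 • u + x.2 • v) v := by
        apply ext_coord <;> simp <;> ring
      rw [this, hx]; apply ext_coord <;> simp
    have e2 : x.2 • cross u v = 0 := by
      have : x.2 • cross u v = cross u (x.1 • u + x.2 • v) := by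
        apply ext_coord <;> simp <;> ring
      rw [this, hx]; apply ext_coord <;> simp
    ext
    · simpa [h] using e1
    · simpa [h] using e2

/-- Injective immersions of the rectangle are bi-Lipschitz. -/
lemma exists_le_norm_sub (hρ : 0 < ρ) {f : ℝ × ℝ → E3} (hf : C1 ρ f) (hinj : InjOn f (rect ρ))
    (himm : ∀ q ∈ rect ρ, Function.Injective (fderivWithin ℝ f (rect ρ) q)) :
    ∃ c > 0, ∀ p ∈ rect ρ, ∀ q ∈ rect ρ, c * ‖p - q‖ ≤ ‖f p - f q‖ := by
  have hK := (isCompact_rect ρ).prod (isCompact_rect ρ)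
  suffices h : ∃ c > 0, ∀ x ∈ rect ρ ×ˢ rect ρ, c * ‖x.1 - x.2‖ ≤ ‖f x.1 - f x.2‖ by
    obtain ⟨c, hc, h⟩ := h
    exact ⟨c, hc, fun p hp q hq => h (p, q) ⟨hp, hq⟩⟩
  -- Having some positive lower constant passes to subsets and to finite unions, so by compactness
  -- it suffices to treat a neighbourhood of each pair: the diagonal by the derivative, the rest by
  -- continuity.
  refine hK.induction_on (p := fun s => ∃ c > 0, ∀ x ∈ s, c * ‖x.1 - x.2‖ ≤ ‖f x.1 - f x.2‖)
    ⟨1, one_pos, by simp⟩ ?_ ?_ ?_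
  · rintro s t hst ⟨c, hc, h⟩
    exact ⟨c, hc, fun x hx => h x (hst hx)⟩
  · rintro s t ⟨c, hc, h⟩ ⟨d, hd, h'⟩
    refine ⟨min c d, lt_min hc hd, fun x hx => ?_⟩
    rcases hx with hx | hx
    · exact (mul_le_mul_of_nonneg_right (min_le_left _ _) (norm_nonneg _)).trans (h x hx)
    · exact (mul_le_mul_of_nonneg_right (min_le_right _ _) (norm_nonneg _)).trans (h' x hx)
  · rintro ⟨p, q⟩ ⟨hp, hq⟩
    simp only at hp hq
    have hc1 : ContinuousOn (fun x : (ℝ × ℝ) × (ℝ × ℝ) => ‖f x.1 - f x.2‖)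
        (rect ρ ×ˢ rect ρ) :=
      ((hf.continuousOn.comp continuousOn_fst fun x hx => hx.1).sub
        (hf.continuousOn.comp continuousOn_snd fun x hx => hx.2)).norm
    by_cases hpq : p = q
    · subst hpq
      obtain ⟨K, hK0, hK⟩ := LinearMap.exists_antilipschitzWith
        (fderivWithin ℝ f (rect ρ) p : ℝ × ℝ →ₗ[ℝ] E3) (LinearMap.ker_eq_bot.2 (himm p hp))
      have hK0' : (0 : ℝ) < K := hK0
      have hlow (x : ℝ × ℝ) : ‖x‖ ≤ K * ‖fderivWithin ℝ f (rect ρ) p x‖ := by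
        simpa using hK.le_mul_dist x 0
      -- Half of the lower bound 1/K of the derivative at p: near p the remainder f - Df(p) is
      -- ε-Lipschitz and can absorb at most half of it.
      set ε : ℝ := (2 * K)⁻¹ with hε
      have hε0 : 0 < ε := by positivity
      have hcont := (hf.continuousOn_fderivWithin hρ) p hp
      obtain ⟨r, hr, hrb⟩ := Metric.continuousWithinAt_iff.1 hcont ε hε0
      set s := rect ρ ∩ Metric.ball p r with hs
      have hconv : Convex ℝ s := (convex_rect ρ).inter (convex_ball p r)
      refine ⟨s ×ˢ s, ?_, ε, hε0, ?_⟩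
      · rw [nhdsWithin_prod_eq]
        exact prod_mem_prod (inter_mem self_mem_nhdsWithin
          (mem_nhdsWithin_of_mem_nhds (Metric.ball_mem_nhds p hr)))
          (inter_mem self_mem_nhdsWithin
          (mem_nhdsWithin_of_mem_nhds (Metric.ball_mem_nhds p hr)))
      · rintro ⟨x, y⟩ ⟨hx, hy⟩
        simp only at hx hy ⊢
        have hd (z) (hz : z ∈ s) : HasFDerivWithinAt
            (fun z => f z - fderivWithin ℝ f (rect ρ) p z)
            (fderivWithin ℝ f (rect ρ) z - fderivWithin ℝ f (rect ρ) p) s z :=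
          ((hf.diff hz.1).hasFDerivWithinAt.mono inter_subset_left).sub
            (ContinuousLinearMap.hasFDerivWithinAt _)
        have h1 := Convex.norm_image_sub_le_of_norm_hasFDerivWithin_le (C := ε) hd
          (fun z hz => by
            have := hrb hz.1 hz.2
            rw [dist_eq_norm] at this
            exact this.le) hconv hy hx
        have h2 := hlow (x - y)
        have h3 : fderivWithin ℝ f (rect ρ) p (x - y) = (f x - f y) -
            ((f x - fderivWithin ℝ f (rect ρ) p x) - (f y - fderivWithin ℝ f (rect ρ) p y)) := by
          rw [map_sub]; abel
        have h4 : ‖fderivWithin ℝ f (rect ρ) p (x - y)‖ ≤ ‖f x - f y‖ + ε * ‖x - y‖ := by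
          rw [h3]; exact (norm_sub_le _ _).trans (by gcongr)
        have h5 : ‖x - y‖ ≤ K * (‖f x - f y‖ + ε * ‖x - y‖) :=
          h2.trans (mul_le_mul_of_nonneg_left h4 hK0'.le)
        have h6 : K * ε = 1 / 2 := by rw [hε]; field_simp
        have h7 : ‖x - y‖ ≤ 2 * K * ‖f x - f y‖ := by
          have : K * (‖f x - f y‖ + ε * ‖x - y‖) = K * ‖f x - f y‖ + K * ε * ‖x - y‖ := by ring
          rw [this, h6] at h5
          linarith
        rw [hε, inv_mul_le_iff₀ (by positivity)]
        exact h7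
    · have hpos : 0 < ‖f p - f q‖ := by
        rw [norm_pos_iff, sub_ne_zero]
        exact fun h => hpq (hinj hp hq h)
      obtain ⟨M, hM⟩ := hK.exists_bound_of_continuousOn
        (f := fun x : (ℝ × ℝ) × (ℝ × ℝ) => x.1 - x.2) (by fun_prop)
      have hM0 : 0 ≤ M := (norm_nonneg _).trans (hM (p, q) ⟨hp, hq⟩)
      have hev := (hc1 (p, q) ⟨hp, hq⟩).eventually (lt_mem_nhds (half_lt_self hpos))
      refine ⟨_, inter_mem hev self_mem_nhdsWithin, ‖f p - f q‖ / 2 / (M + 1), by positivity, ?_⟩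
      rintro x ⟨hx1, hx2⟩
      have hx1' : ‖f p - f q‖ / 2 < ‖f x.1 - f x.2‖ := hx1
      refine le_trans ?_ hx1'.le
      rw [div_mul_eq_mul_div, div_le_iff₀ (by positivity)]
      have := hM x hx2
      gcongr
      linarith

/-- A condition that is open and holds at time `0` holds for small times. -/
lemma exists_forall_small_time {X : Type*} [TopologicalSpace X] {Φ : ℝ → ℝ × ℝ → X} (ha : a < 0)
    (hb : 0 < b) (hc : ContinuousOn (fun x : ℝ × ℝ × ℝ => Φ x.1 x.2) (Ioo a b ×ˢ rect ρ))
    {U : Set X} (hU : IsOpen U) {K : Set (ℝ × ℝ)} (hK : IsCompact K) (hKρ : K ⊆ rect ρ)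
    (h0 : ∀ q ∈ K, Φ 0 q ∈ U) :
    ∀ᶠ t in 𝓝 (0 : ℝ), ∀ q ∈ K, Φ t q ∈ U := by
  have h := hK.eventually_forall_of_forall_eventually (x₀ := (0 : ℝ))
    (P := fun t q => t ∈ Ioo a b → q ∈ K → Φ t q ∈ U) ?_
  · filter_upwards [h, Ioo_mem_nhds ha hb] with t ht hab q hq using ht q hq hab hq
  · intro q hq
    have := (hc (0, q) ⟨⟨ha, hb⟩, hKρ hq⟩).eventually (hU.mem_nhds (h0 q hq))
    rw [eventually_nhdsWithin_iff] at this
    filter_upwards [this] with z hz h1 h2 using hz ⟨h1, hKρ h2⟩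

/-- Members of a family that starts at an injective immersion are injective immersions for small
times. -/
lemma C2Jet.eventually_injective_immersion {G : ℕ → ℝ → ℝ × ℝ → E3} (hρ : 0 < ρ) (ha : a < 0)
    (hb : 0 < b) (hG : C2Jet ρ a b G) (hinj : InjOn (G 0 0) (rect ρ))
    (himm : ∀ q ∈ rect ρ, Function.Injective (fderivWithin ℝ (G 0 0) (rect ρ) q)) :
    ∀ᶠ t in 𝓝 (0 : ℝ), InjOn (G 0 t) (rect ρ) ∧
      ∀ q ∈ rect ρ, Function.Injective (fderivWithin ℝ (G 0 t) (rect ρ) q) := by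
  have h00 : (0 : ℝ) ∈ Ioo a b := ⟨ha, hb⟩
  obtain ⟨c, hc, hlow⟩ := exists_le_norm_sub hρ (hG.c2 0 (by norm_num) 0 h00).c1 hinj himm
  have hDc := hG.continuousOn_fderivWithin hρ (i := 0) (by norm_num)
  -- Once the derivative has moved by less than c/2, the difference of the two maps is c/2-Lipschitz
  -- and cannot undo the lower Lipschitz bound c of the initial one.
  have h1 := exists_forall_small_time ha hb (X := ℝ)
    (Φ := fun t q => ‖fderivWithin ℝ (G 0 t) (rect ρ) q - fderivWithin ℝ (G 0 0) (rect ρ) q‖)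
    (hDc.sub ((continuousOn_param_right (Φ := fun t q => fderivWithin ℝ (G 0 t) (rect ρ) q)
      hDc h00).comp continuousOn_snd fun x hx => hx.2)).norm
    (U := Iio (c / 2)) isOpen_Iio (isCompact_rect ρ) subset_rfl (fun q hq => by simp [hc])
  have h2 := exists_forall_small_time ha hb (hG.continuousOn_normalJet hρ 0)
    (U := {0}ᶜ) isOpen_compl_singleton (isCompact_rect ρ) subset_rfl
    (fun q hq => (injective_iff_cross_ne_zero _ q).1 (himm q hq))
  filter_upwards [h1, h2, Ioo_mem_nhds ha hb] with t ht1 ht2 ht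
  refine ⟨fun p hp q hq hpq => ?_, fun q hq => (injective_iff_cross_ne_zero _ q).2 (ht2 q hq)⟩
  have hd (z) (hz : z ∈ rect ρ) : HasFDerivWithinAt (fun z => G 0 t z - G 0 0 z)
      (fderivWithin ℝ (G 0 t) (rect ρ) z - fderivWithin ℝ (G 0 0) (rect ρ) z) (rect ρ) z :=
    ((hG.c2 0 (by norm_num) t ht).c1.diff hz).hasFDerivWithinAt.sub
      ((hG.c2 0 (by norm_num) 0 h00).c1.diff hz).hasFDerivWithinAt
  have h3 := Convex.norm_image_sub_le_of_norm_hasFDerivWithin_le (C := c / 2) hd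
    (fun z hz => (ht1 z hz).le) (convex_rect ρ) hq hp
  have h4 := hlow p hp q hq
  have h5 : (G 0 t p - G 0 0 p) - (G 0 t q - G 0 0 q) = -(G 0 0 p - G 0 0 q) := by
    rw [hpq]; abel
  rw [h5, norm_neg] at h3
  have h6 : ‖p - q‖ = 0 := by
    have := norm_nonneg (p - q)
    nlinarith
  rwa [norm_eq_zero, sub_eq_zero] at h6

end Families

/-! ### Pointwise algebra of a tangent frame -/

/-- `(a, b)` is a basis of the plane with unit normal `n`, and `a × b = J n` with `J > 0`. -/
structure IsFrame (a b n : E3) (J : ℝ) : Prop where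
  pos : 0 < J
  nn : inner ℝ n n = (1 : ℝ)
  na : inner ℝ n a = (0 : ℝ)
  nb : inner ℝ n b = (0 : ℝ)
  cross_eq : cross a b = J • n

namespace IsFrame
variable {a b n : E3} {J : ℝ}

lemma tri_eq (h : IsFrame a b n J) : tri n a b = J := by
  rw [tri, h.cross_eq, inner_smul_right, h.nn, mul_one]

lemma gram (h : IsFrame a b n J) :
    J ^ 2 = inner ℝ a a * inner ℝ b b - inner ℝ a b ^ 2 := by
  have h1 : inner ℝ (cross a b) (cross a b) = J ^ 2 := by
    rw [h.cross_eq, inner_smul_left, inner_smul_right, h.nn]; simp; ring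
  rw [← h1]; simp only [inner_coord, cross_zero_coord, cross_one_coord, cross_two_coord]; ring

/-- Coordinates with respect to the frame. -/
lemma decomp (h : IsFrame a b n J) (x : E3) :
    ∃ α β : ℝ, x = α • a + β • b + (inner ℝ n x : ℝ) • n := by
  refine ⟨tri n x b / J, tri n a x / J, ?_⟩
  -- Cramer's rule in ℝ³, as an identity between four vectors.
  have e1 : tri n a b • x = tri n x b • a + tri n a x • b + inner ℝ x (cross a b) • n := by
    apply ext_coord <;> simp [tri_coord, inner_coord] <;> ring
  have e2 : inner ℝ x (cross a b) = J * inner ℝ n x := by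
    rw [h.cross_eq, inner_smul_right, real_inner_comm]
  rw [h.tri_eq, e2] at e1
  have hJ := h.pos.ne'
  have : x = J⁻¹ • (J • x) := by rw [smul_smul, inv_mul_cancel₀ hJ, one_smul]
  rw [e1] at this
  refine this.trans ?_
  simp only [smul_add, smul_smul]
  congr 3 <;> field_simp

lemma tri_comb (h : IsFrame a b n J) (x y z x' y' z' x'' y'' z'' : ℝ) :
    tri (x • a + y • b + z • n) (x' • a + y' • b + z' • n) (x'' • a + y'' • b + z'' • n) =
      (x * (y' * z'' - z' * y'') - y * (x' * z'' - z' * x'') + z * (x' * y'' - y' * x'')) * J := by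
  rw [← h.tri_eq]
  simp only [tri_coord, PiLp.add_apply, PiLp.smul_apply, smul_eq_mul]
  ring

lemma inner_comb (h : IsFrame a b n J) (x y z x' y' z' : ℝ) :
    inner ℝ (x • a + y • b + z • n) (x' • a + y' • b + z' • n) =
      x * x' * inner ℝ a a + (x * y' + y * x') * inner ℝ a b + y * y' * inner ℝ b b + z * z' := by
  have e1 := h.na
  have e2 := h.nb
  have e3 := h.nn
  simp only [inner_coord, PiLp.add_apply, PiLp.smul_apply, smul_eq_mul] at *
  linear_combination (x * z' + z * x') * e1 + (y * z' + z * y') * e2 + z * z' * e3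

/-- The squared norm of the tangent covector with components `m`, `k`. -/
lemma norm_sq_dual (h : IsFrame a b n J) (m k : ℝ) :
    ‖m • (J⁻¹ • cross b n) + k • (J⁻¹ • cross n a)‖ ^ 2 =
      (m ^ 2 * inner ℝ b b - 2 * m * k * inner ℝ a b + k ^ 2 * inner ℝ a a) / J ^ 2 := by
  have hJ := h.pos.ne'
  have e1 : inner ℝ (cross b n) (cross b n) = inner ℝ b b := by
    have : inner ℝ (cross b n) (cross b n) = inner ℝ b b * inner ℝ n n - inner ℝ n b ^ 2 := by
      simp only [inner_coord, cross_zero_coord, cross_one_coord, cross_two_coord]; ring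
    rw [this, h.nn, h.nb]; ring
  have e2 : inner ℝ (cross n a) (cross n a) = inner ℝ a a := by
    have : inner ℝ (cross n a) (cross n a) = inner ℝ a a * inner ℝ n n - inner ℝ n a ^ 2 := by
      simp only [inner_coord, cross_zero_coord, cross_one_coord, cross_two_coord]; ring
    rw [this, h.nn, h.na]; ring
  have e3 : inner ℝ (cross b n) (cross n a) = -inner ℝ a b := by
    have : inner ℝ (cross b n) (cross n a) =
        inner ℝ n a * inner ℝ n b - inner ℝ n n * inner ℝ a b := by
      simp only [inner_coord, cross_zero_coord, cross_one_coord, cross_two_coord]; ring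
    rw [this, h.nn, h.na]; ring
  rw [← real_inner_self_eq_norm_sq]
  simp only [inner_add_left, inner_add_right, real_inner_smul_left, real_inner_smul_right, e1, e2, e3,
    real_inner_comm (cross b n) (cross n a)]
  field_simp
  ring

end IsFrame

/-- The integrand of the second variation minus that of the quadratic form in the normal component
is a sum of two exact forms. -/
lemma secondVariation_pointwise {a b n : E3} {J : ℝ} (h : IsFrame a b n J) {ny nz v vy vz : E3}
    (hny : inner ℝ n ny = (0 : ℝ)) (hnz : inner ℝ n nz = (0 : ℝ))
    (hsymm : inner ℝ a nz = (inner ℝ b ny : ℝ)) (hH : tri n ny b + tri n a nz = 0) {c cy cz : ℝ}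
    (hc : c = inner ℝ v n) (hcy : cy = inner ℝ vy n + inner ℝ v ny)
    (hcz : cz = inner ℝ vz n + inner ℝ v nz) :
    2 * tri n vy vz + J * ‖(inner ℝ n vy : ℝ) • (J⁻¹ • cross b n) +
        (inner ℝ n vz : ℝ) • (J⁻¹ • cross n a)‖ ^ 2 =
      (J * ‖cy • (J⁻¹ • cross b n) + cz • (J⁻¹ • cross n a)‖ ^ 2 + 2 * tri n ny nz * c ^ 2)
      + (inner ℝ (cross ny v + cross n vy) vz - inner ℝ (cross nz v + cross n vz) vy)
      + (inner ℝ (cy • cross n v + c • (cross ny v + cross n vy)) nz -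
          inner ℝ (cz • cross n v + c • (cross nz v + cross n vz)) ny) := by
  have e1 : inner ℝ (cross ny v + cross n vy) vz = tri ny v vz + tri n vy vz := by
    rw [inner_add_left, tri_eq_inner_cross, tri_eq_inner_cross]
  have e2 : inner ℝ (cross nz v + cross n vz) vy = tri nz v vy + tri n vz vy := by
    rw [inner_add_left, tri_eq_inner_cross, tri_eq_inner_cross]
  have e3 : inner ℝ (cy • cross n v + c • (cross ny v + cross n vy)) nz =
      cy * tri n v nz + c * (tri ny v nz + tri n vy nz) := by
    simp only [inner_add_left, real_inner_smul_left, tri_eq_inner_cross]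
  have e4 : inner ℝ (cz • cross n v + c • (cross nz v + cross n vz)) ny =
      cz * tri n v ny + c * (tri nz v ny + tri n vz ny) := by
    simp only [inner_add_left, real_inner_smul_left, tri_eq_inner_cross]
  rw [e1, e2, e3, e4, h.norm_sq_dual, h.norm_sq_dual]
  clear e1 e2 e3 e4
  -- From here on all vectors are replaced by their coordinates in (a, b, n), and the claim becomes
  -- a polynomial identity modulo the Gram relation.
  obtain ⟨a1, a2, ea⟩ := h.decomp ny
  obtain ⟨p, q, ep⟩ := h.decomp nz
  obtain ⟨α, β, ev⟩ := h.decomp v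
  obtain ⟨A1, A2, eA⟩ := h.decomp vy
  obtain ⟨B1, B2, eB⟩ := h.decomp vz
  rw [hny] at ea
  rw [hnz] at ep
  rw [real_inner_comm] at hc hcy hcz
  rw [← hc] at ev
  generalize hm : inner ℝ n vy = m at *
  generalize hk : inner ℝ n vz = k at *
  have en : n = (0 : ℝ) • a + (0 : ℝ) • b + (1 : ℝ) • n := by simp
  have eaa : a = (1 : ℝ) • a + (0 : ℝ) • b + (0 : ℝ) • n := by simp
  have ebb : b = (0 : ℝ) • a + (1 : ℝ) • b + (0 : ℝ) • n := by simp
  have htn (x y : E3) {x1 x2 x3 y1 y2 y3 : ℝ} (hx : x = x1 • a + x2 • b + x3 • n)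
      (hy : y = y1 • a + y2 • b + y3 • n) : tri n x y = (x1 * y2 - x2 * y1) * J := by
    have := h.tri_comb 0 0 1 x1 x2 x3 y1 y2 y3
    rw [← en, ← hx, ← hy] at this
    rw [this]; ring
  have ht (x y z : E3) {x1 x2 x3 y1 y2 y3 z1 z2 z3 : ℝ} (hx : x = x1 • a + x2 • b + x3 • n)
      (hy : y = y1 • a + y2 • b + y3 • n) (hz : z = z1 • a + z2 • b + z3 • n) :
      tri x y z = (x1 * (y2 * z3 - y3 * z2) - x2 * (y1 * z3 - y3 * z1) +
        x3 * (y1 * z2 - y2 * z1)) * J := by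
    rw [hx, hy, hz]; exact h.tri_comb _ _ _ _ _ _ _ _ _
  have hi (x y : E3) {x1 x2 x3 y1 y2 y3 : ℝ} (hx : x = x1 • a + x2 • b + x3 • n)
      (hy : y = y1 • a + y2 • b + y3 • n) : inner ℝ x y =
      x1 * y1 * inner ℝ a a + (x1 * y2 + x2 * y1) * inner ℝ a b + x2 * y2 * inner ℝ b b
        + x3 * y3 := by
    rw [hx, hy]; exact h.inner_comb _ _ _ _ _ _
  have hJ := h.pos.ne'
  have hg := h.gram
  rw [hi _ _ eaa ep, hi _ _ ebb ea] at hsymm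
  rw [hi _ _ ev ea] at hcy
  rw [hi _ _ ev ep] at hcz
  rw [htn _ _ ea ebb, htn _ _ eaa ep] at hH
  rw [htn _ _ eA eB, htn _ _ ea ep, ht _ _ _ ea ev eB, ht _ _ _ ep ev eA, htn _ _ eB eA,
    htn _ _ ev ep, ht _ _ _ ea ev ep, htn _ _ eA ep, htn _ _ ev ea, ht _ _ _ ep ev ea,
    htn _ _ eB ea]
  clear ht htn hi ea ep ev eA eB en eaa ebb hm hk
  generalize (inner ℝ a a : ℝ) = E at *
  generalize (inner ℝ a b : ℝ) = F at *
  generalize (inner ℝ b b : ℝ) = G at *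
  -- Vanishing mean curvature: the matrix of the derivative of n in the basis (a, b) is traceless.
  have hq : q = -a1 := by
    have : (a1 + q) * J = 0 := by linear_combination hH
    have := (mul_eq_zero.1 this).resolve_right hJ
    linarith
  subst hq
  clear hH hc
  have hs : a1 * F + a2 * G = p * E - a1 * F := by linear_combination -hsymm
  set s := cy - m with hs'
  set r := cz - k with hr'
  have es : s = a1 * (α * E + β * F) + a2 * (α * F + β * G) := by rw [hs', hcy]; ring
  have er : r = p * (α * E + β * F) - a1 * (α * F + β * G) := by rw [hr', hcz]; ring
  -- The covector (s, r) has components v · ny and v · nz. Since dn is self-adjoint, raising its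
  -- index gives dn applied to the tangential part of v; `h1` and `h2` are the two components of
  -- this statement.
  have h1 : s * G - r * F = J ^ 2 * (α * a1 + β * p) := by
    rw [es, er, hg]; linear_combination (α * F + β * G) * hs
  have h2 : r * E - s * F = J ^ 2 * (α * a2 - β * a1) := by
    rw [es, er, hg]; linear_combination (-α * E - β * F) * hs
  have hcy' : cy = m + s := by rw [hs']; ring
  have hcz' : cz = k + r := by rw [hr']; ring
  rw [hcy', hcz']
  clear_value s r
  field_simp
  linear_combination (-(2 * m + s)) * h1 - (2 * k + r) * h2

/-- The integrand of the first variation. -/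
lemma firstVariation_pointwise {a b n : E3} {J : ℝ} (h : IsFrame a b n J) {ny nz v vy vz : E3}
    (hny : inner ℝ n ny = (0 : ℝ)) (hnz : inner ℝ n nz = (0 : ℝ)) :
    tri n vy b + tri n a vz =
      (inner ℝ (cross ny v + cross n vy) b - inner ℝ (cross nz v + cross n vz) a)
        + (tri n ny b + tri n a nz) * inner ℝ v n := by
  -- Both products are multiples of a × b, because ny and nz are tangential; the coefficients add up
  -- to the trace of dn.
  have e1 : cross ny b + cross a nz = (tri n ny b + tri n a nz) • n := by
    obtain ⟨a1, a2, ea⟩ := h.decomp ny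
    obtain ⟨p, q, ep⟩ := h.decomp nz
    rw [hny] at ea
    rw [hnz] at ep
    have f1 : cross ny b = a1 • cross a b := by
      rw [ea]; apply ext_coord <;> simp <;> ring
    have f2 : cross a nz = q • cross a b := by
      rw [ep]; apply ext_coord <;> simp <;> ring
    simp only [tri, f1, f2, inner_smul_right, h.cross_eq, h.nn, smul_smul, ← add_smul, mul_one]
  have e2 : inner ℝ (cross nz v) a - inner ℝ (cross ny v) b = inner ℝ v (cross ny b + cross a nz) := by
    simp only [inner_coord, cross_zero_coord, cross_one_coord, cross_two_coord, PiLp.add_apply]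
    ring
  rw [e1, inner_smul_right] at e2
  have e3 : tri n a vz = -inner ℝ (cross n vz) a := by
    simp only [tri_coord, inner_coord, cross_zero_coord, cross_one_coord, cross_two_coord]; ring
  rw [inner_add_left, inner_add_left, ← tri_eq_inner_cross n vy b, e3]
  linarith

/-! ### The geometry of an immersed rectangle -/

/-- An immersion of class `C²` of the closed rectangle. -/
structure IsRegular (ρ : ℝ) (f : ℝ × ℝ → E3) : Prop where
  rho_pos : 0 < ρ
  c2 : C2 ρ f
  cross_ne : ∀ q ∈ rect ρ, cross (dy ρ f q) (dz ρ f q) ≠ 0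

lemma IsAdmissible.isRegular {ρ θ₀ : ℝ} {f : ℝ × ℝ → E3} (hρ : 0 < ρ)
    (hf : IsAdmissible ρ θ₀ f) : IsRegular ρ f :=
  ⟨hρ, hf.contDiffOn, fun q hq => (injective_iff_cross_ne_zero f q).1 (hf.immersion q hq)⟩

namespace IsRegular
variable {ρ : ℝ} {f : ℝ × ℝ → E3} {q : ℝ × ℝ}

lemma areaElement_pos (hf : IsRegular ρ f) (hq : q ∈ rect ρ) : 0 < areaElement ρ f q :=
  norm_pos_iff.2 (hf.cross_ne q hq)

lemma c1_dy (hf : IsRegular ρ f) : C1 ρ (dy ρ f) := hf.c2.dy hf.rho_pos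
lemma c1_dz (hf : IsRegular ρ f) : C1 ρ (dz ρ f) := hf.c2.dz hf.rho_pos

lemma c1_areaElement (hf : IsRegular ρ f) : C1 ρ (areaElement ρ f) :=
  (contDiffOn_cross hf.c1_dy hf.c1_dz).norm ℝ hf.cross_ne

lemma c1_areaElement_inv (hf : IsRegular ρ f) : C1 ρ (fun q => (areaElement ρ f q)⁻¹) :=
  hf.c1_areaElement.inv fun _ hq => (hf.areaElement_pos hq).ne'

lemma c1_unitNormal (hf : IsRegular ρ f) : C1 ρ (unitNormal ρ f) :=
  hf.c1_areaElement_inv.smul (contDiffOn_cross hf.c1_dy hf.c1_dz)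

lemma c1_dualY (hf : IsRegular ρ f) : C1 ρ (dualY ρ f) :=
  hf.c1_areaElement_inv.smul (contDiffOn_cross hf.c1_dz hf.c1_unitNormal)

lemma c1_dualZ (hf : IsRegular ρ f) : C1 ρ (dualZ ρ f) :=
  hf.c1_areaElement_inv.smul (contDiffOn_cross hf.c1_unitNormal hf.c1_dy)

lemma isFrame (hf : IsRegular ρ f) (hq : q ∈ rect ρ) :
    IsFrame (dy ρ f q) (dz ρ f q) (unitNormal ρ f q) (areaElement ρ f q) := by
  have hJ := hf.areaElement_pos hq
  refine ⟨hJ, ?_, ?_, ?_, ?_⟩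
  · rw [unitNormal, real_inner_smul_left, real_inner_smul_right, real_inner_self_eq_norm_sq]
    change _ * (_ * areaElement ρ f q ^ 2) = 1
    field_simp
  · rw [unitNormal, real_inner_smul_left]
    simp only [inner_coord, cross_zero_coord, cross_one_coord, cross_two_coord]; ring
  · rw [unitNormal, real_inner_smul_left]
    simp only [inner_coord, cross_zero_coord, cross_one_coord, cross_two_coord]; ring
  · rw [unitNormal, smul_smul, mul_inv_cancel₀ hJ.ne', one_smul]

lemma inner_unitNormal_dy (hf : IsRegular ρ f) (hq : q ∈ rect ρ) :
    inner ℝ (unitNormal ρ f q) (dy ρ (unitNormal ρ f) q) = 0 := by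
  have h : dy ρ (fun p => inner ℝ (unitNormal ρ f p) (unitNormal ρ f p)) q = 0 := by
    rw [dy_congr (v := fun _ => (1 : ℝ)) (fun p hp => (hf.isFrame hp).nn) hq, dy_const]
  rw [dy_inner hf.rho_pos hf.c1_unitNormal hf.c1_unitNormal hq,
    real_inner_comm (unitNormal ρ f q)] at h
  linarith

lemma inner_unitNormal_dz (hf : IsRegular ρ f) (hq : q ∈ rect ρ) :
    inner ℝ (unitNormal ρ f q) (dz ρ (unitNormal ρ f) q) = 0 := by
  have h : dz ρ (fun p => inner ℝ (unitNormal ρ f p) (unitNormal ρ f p)) q = 0 := by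
    rw [dz_congr (v := fun _ => (1 : ℝ)) (fun p hp => (hf.isFrame hp).nn) hq, dz_const]
  rw [dz_inner hf.rho_pos hf.c1_unitNormal hf.c1_unitNormal hq,
    real_inner_comm (unitNormal ρ f q)] at h
  linarith

/-- Symmetry of the second fundamental form. -/
lemma inner_dy_dz_unitNormal (hf : IsRegular ρ f) (hq : q ∈ rect ρ) :
    inner ℝ (dy ρ f q) (dz ρ (unitNormal ρ f) q) =
      (inner ℝ (dz ρ f q) (dy ρ (unitNormal ρ f) q) : ℝ) := by
  have h1 : dz ρ (fun p => inner ℝ (unitNormal ρ f p) (dy ρ f p)) q = 0 := by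
    rw [dz_congr (v := fun _ => (0 : ℝ)) (fun p hp => (hf.isFrame hp).na) hq, dz_const]
  have h2 : dy ρ (fun p => inner ℝ (unitNormal ρ f p) (dz ρ f p)) q = 0 := by
    rw [dy_congr (v := fun _ => (0 : ℝ)) (fun p hp => (hf.isFrame hp).nb) hq, dy_const]
  rw [dz_inner hf.rho_pos hf.c1_unitNormal hf.c1_dy hq,
    dz_dy_eq_dy_dz hf.rho_pos hf.c2 hq, real_inner_comm] at h1
  rw [dy_inner hf.rho_pos hf.c1_unitNormal hf.c1_dz hq, real_inner_comm] at h2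
  linarith

lemma _root_.SoapFilm.norm_surfGrad_sq (f : ℝ × ℝ → E3) (c : ℝ × ℝ → ℝ) (q : ℝ × ℝ) :
    ‖surfGrad ρ f c q‖ ^ 2 = ‖dy ρ c q • dualY ρ f q + dz ρ c q • dualZ ρ f q‖ ^ 2 := by
  have : surfGrad ρ f c q = innerSL ℝ (dy ρ c q • dualY ρ f q + dz ρ c q • dualZ ρ f q) := by
    ext x
    simp [surfGrad, mul_comm]
  rw [this, innerSL_apply_norm]

lemma trace_smulRight (e x : E3) :
    LinearMap.trace ℝ E3 ((innerSL ℝ e).smulRight x : E3 →L[ℝ] E3) = inner ℝ e x := by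
  rw [ContinuousLinearMap.coe_smulRight]
  exact LinearMap.trace_smulRight (R := ℝ) (innerSL ℝ e : E3 →ₗ[ℝ] ℝ) x

/-- With L = -(ny ⊗ eY + nz ⊗ eZ), half the difference of traces is the determinant (eY · ny)(eZ ·
nz) - (eY · nz)(eZ · ny) = (eY × eZ) · (ny × nz), and for the dual frame eY × eZ = n / J. -/
lemma gaussCurv_mul_areaElement (hf : IsRegular ρ f) (hq : q ∈ rect ρ) :
    gaussCurv ρ f q * areaElement ρ f q =
      tri (unitNormal ρ f q) (dy ρ (unitNormal ρ f) q) (dz ρ (unitNormal ρ f) q) := by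
  have h := hf.isFrame hq
  set n := unitNormal ρ f q
  set ny := dy ρ (unitNormal ρ f) q
  set nz := dz ρ (unitNormal ρ f) q
  set eY := dualY ρ f q with heY
  set eZ := dualZ ρ f q with heZ
  have hL : curvTensor ρ f q = -((innerSL ℝ eY).smulRight ny + (innerSL ℝ eZ).smulRight nz) := rfl
  have hLL : curvTensor ρ f q ∘L curvTensor ρ f q =
      (innerSL ℝ eY).smulRight ((inner ℝ eY ny : ℝ) • ny + (inner ℝ eZ ny : ℝ) • nz) +
      (innerSL ℝ eZ).smulRight ((inner ℝ eY nz : ℝ) • ny + (inner ℝ eZ nz : ℝ) • nz) := by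
    ext1 x
    rw [hL]
    simp only [ContinuousLinearMap.comp_apply, neg_apply, add_apply,
      ContinuousLinearMap.smulRight_apply, innerSL_apply_apply, map_neg, map_add,
      map_smul, smul_add, smul_smul]
    module
  have t1 : LinearMap.trace ℝ E3 (curvTensor ρ f q : E3 →ₗ[ℝ] E3) =
      -(inner ℝ eY ny + inner ℝ eZ nz) := by
    rw [hL, ContinuousLinearMap.toLinearMap_neg, ContinuousLinearMap.toLinearMap_add, map_neg, map_add,
      trace_smulRight, trace_smulRight]
  have t2 : LinearMap.trace ℝ E3 (curvTensor ρ f q ∘L curvTensor ρ f q : E3 →ₗ[ℝ] E3) =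
      inner ℝ eY ((inner ℝ eY ny : ℝ) • ny + (inner ℝ eZ ny : ℝ) • nz) +
      inner ℝ eZ ((inner ℝ eY nz : ℝ) • ny + (inner ℝ eZ nz : ℝ) • nz) := by
    have e := congrArg (fun A : E3 →L[ℝ] E3 => LinearMap.trace ℝ E3 (A : E3 →ₗ[ℝ] E3)) hLL
    simp only [ContinuousLinearMap.toLinearMap_add, map_add, trace_smulRight] at e
    exact e
  rw [gaussCurv, t1, t2]
  simp only [inner_add_right, real_inner_smul_right]
  have hYZ : cross eY eZ = (areaElement ρ f q)⁻¹ • n := by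
    have hJ := h.pos.ne'
    have e : cross (cross (dz ρ f q) n) (cross n (dy ρ f q)) = tri n (dy ρ f q) (dz ρ f q) • n := by
      apply ext_coord <;> simp [tri_coord] <;> ring
    rw [h.tri_eq] at e
    have e2 : cross eY eZ = (areaElement ρ f q)⁻¹ • (areaElement ρ f q)⁻¹ •
        cross (cross (dz ρ f q) n) (cross n (dy ρ f q)) := by
      rw [heY, heZ]
      apply ext_coord <;> simp [dualY, dualZ] <;> ring
    rw [e2, e, smul_smul, smul_smul, mul_assoc, inv_mul_cancel₀ hJ, mul_one]
  have hK : inner ℝ (cross eY eZ) (cross ny nz) =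
      inner ℝ eY ny * inner ℝ eZ nz - inner ℝ eY nz * inner ℝ eZ ny := by
    simp only [inner_coord, cross_zero_coord, cross_one_coord, cross_two_coord]; ring
  rw [hYZ, real_inner_smul_left] at hK
  have hJ := h.pos.ne'
  have : tri n ny nz = areaElement ρ f q * ((areaElement ρ f q)⁻¹ * inner ℝ n (cross ny nz)) := by
    rw [tri]; field_simp
  rw [this, hK]
  ring

end IsRegular

/-- The first variation of the area in the direction of the field `g`. -/
def firstVar (ρ : ℝ) (f g : ℝ × ℝ → E3) : ℝ :=
  ∫ q in rect ρ, (tri (unitNormal ρ f q) (dy ρ g q) (dz ρ f q) +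
    tri (unitNormal ρ f q) (dy ρ f q) (dz ρ g q))

/-- The mean curvature density. -/
def meanDensity (ρ : ℝ) (f : ℝ × ℝ → E3) (q : ℝ × ℝ) : ℝ :=
  tri (unitNormal ρ f q) (dy ρ (unitNormal ρ f) q) (dz ρ f q) +
    tri (unitNormal ρ f q) (dy ρ f q) (dz ρ (unitNormal ρ f) q)

namespace IsRegular
variable {ρ : ℝ} {f g : ℝ × ℝ → E3}

lemma continuousOn_meanDensity (hf : IsRegular ρ f) : ContinuousOn (meanDensity ρ f) (rect ρ) :=
  (continuousOn_tri hf.c1_unitNormal.continuousOn (hf.c1_unitNormal.continuousOn_dy hf.rho_pos)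
    hf.c1_dz.continuousOn).add
  (continuousOn_tri hf.c1_unitNormal.continuousOn hf.c1_dy.continuousOn
    (hf.c1_unitNormal.continuousOn_dz hf.rho_pos))

lemma continuousOn_green {u w : ℝ × ℝ → E3} (hρ : 0 < ρ) (hu : C1 ρ u) (hw : C1 ρ w) :
    ContinuousOn (fun q => inner ℝ (dy ρ u q) (dz ρ w q) - inner ℝ (dz ρ u q) (dy ρ w q) : _ → ℝ)
      (rect ρ) :=
  ((hu.continuousOn_dy hρ).inner (hw.continuousOn_dz hρ)).sub
    ((hu.continuousOn_dz hρ).inner (hw.continuousOn_dy hρ))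

/-- The first variation formula. -/
lemma firstVar_eq (hf : IsRegular ρ f) (hg : C1 ρ g) :
    firstVar ρ f g = bdryIntegral ρ (fun q => cross (unitNormal ρ f q) (g q)) f +
      ∫ q in rect ρ, meanDensity ρ f q * inner ℝ (g q) (unitNormal ρ f q) := by
  have hn := hf.c1_unitNormal
  have hu : C1 ρ (fun q => cross (unitNormal ρ f q) (g q)) := contDiffOn_cross hn hg
  have hi : IntegrableOn (fun q => meanDensity ρ f q * inner ℝ (g q) (unitNormal ρ f q)) (rect ρ) :=
    integrableOn_rect (hf.continuousOn_meanDensity.mul (hg.continuousOn.inner hn.continuousOn))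
  rw [← integral_green hf.rho_pos hu hf.c2.c1, ← integral_add
    (integrableOn_rect (continuousOn_green hf.rho_pos hu hf.c2.c1)) hi]
  refine setIntegral_congr_fun (measurableSet_rect ρ) fun q hq => ?_
  rw [dy_cross hf.rho_pos hn hg hq, dz_cross hf.rho_pos hn hg hq]
  exact firstVariation_pointwise (hf.isFrame hq) (hf.inner_unitNormal_dy hq)
    (hf.inner_unitNormal_dz hq)

end IsRegular

/-! ### Admissible fields and criticality -/

section Critical
open Filter
open scoped Topology ContDiff
variable {ρ θ₀ σ : ℝ} {f g : ℝ × ℝ → E3}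

/-- Admissible velocities, as fields on the rectangle. -/
structure IsAdmissibleField (ρ θ₀ : ℝ) (f g : ℝ × ℝ → E3) : Prop where
  c2 : C2 ρ g
  lower : ∀ q ∈ rect ρ, f q ∈ wire 0 0 → g q = (inner ℝ (g q) (wireDir 0) : ℝ) • wireDir 0
  upper : ∀ q ∈ rect ρ, f q ∈ wire ρ θ₀ → g q = (inner ℝ (g q) (wireDir θ₀) : ℝ) • wireDir θ₀
  side : ∀ q ∈ sideEdges ρ, inner ℝ (g q) (radial (f q)) = 0

lemma sideEdges_subset : sideEdges ρ ⊆ rect ρ := by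
  rintro ⟨y, z⟩ ⟨hy, hz⟩
  refine ⟨?_, Ioo_subset_Icc_self hz⟩
  rcases hy with h | h <;> simp only at h <;> simp [h]

lemma wireEdges_subset (hρ : 0 < ρ) : wireEdges ρ ⊆ rect ρ := by
  rintro ⟨y, z⟩ ⟨hy, hz⟩
  refine ⟨hy, ?_⟩
  rcases hz with h | h <;> simp only at h <;> simp [h, hρ.le]

lemma IsAdmissibleVelocity.field {v : E3 → E3} (hv : IsAdmissibleVelocity ρ θ₀ f v) :
    IsAdmissibleField ρ θ₀ f (v ∘ f) :=
  ⟨hv.isC2, fun _ _ h => hv.lowerWire _ h, fun _ _ h => hv.upperWire _ h,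
    fun q hq => hv.side _ ⟨q, hq, rfl⟩⟩

/-- Injectivity of f carries a field on the rectangle over to the surface. Every wire point is the
image of a point of the wire edges, so the conditions on the wires transfer too. -/
lemma IsAdmissibleField.exists_velocity (hρ : 0 < ρ) (hf : IsAdmissible ρ θ₀ f)
    (hg : IsAdmissibleField ρ θ₀ f g) :
    ∃ v, IsAdmissibleVelocity ρ θ₀ f v ∧ ∀ q ∈ rect ρ, v (f q) = g q := by
  have hinv : ∀ q ∈ rect ρ, (g ∘ Function.invFunOn f (rect ρ)) (f q) = g q := fun q hq =>
    congrArg g (hf.injOn.leftInvOn_invFunOn hq)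
  have hw (p : E3) (hp : p ∈ wires ρ θ₀) : ∃ q ∈ rect ρ, f q = p := by
    rw [← hf.image_wireEdges] at hp
    obtain ⟨q, hq, rfl⟩ := hp
    exact ⟨q, wireEdges_subset hρ hq, rfl⟩
  refine ⟨g ∘ Function.invFunOn f (rect ρ), ⟨?_, ?_, ?_, ?_⟩, hinv⟩
  · exact hg.c2.congr hinv
  · intro p hp
    obtain ⟨q, hq, rfl⟩ := hw p (Or.inl hp)
    rw [hinv q hq]; exact hg.lower q hq hp
  · intro p hp
    obtain ⟨q, hq, rfl⟩ := hw p (Or.inr hp)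
    rw [hinv q hq]; exact hg.upper q hq hp
  · rintro p ⟨q, hq, rfl⟩
    rw [hinv q (sideEdges_subset hq)]; exact hg.side q hq

/-- Criticality is tested on families that need not consist of admissible surfaces, so the straight
family f + t g suffices. For small t its members are immersions, where the energy is differentiable
with derivative σ times the first variation; σ > 0 cancels. -/
lemma firstVar_eq_zero (hρ : 0 < ρ) (hσ : 0 < σ) (hf : IsAdmissible ρ θ₀ f)
    (hcrit : IsCritical ρ θ₀ σ f) (hg : IsAdmissibleField ρ θ₀ f g) : firstVar ρ f g = 0 := by
  obtain ⟨v, hv, hvg⟩ := hg.exists_velocity hρ hf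
  let Ψ : ℝ × E3 × E3 → E3 := fun x => x.2.1 + x.1 • x.2.2
  have hΨ : ContDiff ℝ ∞ Ψ := by fun_prop
  set G : ℕ → ℝ → ℝ × ℝ → E3 := fun i t q => timeDeriv Ψ i (t, f q, g q) with hGdef
  have hG : C2Jet ρ (-1) 1 G := c2Jet_of_contDiff hρ hΨ hf.contDiffOn hg.c2
  have hG0 (t : ℝ) (q) : G 0 t q = f q + t • g q := rfl
  have hG00 : G 0 0 = f := by ext1 q; rw [hG0]; simp
  have hd (q) : HasDerivAt (fun t => G 0 t q) (g q) 0 := by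
    simp only [hG0]
    simpa using ((hasDerivAt_id (0 : ℝ)).smul_const (g q)).const_add (f q)
  have hG10 : G 1 0 = g := by
    ext1 q
    exact (hasDerivAt_timeDeriv hΨ 0 0 (f q, g q)).unique (hd q)
  have hev := hG.eventually_injective_immersion hρ (by norm_num) (by norm_num)
    (by rw [hG00]; exact hf.injOn) (by rw [hG00]; exact hf.immersion)
  obtain ⟨τ, hτ, hτ'⟩ := Metric.eventually_nhds_iff.1
    (hev.and (Ioo_mem_nhds (show (-1 : ℝ) < 0 by norm_num) one_pos))
  have hball {t : ℝ} (ht : t ∈ Ioo (-τ) τ) : dist t 0 < τ := by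
    rw [Real.dist_0_eq_abs, abs_lt]; exact ht
  have hτ1 : τ ≤ 1 := by
    by_contra! h
    exact absurd (hτ' (y := 1) (by simpa using h)).2.2 (lt_irrefl _)
  have hGτ : C2Jet ρ (-τ) τ G := hG.mono (by linarith) hτ1
  have hne : ∀ t ∈ Ioo (-τ) τ, ∀ q ∈ rect ρ, normalJet ρ G 0 t q ≠ 0 := fun t ht q hq =>
    (injective_iff_cross_ne_zero _ q).1 ((hτ' (hball ht)).1.2 q hq)
  have h0 : (0 : ℝ) ∈ Ioo (-τ) τ := ⟨by linarith, hτ⟩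
  have h1 := hcrit v hv (-τ) τ (G 0) (by linarith) hτ hGτ.isC2Family fun q hq =>
    ⟨by rw [hG00], by rw [hvg q hq]; exact hd q⟩
  have h2 := (hGτ.hasDerivAt_energy (σ := σ) hρ hne h0).unique h1
  rw [integral_const_mul] at h2
  have h3 := (mul_eq_zero.1 h2).resolve_left hσ.ne'
  rw [firstVar, ← h3]
  refine setIntegral_congr_fun (measurableSet_rect ρ) fun q hq => ?_
  simp only [normalJet, hG00, hG10, tri, unitNormal, areaElement, real_inner_smul_left,
    inner_add_right]
  ring

end Critical

/-! ### Consequences of criticality -/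

section PosPart
open scoped Topology

/-- Powers of the positive part serve as truncations: the cube is C², so test fields built with it
stay in the admissible class. At 0 the power is O(h^(n+2)) with exponent at least 2, whence the
derivative 0. -/
lemma hasDerivAt_max_pow (n : ℕ) (x : ℝ) :
    HasDerivAt (fun x : ℝ => max x 0 ^ (n + 2)) ((n + 2 : ℕ) * max x 0 ^ (n + 1)) x := by
  rcases lt_trichotomy x 0 with hx | rfl | hx
  · rw [max_eq_right hx.le]
    refine ((hasDerivAt_const x (0 : ℝ)).congr_of_eventuallyEq ?_).congr_deriv (by simp)
    filter_upwards [gt_mem_nhds hx] with y hy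
    rw [max_eq_right hy.le]; simp
  · simp only [max_self, ne_eq, Nat.add_eq_zero_iff, one_ne_zero, and_false, not_false_eq_true,
      zero_pow, mul_zero]
    rw [hasDerivAt_iff_isLittleO_nhds_zero]
    have h1 : (fun h : ℝ => max (0 + h) 0 ^ (n + 2) - max 0 0 ^ (n + 2) - h • (0 : ℝ)) =O[𝓝 0]
        fun h => h ^ (n + 2) := by
      refine Asymptotics.IsBigO.of_bound 1 (.of_forall fun h => ?_)
      simp only [zero_add, max_self, ne_eq, Nat.add_eq_zero_iff, OfNat.ofNat_ne_zero, and_false,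
        not_false_eq_true, zero_pow, sub_zero, smul_zero, norm_pow, Real.norm_eq_abs, one_mul]
      refine pow_le_pow_left₀ (abs_nonneg _) ?_ _
      rw [abs_of_nonneg (le_max_right _ _)]
      exact max_le (le_abs_self _) (abs_nonneg _)
    exact h1.trans_isLittleO (by simpa using Asymptotics.isLittleO_pow_id (𝕜 := ℝ) (n := n + 2) (by omega))
  · rw [max_eq_left hx.le]
    refine ((hasDerivAt_pow (n + 2) x).congr_of_eventuallyEq ?_).congr_deriv (by simp)
    filter_upwards [lt_mem_nhds hx] with y hy
    rw [max_eq_left hy.le]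

lemma contDiff_max_pow_two : ContDiff ℝ 1 (fun x : ℝ => max x 0 ^ 2) := by
  have h2 : deriv (fun x : ℝ => max x 0 ^ 2) = fun x => 2 * max x 0 ^ 1 :=
    funext fun x => by simpa using (hasDerivAt_max_pow 0 x).deriv
  rw [contDiff_one_iff_deriv, h2]
  exact ⟨fun x => (hasDerivAt_max_pow 0 x).differentiableAt, by fun_prop⟩

lemma contDiff_max_pow_three : ContDiff ℝ 2 (fun x : ℝ => max x 0 ^ 3) := by
  have h3 : deriv (fun x : ℝ => max x 0 ^ 3) = fun x => 3 * max x 0 ^ 2 :=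
    funext fun x => by simpa using (hasDerivAt_max_pow 1 x).deriv
  rw [show (2 : WithTop ℕ∞) = 1 + 1 by norm_num, contDiff_succ_iff_deriv, h3]
  exact ⟨fun x => (hasDerivAt_max_pow 1 x).differentiableAt, by simp,
    contDiff_const.mul contDiff_max_pow_two⟩

end PosPart

/-! ### Vanishing mean curvature, and orthogonality to the tube. -/

section Critical
open Filter
open scoped Topology ContDiff
variable {ρ θ₀ σ : ℝ} {f g : ℝ × ℝ → E3}

lemma eqOn_rect_of_ae {u : ℝ × ℝ → ℝ} (hρ : 0 < ρ) (hu : ContinuousOn u (rect ρ))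
    (h : ∀ᵐ q ∂(volume.restrict (rect ρ)), q ∈ interior (rect ρ) → u q = 0) :
    ∀ q ∈ rect ρ, u q = 0 := by
  have h1 : EqOn u 0 (interior (rect ρ)) := by
    refine Measure.eqOn_open_of_ae_eq (μ := (volume : Measure (ℝ × ℝ))) ?_ isOpen_interior
      (hu.mono interior_subset) continuousOn_const
    have h2 := ae_mono (Measure.restrict_mono interior_subset le_rfl) h
    filter_upwards [h2, ae_restrict_mem isOpen_interior.measurableSet] with q hq hq'
    exact hq hq'
  exact h1.of_subset_closure hu continuousOn_const interior_subset (closure_interior_rect hρ).ge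

lemma eq_zero_of_integral_rect_nonpos {u : ℝ × ℝ → ℝ} (hρ : 0 < ρ) (hu : ContinuousOn u (rect ρ))
    (h0 : ∀ q ∈ rect ρ, 0 ≤ u q) (h : ∫ q in rect ρ, u q ≤ 0) : ∀ q ∈ rect ρ, u q = 0 := by
  refine eqOn_rect_of_ae hρ hu ?_
  have h1 : 0 ≤ᵐ[volume.restrict (rect ρ)] u := by
    filter_upwards [ae_restrict_mem (measurableSet_rect ρ)] with q hq using h0 q hq
  have h2 := (integral_eq_zero_iff_of_nonneg_ae h1 (integrableOn_rect hu)).1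
    (le_antisymm h (integral_nonneg_of_ae h1))
  filter_upwards [h2] with q hq _ using hq

lemma IsAdmissible.mem_wireEdges (hρ : 0 < ρ) (hf : IsAdmissible ρ θ₀ f) {q : ℝ × ℝ}
    (hq : q ∈ rect ρ) (h : f q ∈ wires ρ θ₀) : q ∈ wireEdges ρ := by
  rw [← hf.image_wireEdges] at h
  obtain ⟨p, hp, hpq⟩ := h
  rwa [← hf.injOn (wireEdges_subset hρ hp) hq hpq]

/-- A `C²` field that vanishes on the wires is admissible as soon as it is tangent to the tube. -/
lemma isAdmissibleField_of_eq_zero (hg : C2 ρ g)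
    (h0 : ∀ q ∈ rect ρ, f q ∈ wires ρ θ₀ → g q = 0)
    (hs : ∀ q ∈ sideEdges ρ, inner ℝ (g q) (radial (f q)) = 0) : IsAdmissibleField ρ θ₀ f g :=
  ⟨hg, fun q hq h => by rw [h0 q hq (Or.inl h)]; simp,
    fun q hq h => by rw [h0 q hq (Or.inr h)]; simp, hs⟩

/-- The projection to the horizontal plane. -/
def radialL : E3 →L[ℝ] E3 :=
  LinearMap.toContinuousLinearMap
    { toFun := radial
      map_add' := fun a b => by apply ext_coord <;> simp [radial]
      map_smul' := fun r a => by apply ext_coord <;> simp [radial] }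

@[simp] lemma radialL_apply (p : E3) : radialL p = radial p := rfl
@[simp] lemma radial_zero_coord (p : E3) : radial p 0 = p 0 := rfl
@[simp] lemma radial_one_coord (p : E3) : radial p 1 = p 1 := rfl
@[simp] lemma radial_two_coord (p : E3) : radial p 2 = 0 := rfl
@[simp] lemma zAxis_zero_coord : zAxis 0 = 0 := rfl
@[simp] lemma zAxis_one_coord : zAxis 1 = 0 := rfl
@[simp] lemma zAxis_two_coord : zAxis 2 = 1 := rfl

lemma inner_radial_radial (u v : E3) : inner ℝ (radial u) (radial v) = inner ℝ (radial u) v := by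
  simp [inner_coord]

lemma contDiffOn_radial {n : WithTop ℕ∞} {s : Set (ℝ × ℝ)} (hf : ContDiffOn ℝ n f s) :
    ContDiffOn ℝ n (fun q => radial (f q)) s :=
  radialL.contDiff.comp_contDiffOn hf

lemma dy_radial (hρ : 0 < ρ) (hf : C1 ρ f) {q : ℝ × ℝ} (hq : q ∈ rect ρ) :
    dy ρ (fun q => radial (f q)) q = radial (dy ρ f q) := dy_clm hρ radialL hf hq
lemma dz_radial (hρ : 0 < ρ) (hf : C1 ρ f) {q : ℝ × ℝ} (hq : q ∈ rect ρ) :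
    dz ρ (fun q => radial (f q)) q = radial (dz ρ f q) := dz_clm hρ radialL hf hq

lemma inner_radial_self_side (hf : IsAdmissible ρ θ₀ f) {q : ℝ × ℝ} (hq : q ∈ sideEdges ρ) :
    inner ℝ (radial (f q)) (radial (f q)) = (1 : ℝ) := by
  have := (hf.mapsTo_sideEdges hq).1
  rw [← this]
  simp only [inner_coord, radial_zero_coord, radial_one_coord, radial_two_coord]; ring

lemma mem_sideEdges {y s : ℝ} (hy : y = -1 ∨ y = 1) (hs : s ∈ Ioo 0 ρ) : (y, s) ∈ sideEdges ρ :=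
  ⟨hy, hs⟩
lemma mem_Icc_of_side {y : ℝ} (hy : y = -1 ∨ y = 1) : y ∈ Icc (-1 : ℝ) 1 := by
  rcases hy with rfl | rfl <;> simp

lemma inner_radial_dz_side (hρ : 0 < ρ) (hf : IsAdmissible ρ θ₀ f) {q : ℝ × ℝ}
    (hq : q ∈ sideEdges ρ) : inner ℝ (radial (f q)) (dz ρ f q) = 0 := by
  obtain ⟨y, s⟩ := q
  obtain ⟨hy, hs⟩ := hq
  simp only at hy hs
  have hr : C1 ρ (fun q => radial (f q)) := contDiffOn_radial (C2.c1 hf.contDiffOn)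
  have h1 := hasDerivAt_slice_z hr (mem_Icc_of_side hy) hs
  rw [dz_radial hρ (C2.c1 hf.contDiffOn) (sideEdges_subset (mem_sideEdges hy hs))] at h1
  have h2 := (h1.inner ℝ h1).unique ((hasDerivAt_const s (1 : ℝ)).congr_of_eventuallyEq (by
    filter_upwards [Ioo_mem_nhds hs.1 hs.2] with t ht
    exact inner_radial_self_side hf (mem_sideEdges hy ht)))
  rw [real_inner_comm (radial (f (y, s))) (radial (dz ρ f (y, s))), inner_radial_radial] at h2
  linarith

lemma bdryIntegral_eq_zero {u w : ℝ × ℝ → E3} (hρ : 0 < ρ)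
    (h : ∀ q ∈ rect ρ, q ∉ interior (rect ρ) → u q = 0) : bdryIntegral ρ u w = 0 := by
  have hz (y : ℝ) (hy : y = -1 ∨ y = 1) :
      ∫ s in (0 : ℝ)..ρ, (inner ℝ (u (y, s)) (dz ρ w (y, s)) : ℝ) = 0 := by
    refine intervalIntegral.integral_zero_ae (.of_forall fun s hs => ?_)
    rw [uIoc_of_le hρ.le] at hs
    rw [h (y, s) ⟨mem_Icc_of_side hy, hs.1.le, hs.2⟩, inner_zero_left]
    rw [interior_rect]
    rintro ⟨h1, -⟩
    rcases hy with rfl | rfl <;> simp at h1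
  have hy (z : ℝ) (hz : z = 0 ∨ z = ρ) :
      ∫ s in (-1 : ℝ)..1, (inner ℝ (u (s, z)) (dy ρ w (s, z)) : ℝ) = 0 := by
    refine intervalIntegral.integral_zero_ae (.of_forall fun s hs => ?_)
    rw [uIoc_of_le (by norm_num)] at hs
    rw [h (s, z) ⟨⟨hs.1.le, hs.2⟩, by rcases hz with rfl | rfl <;> simp [hρ.le]⟩, inner_zero_left]
    rw [interior_rect]
    rintro ⟨-, h1⟩
    rcases hz with rfl | rfl <;> simp at h1
  rw [bdryIntegral, hz 1 (Or.inr rfl), hz (-1) (Or.inl rfl), hy ρ (Or.inr rfl), hy 0 (Or.inl rfl)]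
  simp

/-- A critical surface is a minimal surface. -/
lemma meanDensity_eq_zero (hρ : 0 < ρ) (hf : IsAdmissible ρ θ₀ f)
    (hcrit : ∀ g, IsAdmissibleField ρ θ₀ f g → firstVar ρ f g = 0) {q : ℝ × ℝ} (hq : q ∈ rect ρ) :
    meanDensity ρ f q = 0 := by
  have hr := hf.isRegular hρ
  -- A bump times n is only C¹ and hence not an admissible field. Bumps times constant vectors X
  -- are, and X is set equal to n(q) only after the localization.
  suffices h : ∀ X : E3, ∀ q ∈ rect ρ, meanDensity ρ f q * inner ℝ X (unitNormal ρ f q) = 0 by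
    have h1 := h (unitNormal ρ f q) q hq
    rwa [(hr.isFrame hq).nn, mul_one] at h1
  intro X
  have hcont : ContinuousOn (fun q => meanDensity ρ f q * inner ℝ X (unitNormal ρ f q)) (rect ρ) :=
    hr.continuousOn_meanDensity.mul (continuousOn_const.inner hr.c1_unitNormal.continuousOn)
  refine eqOn_rect_of_ae hρ hcont (ae_restrict_of_ae ?_)
  refine isOpen_interior.ae_eq_zero_of_integral_contDiff_smul_eq_zero
    ((integrableOn_rect hcont).mono_set interior_subset).locallyIntegrableOn ?_
  intro φ hφ _ hφs
  have hφ0 (p) (hp : p ∉ interior (rect ρ)) : φ p = 0 := by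
    by_contra h
    exact hp (hφs (subset_tsupport _ h))
  have hφ2 : ContDiff ℝ 2 φ := hφ.of_le (WithTop.coe_le_coe.2 (le_top : (2 : ℕ∞) ≤ ⊤))
  have hg : C2 ρ (fun q => φ q • X) := (hφ2.smul contDiff_const).contDiffOn
  have hadm : IsAdmissibleField ρ θ₀ f (fun q => φ q • X) := by
    refine isAdmissibleField_of_eq_zero hg (fun p hp h => ?_) fun p hp => ?_
    · rw [hφ0 p, zero_smul]
      have h1 := hf.mem_wireEdges hρ hp h
      rw [interior_rect]
      rintro ⟨-, h2⟩
      rcases h1.2 with h | h <;> simp [h] at h2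
    · rw [hφ0 p, zero_smul, inner_zero_left]
      rw [interior_rect]
      rintro ⟨h2, -⟩
      rcases hp.1 with h | h <;> simp [h] at h2
  have h1 := hcrit _ hadm
  rw [hr.firstVar_eq hg.c1, bdryIntegral_eq_zero hρ (fun p hp hp' => by
    rw [hφ0 p hp', zero_smul]; exact (crossL _).map_zero), zero_add] at h1
  rw [← h1, ← integral_indicator (measurableSet_rect ρ)]
  congr 1
  ext1 p
  by_cases hp : p ∈ rect ρ
  · rw [indicator_of_mem hp, real_inner_smul_left, smul_eq_mul]; ring
  · rw [indicator_of_notMem hp, hφ0 p fun h => hp (interior_subset h), zero_smul]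

/-- A critical surface meets the tube orthogonally. -/
lemma inner_unitNormal_radial_side (hρ : 0 < ρ) (hf : IsAdmissible ρ θ₀ f)
    (hcrit : ∀ g, IsAdmissibleField ρ θ₀ f g → firstVar ρ f g = 0) {q : ℝ × ℝ}
    (hq : q ∈ sideEdges ρ) : inner ℝ (unitNormal ρ f q) (radial (f q)) = 0 := by
  have hr := hf.isRegular hρ
  obtain ⟨y₀, s₀⟩ := q
  obtain ⟨hy, hs₀⟩ := hq
  simp only at hy hs₀
  have hyI := mem_Icc_of_side hy
  have hy2 : y₀ * y₀ = 1 := by rcases hy with rfl | rfl <;> norm_num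
  -- The mean curvature being zero, the first variation of a field supported near one side is a
  -- boundary integral of tri n g f_z. Test fields must be tangent to the cylinder, so a constant X
  -- is replaced by its projection X - (X · r) r, which is C² along the surface.
  have key : ∀ X : E3, tri (unitNormal ρ f (y₀, s₀))
      (X - (inner ℝ X (radial (f (y₀, s₀))) : ℝ) • radial (f (y₀, s₀))) (dz ρ f (y₀, s₀)) = 0 := by
    intro X
    set P : ℝ × ℝ → E3 := fun q => X - (inner ℝ X (radial (f q)) : ℝ) • radial (f q) with hP
    have hrad : C2 ρ (fun q => radial (f q)) := contDiffOn_radial hf.contDiffOn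
    have hP2 : C2 ρ P := contDiffOn_const.sub ((contDiffOn_const.inner ℝ hrad).smul hrad)
    set u : ℝ → ℝ := fun s => tri (unitNormal ρ f (y₀, s)) (P (y₀, s)) (dz ρ f (y₀, s)) with hu
    have huc : ContinuousOn u (Icc 0 ρ) := continuousOn_tri
      (continuousOn_slice_z hr.c1_unitNormal.continuousOn hyI)
      (continuousOn_slice_z hP2.continuousOn hyI)
      (continuousOn_slice_z hr.c1_dz.continuousOn hyI)
    have hae : ∀ᵐ s, s ∈ Ioo 0 ρ → u s = 0 := by
      refine isOpen_Ioo.ae_eq_zero_of_integral_contDiff_smul_eq_zero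
        ((huc.integrableOn_Icc).mono_set Ioo_subset_Icc_self).locallyIntegrableOn ?_
      intro ψ hψ _ hψs
      have hψ0 (p) (hp : p ∉ Ioo 0 ρ) : ψ p = 0 := by
        by_contra h
        exact hp (hψs (subset_tsupport _ h))
      have hψ2 : ContDiff ℝ 2 ψ := hψ.of_le (WithTop.coe_le_coe.2 (le_top : (2 : ℕ∞) ≤ ⊤))
      -- The factor 1 + y₀ y is 2 on the side y = y₀ and 0 on the opposite side, while ψ vanishes at
      -- both wires; a single boundary integral survives.
      set g : ℝ × ℝ → E3 := fun q => ((1 + y₀ * q.1) * ψ q.2) • P q with hg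
      have hg2 : C2 ρ g :=
        ((contDiff_const.add (contDiff_const.mul contDiff_fst)).mul
          (hψ2.comp contDiff_snd)).contDiffOn.smul hP2
      have hg0 (q) (h : q.2 ∉ Ioo 0 ρ) : g q = 0 := by simp [hg, hψ0 _ h]
      have hopp (s) : g (-y₀, s) = 0 := by
        have : 1 + y₀ * -y₀ = 0 := by linarith
        simp only [hg]
        rw [this, zero_mul, zero_smul]
      have hadm : IsAdmissibleField ρ θ₀ f g := by
        refine isAdmissibleField_of_eq_zero hg2 (fun p hp h => hg0 p ?_) fun p hp => ?_
        · have h1 := hf.mem_wireEdges hρ hp h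
          rcases h1.2 with h | h <;> simp [h]
        · simp only [hg, hP, real_inner_smul_left, inner_sub_left, inner_radial_self_side hf hp]
          ring
      have h1 := hcrit _ hadm
      rw [hr.firstVar_eq hg2.c1, bdryIntegral] at h1
      have hH : ∫ q in rect ρ, meanDensity ρ f q * inner ℝ (g q) (unitNormal ρ f q) = 0 := by
        rw [setIntegral_congr_fun (g := fun _ => (0 : ℝ)) (measurableSet_rect ρ) fun q hq => by
          simp [meanDensity_eq_zero hρ hf hcrit hq]]
        simp
      have hc0 (x : E3) : cross x 0 = 0 := (crossL x).map_zero
      have hcy (s : ℝ) : g (s, ρ) = 0 := hg0 _ (by simp)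
      have hcy' (s : ℝ) : g (s, 0) = 0 := hg0 _ (by simp)
      have hval (s : ℝ) : inner ℝ (cross (unitNormal ρ f (y₀, s)) (g (y₀, s))) (dz ρ f (y₀, s)) =
          2 * (ψ s • u s) := by
        rw [← tri_eq_inner_cross]
        simp only [hg, hu, hy2, tri_coord, PiLp.smul_apply, smul_eq_mul]
        ring
      have h2 : ∫ s in (0 : ℝ)..ρ, inner ℝ (cross (unitNormal ρ f (y₀, s)) (g (y₀, s)))
          (dz ρ f (y₀, s)) = 0 := by
        rcases hy with rfl | rfl
        · rw [neg_neg] at hopp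
          simpa [hH, hcy, hcy', hopp, hc0] using h1
        · simpa [hH, hcy, hcy', hopp, hc0] using h1
      simp only [hval] at h2
      rw [intervalIntegral.integral_const_mul, intervalIntegral.integral_of_le hρ.le,
        ← integral_indicator measurableSet_Ioc] at h2
      have h3 := (mul_eq_zero.1 h2).resolve_left two_ne_zero
      rw [← h3]
      congr 1
      ext1 s
      by_cases hs : s ∈ Ioc 0 ρ
      · rw [indicator_of_mem hs]
      · rw [indicator_of_notMem hs, hψ0 s fun h => hs (Ioo_subset_Ioc_self h), zero_smul]
    have h4 : EqOn u 0 (Ioo 0 ρ) := by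
      refine Measure.eqOn_open_of_ae_eq (μ := (volume : Measure ℝ)) ?_ isOpen_Ioo
        (huc.mono Ioo_subset_Icc_self) continuousOn_const
      rw [Filter.EventuallyEq, ae_restrict_iff' measurableSet_Ioo]
      exact hae
    exact h4 hs₀
  have hq' : (y₀, s₀) ∈ sideEdges ρ := mem_sideEdges hy hs₀
  have hfr := hr.isFrame (sideEdges_subset hq')
  set n := unitNormal ρ f (y₀, s₀)
  set b := dz ρ f (y₀, s₀)
  set r := radial (f (y₀, s₀))
  have hb : 0 < inner ℝ b b := by
    have h1 := hfr.gram
    have h2 : 0 < areaElement ρ f (y₀, s₀) ^ 2 := pow_pos hfr.pos 2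
    by_contra! h
    have h3 : inner ℝ b b = 0 := le_antisymm h real_inner_self_nonneg
    have h4 : b = 0 := inner_self_eq_zero.1 h3
    rw [h3] at h1
    nlinarith [sq_nonneg (inner ℝ (dy ρ f (y₀, s₀)) b)]
  -- For X = b × n the identity reads |b|² = (r · (b × n))², so r · (b × n) ≠ 0 as b ≠ 0. For X = n
  -- it reads (n · r)(r · (b × n)) = 0.
  have k1 := key (cross b n)
  have k2 := key n
  have e1 (X : E3) (t : ℝ) : tri n (X - t • r) b = inner ℝ X (cross b n) - t * inner ℝ r (cross b n) := by
    simp only [tri_coord, inner_coord, cross_zero_coord, cross_one_coord, cross_two_coord,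
      PiLp.sub_apply, PiLp.smul_apply, smul_eq_mul]
    ring
  rw [e1] at k1 k2
  have e2 : inner ℝ (cross b n) (cross b n) = inner ℝ b b := by
    have : inner ℝ (cross b n) (cross b n) = inner ℝ b b * inner ℝ n n - inner ℝ n b ^ 2 := by
      simp only [inner_coord, cross_zero_coord, cross_one_coord, cross_two_coord]; ring
    rw [this, hfr.nn, hfr.nb]; ring
  have e3 : inner ℝ n (cross b n) = (0 : ℝ) := by
    simp only [inner_coord, cross_zero_coord, cross_one_coord, cross_two_coord]; ring
  rw [e2, real_inner_comm r (cross b n)] at k1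
  rw [e3, zero_sub, neg_eq_zero] at k2
  refine (mul_eq_zero.1 k2).resolve_right fun h => ?_
  rw [h] at k1
  linarith

end Critical

/-! ### A critical surface stays inside the tube and leaves it outward at the sides. -/

section Inside
open Filter
open scoped Topology
variable {ρ θ₀ : ℝ} {f : ℝ × ℝ → E3}

/-- Divided by J, the two triple products are the tangential coordinates of y, so the left side is J
times the inner product of x with the tangential part of y. -/
lemma IsFrame.grad_identity {a b n : E3} {J : ℝ} (h : IsFrame a b n J) (x y : E3) :
    inner ℝ x a * tri n y b + inner ℝ x b * tri n a y =
      J * (inner ℝ x y - inner ℝ n x * inner ℝ n y) := by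
  obtain ⟨α, β, ey⟩ := h.decomp y
  have e1 : tri n y b = α * J := by
    rw [← h.tri_eq, ey]
    simp only [tri_coord, PiLp.add_apply, PiLp.smul_apply, smul_eq_mul]; ring
  have e2 : tri n a y = β * J := by
    rw [← h.tri_eq, ey]
    simp only [tri_coord, PiLp.add_apply, PiLp.smul_apply, smul_eq_mul]; ring
  have e3 : inner ℝ x y = α * inner ℝ x a + β * inner ℝ x b + inner ℝ n y * inner ℝ n x := by
    conv_lhs => rw [ey]
    simp only [inner_add_right, real_inner_smul_right, real_inner_comm x n]
  rw [e1, e2, e3]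
  ring

lemma wireDir_zero_coord (θ : ℝ) : wireDir θ 0 = -Real.sin θ := rfl

lemma wireDir_one_coord (θ : ℝ) : wireDir θ 1 = Real.cos θ := rfl

lemma wireDir_two_coord (θ : ℝ) : wireDir θ 2 = 0 := rfl

lemma radial_sq_le_of_mem_wire {h θ : ℝ} {p : E3} (hp : p ∈ wire h θ) :
    inner ℝ (radial p) (radial p) ≤ (1 : ℝ) := by
  obtain ⟨s, hs, rfl⟩ := hp
  have e : inner ℝ (radial (s • wireDir θ + h • zAxis)) (radial (s • wireDir θ + h • zAxis)) =
      s ^ 2 * (Real.sin θ ^ 2 + Real.cos θ ^ 2) := by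
    simp only [inner_coord, radial_zero_coord, radial_one_coord, radial_two_coord, PiLp.add_apply,
      PiLp.smul_apply, smul_eq_mul, wireDir_zero_coord, wireDir_one_coord, zAxis_zero_coord,
      zAxis_one_coord]
    ring
  rw [e, Real.sin_sq_add_cos_sq, mul_one]
  exact (sq_le_one_iff_abs_le_one s).2 (abs_le.2 hs)

/-- A critical surface lies inside the tube. -/
lemma radial_sq_le_one (hρ : 0 < ρ) (hf : IsAdmissible ρ θ₀ f)
    (hcrit : ∀ g, IsAdmissibleField ρ θ₀ f g → firstVar ρ f g = 0) {q : ℝ × ℝ} (hq : q ∈ rect ρ) :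
    inner ℝ (radial (f q)) (radial (f q)) ≤ (1 : ℝ) := by
  have hr := hf.isRegular hρ
  set R : ℝ × ℝ → ℝ := fun q => inner ℝ (radial (f q)) (radial (f q)) - 1 with hR
  have hrad : C2 ρ (fun q => radial (f q)) := contDiffOn_radial hf.contDiffOn
  have hR2 : C2 ρ R := (hrad.inner ℝ hrad).sub contDiffOn_const
  -- The test field is the horizontal position, cut off where the surface is inside the tube. It
  -- vanishes on the wires and on the sides and is therefore admissible.
  set φ : ℝ × ℝ → ℝ := fun q => max (R q) 0 ^ 3 with hφ
  have hφ2 : C2 ρ φ := contDiff_max_pow_three.comp_contDiffOn hR2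
  have hg2 : C2 ρ (fun q => φ q • radial (f q)) := hφ2.smul hrad
  have hφ0 {q} (h : inner ℝ (radial (f q)) (radial (f q)) ≤ (1 : ℝ)) : φ q = 0 := by
    have : R q ≤ 0 := by simp only [hR]; linarith
    simp [hφ, max_eq_right this]
  have hadm : IsAdmissibleField ρ θ₀ f (fun q => φ q • radial (f q)) := by
    refine isAdmissibleField_of_eq_zero hg2 (fun p hp h => ?_) fun p hp => ?_
    · rcases h with h | h <;> rw [hφ0 (radial_sq_le_of_mem_wire h), zero_smul]
    · rw [hφ0 (inner_radial_self_side hf hp).le, zero_smul, inner_zero_left]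
  have hpt : ∀ q ∈ rect ρ, φ q * areaElement ρ f q ≤
      tri (unitNormal ρ f q) (dy ρ (fun q => φ q • radial (f q)) q) (dz ρ f q) +
      tri (unitNormal ρ f q) (dy ρ f q) (dz ρ (fun q => φ q • radial (f q)) q) := by
    intro q hq
    have hfr := hr.isFrame hq
    have hRy : dy ρ R q = 2 * inner ℝ (radial (f q)) (dy ρ f q) := by
      simp only [hR]
      rw [dy_sub hρ (hrad.c1.inner ℝ hrad.c1) contDiffOn_const hq, dy_const,
        dy_inner hρ hrad.c1 hrad.c1 hq, dy_radial hρ hr.c2.c1 hq, real_inner_comm,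
        inner_radial_radial]
      ring
    have hRz : dz ρ R q = 2 * inner ℝ (radial (f q)) (dz ρ f q) := by
      simp only [hR]
      rw [dz_sub hρ (hrad.c1.inner ℝ hrad.c1) contDiffOn_const hq, dz_const,
        dz_inner hρ hrad.c1 hrad.c1 hq, dz_radial hρ hr.c2.c1 hq, real_inner_comm,
        inner_radial_radial]
      ring
    have hφy : dy ρ φ q = dy ρ R q * (3 * max (R q) 0 ^ 2) := by
      have := dy_comp_real hρ (hasDerivAt_max_pow 1 (R q)) hR2.c1 hq
      simpa using this
    have hφz : dz ρ φ q = dz ρ R q * (3 * max (R q) 0 ^ 2) := by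
      have := dz_comp_real hρ (hasDerivAt_max_pow 1 (R q)) hR2.c1 hq
      simpa using this
    rw [dy_smul hρ hφ2.c1 hrad.c1 hq, dz_smul hρ hφ2.c1 hrad.c1 hq, dy_radial hρ hr.c2.c1 hq,
      dz_radial hρ hr.c2.c1 hq, hφy, hφz, hRy, hRz]
    set n := unitNormal ρ f q
    set a := dy ρ f q
    set b := dz ρ f q
    set r := radial (f q)
    have i1 := hfr.grad_identity r r
    have i2 := hfr.grad_identity zAxis zAxis
    have hn2 : inner ℝ n r ^ 2 ≤ inner ℝ r r := by
      have := real_inner_mul_inner_self_le n r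
      rw [hfr.nn] at this
      nlinarith
    have hφn : 0 ≤ φ q := by positivity
    have hJ := hfr.pos
    have hzz : inner ℝ zAxis zAxis = (1 : ℝ) := by
      simp only [inner_coord, zAxis_zero_coord, zAxis_one_coord, zAxis_two_coord]
      norm_num
    -- The surface divergence of the horizontal position field is 2 - (1 - (n · z)²) ≥ 1, and the
    -- gradient of φ adds a nonnegative term. The first variation is therefore at least the integral
    -- of φ; as it vanishes, so does φ.
    have e : tri n ((2 * inner ℝ r a * (3 * max (R q) 0 ^ 2)) • r + φ q • radial a) b +
        tri n a ((2 * inner ℝ r b * (3 * max (R q) 0 ^ 2)) • r + φ q • radial b) =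
        6 * max (R q) 0 ^ 2 * (inner ℝ r a * tri n r b + inner ℝ r b * tri n a r) +
        φ q * (2 * tri n a b - (inner ℝ zAxis a * tri n zAxis b + inner ℝ zAxis b * tri n a zAxis)) := by
      simp only [tri_coord, inner_coord, PiLp.add_apply, PiLp.smul_apply, smul_eq_mul,
        radial_zero_coord, radial_one_coord, radial_two_coord, zAxis_zero_coord, zAxis_one_coord,
        zAxis_two_coord]
      ring
    rw [e, i1, i2, hfr.tri_eq, hzz]
    have p1 : 0 ≤ 6 * max (R q) 0 ^ 2 * (areaElement ρ f q *
        (inner ℝ r r - inner ℝ n r * inner ℝ n r)) := by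
      have : 0 ≤ inner ℝ r r - inner ℝ n r * inner ℝ n r := by nlinarith
      positivity
    have p2 : 0 ≤ φ q * areaElement ρ f q * (inner ℝ n zAxis * inner ℝ n zAxis) :=
      mul_nonneg (by positivity) (mul_self_nonneg _)
    linarith
  have hcφ : ContinuousOn (fun q => φ q * areaElement ρ f q) (rect ρ) :=
    hφ2.continuousOn.mul hr.c1_areaElement.continuousOn
  have hint : ∫ q in rect ρ, φ q * areaElement ρ f q ≤ 0 := by
    rw [← hcrit _ hadm, firstVar]
    refine setIntegral_mono_on (integrableOn_rect hcφ) (integrableOn_rect ?_)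
      (measurableSet_rect ρ) hpt
    exact (continuousOn_tri hr.c1_unitNormal.continuousOn (hg2.c1.continuousOn_dy hρ)
        hr.c1_dz.continuousOn).add
      (continuousOn_tri hr.c1_unitNormal.continuousOn hr.c1_dy.continuousOn
        (hg2.c1.continuousOn_dz hρ))
  have h0 := eq_zero_of_integral_rect_nonpos hρ hcφ (fun q hq =>
    mul_nonneg (by positivity) (hr.areaElement_pos hq).le) hint q hq
  have h1 := (mul_eq_zero.1 h0).resolve_right (hr.areaElement_pos hq).ne'
  by_contra! h
  have h2 : 0 < R q := by simp only [hR]; linarith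
  simp only [hφ, max_eq_left h2.le] at h1
  exact absurd h1 (by positivity)

/-- At a side edge the surface points outward. -/
lemma inner_radial_dy_side_pos (hρ : 0 < ρ) (hf : IsAdmissible ρ θ₀ f)
    (hcrit : ∀ g, IsAdmissibleField ρ θ₀ f g → firstVar ρ f g = 0) {y₀ s : ℝ}
    (hy : y₀ = -1 ∨ y₀ = 1) (hs : s ∈ Ioo 0 ρ) :
    0 < y₀ * inner ℝ (radial (f (y₀, s))) (dy ρ f (y₀, s)) := by
  have hr := hf.isRegular hρ
  have hq := mem_sideEdges hy hs
  have hqr := sideEdges_subset hq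
  have hrad : C1 ρ (fun q => radial (f q)) := contDiffOn_radial hr.c2.c1
  set R : ℝ × ℝ → ℝ := fun q => inner ℝ (radial (f q)) (radial (f q)) with hR
  have hR1 : C1 ρ R := hrad.inner ℝ hrad
  have hRy : dy ρ R (y₀, s) = 2 * inner ℝ (radial (f (y₀, s))) (dy ρ f (y₀, s)) := by
    simp only [hR]
    rw [dy_inner hρ hrad hrad hqr, dy_radial hρ hr.c2.c1 hqr, real_inner_comm,
      inner_radial_radial]
    ring
  have h1 : R (y₀, s) = 1 := inner_radial_self_side hf hq
  have hd := hasDerivWithinAt_slice_y hR1 (mem_Icc_of_side hy) (Ioo_subset_Icc_self hs)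
  rw [hasDerivWithinAt_iff_tendsto_slope] at hd
  have hnb : (𝓝[Icc (-1 : ℝ) 1 \ {y₀}] y₀).NeBot := by
    rcases hy with rfl | rfl
    · have : Icc (-1 : ℝ) 1 \ {-1} = Ioc (-1) 1 := Icc_sdiff_left
      rw [this]
      exact left_nhdsWithin_Ioc_neBot (by norm_num)
    · have : Icc (-1 : ℝ) 1 \ {1} = Ico (-1) 1 := Icc_sdiff_right
      rw [this]
      exact right_nhdsWithin_Ico_neBot (by norm_num)
  -- The squared radius is at most 1 on the surface and equal to 1 on the side, which fixes the sign
  -- of its one-sided derivative.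
  have hnonneg : 0 ≤ y₀ * dy ρ R (y₀, s) := by
    refine ge_of_tendsto (hd.const_mul y₀) ?_
    filter_upwards [self_mem_nhdsWithin] with y hy'
    have hle : R (y, s) ≤ 1 := radial_sq_le_one hρ hf hcrit ⟨hy'.1, Ioo_subset_Icc_self hs⟩
    rw [slope_def_field, h1, ← mul_div_assoc]
    rcases hy with rfl | rfl
    · exact div_nonneg (by linarith) (by linarith [hy'.1.1])
    · exact div_nonneg_of_nonpos (by linarith) (by linarith [hy'.1.2])
  rw [hRy] at hnonneg
  -- If r were orthogonal to f_y, it would be orthogonal to the whole frame, since it is orthogonal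
  -- to n and to f_z as well; but r is a unit vector.
  have hne : inner ℝ (radial (f (y₀, s))) (dy ρ f (y₀, s)) ≠ 0 := by
    intro h0
    obtain ⟨α, β, e⟩ := (hr.isFrame hqr).decomp (radial (f (y₀, s)))
    have h2 : inner ℝ (radial (f (y₀, s))) (radial (f (y₀, s))) = (0 : ℝ) := by
      have h4 := congrArg (fun x => inner ℝ (radial (f (y₀, s))) x) e
      simp only [inner_add_right, real_inner_smul_right] at h4
      rw [h4, inner_unitNormal_radial_side hρ hf hcrit hq, h0, inner_radial_dz_side hρ hf hq]
      ring
    have h3 : inner ℝ (radial (f (y₀, s))) (radial (f (y₀, s))) = (1 : ℝ) := h1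
    linarith
  have hy0 : y₀ ≠ 0 := by rcases hy with rfl | rfl <;> norm_num
  exact lt_of_le_of_ne (by linarith) (mul_ne_zero hy0 hne).symm

end Inside

/-! ### The height of a critical surface -/

/-- The surface gradient of a scalar, as a vector. -/
def gradVec (ρ : ℝ) (f : ℝ × ℝ → E3) (u : ℝ × ℝ → ℝ) (q : ℝ × ℝ) : E3 :=
  dy ρ u q • dualY ρ f q + dz ρ u q • dualZ ρ f q

namespace IsRegular
variable {ρ : ℝ} {f : ℝ × ℝ → E3} {q : ℝ × ℝ}

lemma inner_dualY (hf : IsRegular ρ f) (hq : q ∈ rect ρ) (x : E3) :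
    areaElement ρ f q * inner ℝ (dualY ρ f q) x = tri (unitNormal ρ f q) x (dz ρ f q) := by
  have hJ := (hf.areaElement_pos hq).ne'
  rw [dualY, real_inner_smul_left, ← mul_assoc, mul_inv_cancel₀ hJ, one_mul]
  simp only [tri_coord, inner_coord, cross_zero_coord, cross_one_coord, cross_two_coord]; ring

lemma inner_dualZ (hf : IsRegular ρ f) (hq : q ∈ rect ρ) (x : E3) :
    areaElement ρ f q * inner ℝ (dualZ ρ f q) x = tri (unitNormal ρ f q) (dy ρ f q) x := by
  have hJ := (hf.areaElement_pos hq).ne'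
  rw [dualZ, real_inner_smul_left, ← mul_assoc, mul_inv_cancel₀ hJ, one_mul]
  simp only [tri_coord, inner_coord, cross_zero_coord, cross_one_coord, cross_two_coord]; ring

lemma inner_gradVec (hf : IsRegular ρ f) (hq : q ∈ rect ρ) (u : ℝ × ℝ → ℝ) (α β : ℝ) :
    inner ℝ (gradVec ρ f u q) (α • dy ρ f q + β • dz ρ f q) = α * dy ρ u q + β * dz ρ u q := by
  have hJ := (hf.areaElement_pos hq).ne'
  have h := hf.isFrame hq
  have ht := h.tri_eq
  have e1 : inner ℝ (dualY ρ f q) (dy ρ f q) = (1 : ℝ) := by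
    have := hf.inner_dualY hq (dy ρ f q)
    rw [ht] at this
    exact mul_left_cancel₀ hJ (by rw [this, mul_one])
  have e2 : inner ℝ (dualY ρ f q) (dz ρ f q) = (0 : ℝ) := by
    have := hf.inner_dualY hq (dz ρ f q)
    refine mul_left_cancel₀ hJ (by rw [this, mul_zero, tri_coord]; ring)
  have e3 : inner ℝ (dualZ ρ f q) (dy ρ f q) = (0 : ℝ) := by
    have := hf.inner_dualZ hq (dy ρ f q)
    refine mul_left_cancel₀ hJ (by rw [this, mul_zero, tri_coord]; ring)
  have e4 : inner ℝ (dualZ ρ f q) (dz ρ f q) = (1 : ℝ) := by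
    have := hf.inner_dualZ hq (dz ρ f q)
    rw [ht] at this
    exact mul_left_cancel₀ hJ (by rw [this, mul_one])
  simp only [gradVec, inner_add_left, inner_add_right, real_inner_smul_left,
    real_inner_smul_right, e1, e2, e3, e4]
  ring

lemma exists_gradVec_eq (hf : IsRegular ρ f) (hq : q ∈ rect ρ) (u : ℝ × ℝ → ℝ) :
    ∃ α β : ℝ, gradVec ρ f u q = α • dy ρ f q + β • dz ρ f q := by
  obtain ⟨α, β, e⟩ := (hf.isFrame hq).decomp (gradVec ρ f u q)
  refine ⟨α, β, ?_⟩
  have h0 : inner ℝ (unitNormal ρ f q) (gradVec ρ f u q) = (0 : ℝ) := by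
    rw [gradVec, dualY, dualZ]
    simp only [inner_add_right, real_inner_smul_right, inner_coord, cross_zero_coord,
      cross_one_coord, cross_two_coord]
    ring
  rwa [h0, zero_smul, add_zero] at e

lemma continuousOn_gradVec (hf : IsRegular ρ f) {u : ℝ × ℝ → ℝ} (hu : C1 ρ u) :
    ContinuousOn (gradVec ρ f u) (rect ρ) :=
  ((hu.continuousOn_dy hf.rho_pos).smul hf.c1_dualY.continuousOn).add
    ((hu.continuousOn_dz hf.rho_pos).smul hf.c1_dualZ.continuousOn)

end IsRegular

section Height
open Filter
open scoped Topology
variable {ρ θ₀ α β : ℝ} {f : ℝ × ℝ → E3}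

/-- An affine function of the height. -/
def affineHeight (α β : ℝ) (f : ℝ × ℝ → E3) (q : ℝ × ℝ) : ℝ := α + β * inner ℝ zAxis (f q)

lemma inner_zAxis (p : E3) : inner ℝ zAxis p = p 2 := by
  simp only [inner_coord, zAxis_zero_coord, zAxis_one_coord, zAxis_two_coord]; ring

lemma c2_affineHeight (hf : C2 ρ f) : C2 ρ (affineHeight α β f) :=
  contDiffOn_const.add (contDiffOn_const.mul (contDiffOn_const.inner ℝ hf))

lemma dy_affineHeight (hρ : 0 < ρ) (hf : C1 ρ f) {q : ℝ × ℝ} (hq : q ∈ rect ρ) :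
    dy ρ (affineHeight α β f) q = β * inner ℝ zAxis (dy ρ f q) := by
  unfold affineHeight
  rw [dy_add hρ contDiffOn_const (contDiffOn_const.mul (contDiffOn_const.inner ℝ hf)) hq,
    dy_const, dy_mul hρ contDiffOn_const (contDiffOn_const.inner ℝ hf) hq, dy_const,
    dy_inner hρ contDiffOn_const hf hq, dy_const, inner_zero_left]
  ring

lemma dz_affineHeight (hρ : 0 < ρ) (hf : C1 ρ f) {q : ℝ × ℝ} (hq : q ∈ rect ρ) :
    dz ρ (affineHeight α β f) q = β * inner ℝ zAxis (dz ρ f q) := by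
  unfold affineHeight
  rw [dz_add hρ contDiffOn_const (contDiffOn_const.mul (contDiffOn_const.inner ℝ hf)) hq,
    dz_const, dz_mul hρ contDiffOn_const (contDiffOn_const.inner ℝ hf) hq, dz_const,
    dz_inner hρ contDiffOn_const hf hq, dz_const, inner_zero_left]
  ring

/-- The first variation for a vertical field. -/
lemma firstVar_smul_zAxis (hf : IsRegular ρ f) {ψ : ℝ × ℝ → ℝ} (hψ : C1 ρ ψ) :
    β * firstVar ρ f (fun q => ψ q • zAxis) = ∫ q in rect ρ, areaElement ρ f q *
      inner ℝ (gradVec ρ f ψ q) (gradVec ρ f (affineHeight α β f) q) := by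
  rw [firstVar, ← integral_const_mul]
  refine setIntegral_congr_fun (measurableSet_rect ρ) fun q hq => ?_
  have hρ := hf.rho_pos
  have e1 : dy ρ (fun q => ψ q • zAxis) q = dy ρ ψ q • zAxis := by
    rw [dy_smul hρ hψ contDiffOn_const hq, dy_const, smul_zero, add_zero]
  have e2 : dz ρ (fun q => ψ q • zAxis) q = dz ρ ψ q • zAxis := by
    rw [dz_smul hρ hψ contDiffOn_const hq, dz_const, smul_zero, add_zero]
  obtain ⟨x, y, hxy⟩ := hf.exists_gradVec_eq hq ψ
  have e3 : inner ℝ (gradVec ρ f ψ q) (gradVec ρ f (affineHeight α β f) q) =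
      β * inner ℝ (gradVec ρ f ψ q) zAxis := by
    rw [real_inner_comm, hxy, hf.inner_gradVec hq, dy_affineHeight hρ hf.c2.c1 hq,
      dz_affineHeight hρ hf.c2.c1 hq, real_inner_comm zAxis]
    simp only [inner_add_right, real_inner_smul_right]
    ring
  have e4 : areaElement ρ f q * inner ℝ (gradVec ρ f ψ q) zAxis =
      dy ρ ψ q * tri (unitNormal ρ f q) zAxis (dz ρ f q) +
      dz ρ ψ q * tri (unitNormal ρ f q) (dy ρ f q) zAxis := by
    rw [← hf.inner_dualY hq, ← hf.inner_dualZ hq, gradVec]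
    simp only [inner_add_left, real_inner_smul_left]
    ring
  rw [e3, e1, e2, mul_left_comm, e4]
  simp only [tri_coord, PiLp.smul_apply, smul_eq_mul]
  ring

lemma isAdmissibleField_smul_zAxis {ψ : ℝ × ℝ → ℝ}
    (hψ : C2 ρ ψ) (h0 : ∀ q ∈ rect ρ, f q ∈ wires ρ θ₀ → ψ q = 0) :
    IsAdmissibleField ρ θ₀ f (fun q => ψ q • zAxis) := by
  refine isAdmissibleField_of_eq_zero (hψ.smul contDiffOn_const)
    (fun q hq h => by rw [h0 q hq h, zero_smul]) fun q hq => ?_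
  simp only [inner_coord, PiLp.smul_apply, smul_eq_mul, zAxis_zero_coord, zAxis_one_coord,
    zAxis_two_coord, radial_zero_coord, radial_one_coord, radial_two_coord]
  ring

/-- Weak maximum principle. Vertical fields are tangent to the cylinder, so the height is weakly
harmonic among test functions that vanish only on the wires. Testing with the cube ψ of the negative
part makes ψ constant on the segments in direction z, and ψ = 0 at their ends on the edge z = 0. -/
lemma affineHeight_nonneg (hρ : 0 < ρ) (hf : IsAdmissible ρ θ₀ f)
    (hcrit : ∀ g, IsAdmissibleField ρ θ₀ f g → firstVar ρ f g = 0)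
    (hw : ∀ q ∈ rect ρ, f q ∈ wires ρ θ₀ → 0 ≤ affineHeight α β f q) {q : ℝ × ℝ}
    (hq : q ∈ rect ρ) : 0 ≤ affineHeight α β f q := by
  have hr := hf.isRegular hρ
  set l := affineHeight α β f with hl
  have hl2 : C2 ρ l := c2_affineHeight hr.c2
  set ψ : ℝ × ℝ → ℝ := fun q => max (-l q) 0 ^ 3 with hψ
  have hψ2 : C2 ρ ψ := contDiff_max_pow_three.comp_contDiffOn hl2.neg
  have hln : C1 ρ (fun q => -l q) := C2.c1 hl2.neg
  have hψ0 : ∀ q ∈ rect ρ, f q ∈ wires ρ θ₀ → ψ q = 0 := fun q hq h => by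
    have := hw q hq h
    simp only [hψ]
    rw [max_eq_right (by linarith)]; norm_num
  have hv := firstVar_smul_zAxis (α := α) (β := β) hr hψ2.c1
  rw [hcrit _ (isAdmissibleField_smul_zAxis hψ2 hψ0), mul_zero] at hv
  have hneg : ∀ q ∈ rect ρ, dy ρ (fun q => -l q) q = -dy ρ l q ∧
      dz ρ (fun q => -l q) q = -dz ρ l q := fun q hq => by
    simp only [dy, dz]
    rw [fderivWithin_fun_neg (uniqueDiffOn_rect hρ q hq)]; exact ⟨rfl, rfl⟩
  have hψy : ∀ q ∈ rect ρ, dy ρ ψ q = -(3 * max (-l q) 0 ^ 2) * dy ρ l q := fun q hq => by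
    have := dy_comp_real (u := fun q => -l q) hρ (hasDerivAt_max_pow 1 (-l q)) hln hq
    rw [(hneg q hq).1] at this
    refine this.trans ?_
    simp; ring
  have hψz : ∀ q ∈ rect ρ, dz ρ ψ q = -(3 * max (-l q) 0 ^ 2) * dz ρ l q := fun q hq => by
    have := dz_comp_real (u := fun q => -l q) hρ (hasDerivAt_max_pow 1 (-l q)) hln hq
    rw [(hneg q hq).2] at this
    refine this.trans ?_
    simp; ring
  have hgrad : ∀ q ∈ rect ρ, gradVec ρ f ψ q = -(3 * max (-l q) 0 ^ 2) • gradVec ρ f l q :=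
    fun q hq => by
      simp only [gradVec, hψy q hq, hψz q hq]; module
  have hpos : ∀ q ∈ rect ρ, 0 ≤ -(areaElement ρ f q *
      inner ℝ (gradVec ρ f ψ q) (gradVec ρ f l q)) := fun q hq => by
    rw [hgrad q hq, real_inner_smul_left, real_inner_self_eq_norm_sq]
    have := (hr.areaElement_pos hq).le
    have h3 : 0 ≤ areaElement ρ f q * (3 * max (-l q) 0 ^ 2 * ‖gradVec ρ f l q‖ ^ 2) := by positivity
    linarith
  have hcont : ContinuousOn (fun q => -(areaElement ρ f q *
      inner ℝ (gradVec ρ f ψ q) (gradVec ρ f l q))) (rect ρ) :=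
    (hr.c1_areaElement.continuousOn.mul ((hr.continuousOn_gradVec hψ2.c1).inner
      (hr.continuousOn_gradVec hl2.c1))).neg
  have hz := eq_zero_of_integral_rect_nonpos hρ hcont hpos
    (by rw [integral_neg, ← hv, neg_zero])
  have hψz0 : ∀ q ∈ rect ρ, dz ρ ψ q = 0 := fun q hq => by
    have h1 := hz q hq
    rw [hgrad q hq, real_inner_smul_left, real_inner_self_eq_norm_sq, neg_eq_zero] at h1
    have h2 := (mul_eq_zero.1 h1).resolve_left (hr.areaElement_pos hq).ne'
    rw [hψz q hq]
    rcases mul_eq_zero.1 h2 with h3 | h3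
    · rw [h3, zero_mul]
    · have h4 : gradVec ρ f l q = 0 := by simpa using h3
      have h5 := hr.inner_gradVec hq l 0 1
      rw [h4, inner_zero_left] at h5
      have : dz ρ l q = 0 := by linarith
      rw [this, mul_zero]
  obtain ⟨y, z⟩ := q
  have hconst : ψ (y, z) = ψ (y, 0) := by
    refine constant_of_has_deriv_right_zero (a := 0) (b := ρ) (f := fun s => ψ (y, s))
      (continuousOn_slice_z hψ2.continuousOn hq.1) (fun s hs => ?_) z hq.2
    have h1 := hasDerivWithinAt_slice_z hψ2.c1 hq.1 (Ico_subset_Icc_self hs)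
    rw [hψz0 (y, s) ⟨hq.1, Ico_subset_Icc_self hs⟩] at h1
    exact h1.mono_of_mem_nhdsWithin (mem_of_superset (Icc_mem_nhdsGE hs.2)
      (Icc_subset_Icc_left hs.1))
  have hw0 : ψ (y, 0) = 0 := by
    have hm : ((y, 0) : ℝ × ℝ) ∈ wireEdges ρ := ⟨hq.1, Or.inl rfl⟩
    refine hψ0 _ (wireEdges_subset hρ hm) ?_
    rw [← hf.image_wireEdges]
    exact mem_image_of_mem f hm
  rw [hw0] at hconst
  by_contra! h
  simp only [hψ, max_eq_left (neg_pos.2 h).le] at hconst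
  have : 0 < (-l (y, z)) ^ 3 := pow_pos (neg_pos.2 h) 3
  linarith

/-- A local bound for the Dirichlet energy of the logarithm of a nonnegative affine function of the
height. -/
lemma integral_log_height_le (hρ : 0 < ρ) (hf : IsAdmissible ρ θ₀ f)
    (hcrit : ∀ g, IsAdmissibleField ρ θ₀ f g → firstVar ρ f g = 0)
    (h0 : ∀ q ∈ rect ρ, 0 ≤ affineHeight α β f q) {η : ℝ × ℝ → ℝ} (hη : C2 ρ η)
    (hη0 : ∀ q ∈ wireEdges ρ, η q = 0) {ε : ℝ} (hε : 0 < ε) :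
    ∫ q in rect ρ, areaElement ρ f q * η q ^ 2 *
        (‖gradVec ρ f (affineHeight α β f) q‖ / (affineHeight α β f q + ε)) ^ 2 ≤
      ∫ q in rect ρ, 4 * areaElement ρ f q * ‖gradVec ρ f η q‖ ^ 2 := by
  have hr := hf.isRegular hρ
  set l := affineHeight α β f with hl
  have hl2 : C2 ρ l := c2_affineHeight hr.c2
  have hlε : ∀ q ∈ rect ρ, l q + ε ≠ 0 := fun q hq => by have := h0 q hq; positivity
  -- The standard test function η²/(l + ε) for a Caccioppoli inequality for log (l + ε); ε > 0 keeps
  -- it C² where l vanishes.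
  set ψ : ℝ × ℝ → ℝ := fun q => η q ^ 2 * (l q + ε)⁻¹ with hψ
  have hle2 : C2 ρ (fun q => l q + ε) := hl2.add contDiffOn_const
  have hinv2 : C2 ρ (fun q => (l q + ε)⁻¹) := hle2.inv hlε
  have hη22 : C2 ρ (fun q => η q ^ 2) := hη.pow 2
  have hψ2 : C2 ρ ψ := hη22.mul hinv2
  have hv := firstVar_smul_zAxis (α := α) (β := β) hr hψ2.c1
  rw [hcrit _ (isAdmissibleField_smul_zAxis hψ2 fun q hq h => by
    simp [hψ, hη0 q (hf.mem_wireEdges hρ hq h)]), mul_zero] at hv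
  have hgrad : ∀ q ∈ rect ρ, gradVec ρ f ψ q =
      (2 * η q * (l q + ε)⁻¹) • gradVec ρ f η q - (η q ^ 2 * (l q + ε)⁻¹ ^ 2) • gradVec ρ f l q := by
    intro q hq
    have e1 : dy ρ (fun q => l q + ε) q = dy ρ l q := by
      rw [dy_add hρ hl2.c1 contDiffOn_const hq, dy_const, add_zero]
    have e2 : dz ρ (fun q => l q + ε) q = dz ρ l q := by
      rw [dz_add hρ hl2.c1 contDiffOn_const hq, dz_const, add_zero]
    have hd := hasDerivAt_inv (hlε q hq)
    have hd2 := hasDerivAt_pow 2 (η q)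
    have a1 := dy_comp_real hρ hd hle2.c1 hq
    have a2 := dz_comp_real hρ hd hle2.c1 hq
    have b1 := dy_comp_real hρ hd2 hη.c1 hq
    have b2 := dz_comp_real hρ hd2 hη.c1 hq
    have c1 : dy ρ ψ q = _ := dy_mul hρ hη22.c1 hinv2.c1 hq
    have c2 : dz ρ ψ q = _ := dz_mul hρ hη22.c1 hinv2.c1 hq
    rw [a1, b1, e1] at c1
    rw [a2, b2, e2] at c2
    simp only [smul_eq_mul, Nat.cast_ofNat, Nat.add_one_sub_one, pow_one] at c1 c2
    rw [gradVec, c1, c2, gradVec, gradVec, inv_pow]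
    module
  have hcg := hr.continuousOn_gradVec hl2.c1
  have hcη := hr.continuousOn_gradVec hη.c1
  have hJ := hr.c1_areaElement.continuousOn
  have i1 : IntegrableOn (fun q => 4 * areaElement ρ f q * ‖gradVec ρ f η q‖ ^ 2) (rect ρ) :=
    integrableOn_rect ((continuousOn_const.mul hJ).mul (hcη.norm.pow 2))
  have i2 : IntegrableOn (fun q => 2 * (areaElement ρ f q *
      inner ℝ (gradVec ρ f ψ q) (gradVec ρ f l q))) (rect ρ) :=
    integrableOn_rect (continuousOn_const.mul
      (hJ.mul ((hr.continuousOn_gradVec hψ2.c1).inner hcg)))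
  calc _ ≤ ∫ q in rect ρ, (4 * areaElement ρ f q * ‖gradVec ρ f η q‖ ^ 2 -
        2 * (areaElement ρ f q * inner ℝ (gradVec ρ f ψ q) (gradVec ρ f l q))) := by
        refine setIntegral_mono_on (integrableOn_rect ((hJ.mul (hη.continuousOn.pow 2)).mul
          ((hcg.norm.div hle2.continuousOn hlε).pow 2))) (i1.sub i2) (measurableSet_rect ρ)
          fun q hq => ?_
        rw [hgrad q hq, inner_sub_left, real_inner_smul_left, real_inner_smul_left]
        -- After the expansion of the gradient of ψ, the claimed pointwise inequality is |2∇η -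
        -- η∇l/(l + ε)|² ≥ 0.
        have h1 : 0 ≤ areaElement ρ f q * ‖(2 : ℝ) • gradVec ρ f η q -
            (η q * (l q + ε)⁻¹) • gradVec ρ f l q‖ ^ 2 := by
          have := (hr.areaElement_pos hq).le
          positivity
        rw [← real_inner_self_eq_norm_sq] at h1
        simp only [inner_sub_left, inner_sub_right, real_inner_smul_left, real_inner_smul_right,
          real_inner_comm (gradVec ρ f η q)] at h1
        rw [real_inner_self_eq_norm_sq, real_inner_self_eq_norm_sq] at h1
        rw [real_inner_self_eq_norm_sq, div_pow, div_eq_mul_inv, ← inv_pow]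
        linarith
    _ = _ := by
        rw [integral_sub i1 i2, integral_const_mul, ← hv, mul_zero, sub_zero]

/-- Each of the edges `z = 0` and `z = ρ` is mapped to one wire. -/
lemma wireEdges_cases (hρ : 0 < ρ) (hf : IsAdmissible ρ θ₀ f) :
    (∀ y ∈ Icc (-1 : ℝ) 1, f (y, 0) ∈ wire 0 0 ∧ f (y, ρ) ∈ wire ρ θ₀) ∨
      ∀ y ∈ Icc (-1 : ℝ) 1, f (y, 0) ∈ wire ρ θ₀ ∧ f (y, ρ) ∈ wire 0 0 := by
  have hh {h θ : ℝ} {p : E3} (hp : p ∈ wire h θ) : p 2 = h := by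
    obtain ⟨s, hs, rfl⟩ := hp
    simp [wireDir, zAxis]
  have hmem {y z : ℝ} (hy : y ∈ Icc (-1 : ℝ) 1) (hz : z = 0 ∨ z = ρ) : f (y, z) ∈ wires ρ θ₀ := by
    rw [← hf.image_wireEdges]
    exact mem_image_of_mem f ⟨hy, hz⟩
  have hcont {z : ℝ} (hz : z ∈ Icc 0 ρ) : ContinuousOn (fun y => f (y, z) 2) (Icc (-1) 1) := by
    have := continuousOn_slice_y hf.contDiffOn.continuousOn hz
    exact (EuclideanSpace.proj (𝕜 := ℝ) (2 : Fin 3)).continuous.comp_continuousOn this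
  have hedge {z : ℝ} (hz : z = 0 ∨ z = ρ) : (∀ y ∈ Icc (-1 : ℝ) 1, f (y, z) ∈ wire 0 0) ∨
      ∀ y ∈ Icc (-1 : ℝ) 1, f (y, z) ∈ wire ρ θ₀ := by
    have hzI : z ∈ Icc 0 ρ := by rcases hz with rfl | rfl <;> simp [hρ.le]
    have h0 : (0 : ℝ) ∈ Icc (-1 : ℝ) 1 := by simp
    -- The height on an edge is continuous with values in {0, ρ}, hence constant: an edge cannot
    -- switch wires.
    have hval (y) (hy : y ∈ Icc (-1 : ℝ) 1) : f (y, z) 2 ∈ ({0, ρ} : Set ℝ) := by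
      rcases hmem hy hz with h | h
      · exact Or.inl (hh h)
      · exact Or.inr (hh h)
    have hc (y) (hy : y ∈ Icc (-1 : ℝ) 1) : f (y, z) 2 = f (0, z) 2 :=
      isPreconnected_Icc.constant_of_mapsTo (T := {0, ρ})
        (Set.toFinite _).isDiscrete (hcont hzI) hval hy h0
    rcases hmem h0 hz with h | h
    · left
      intro y hy
      rcases hmem hy hz with h' | h'
      · exact h'
      · exact absurd ((hh h').symm.trans ((hc y hy).trans (hh h))) hρ.ne'
    · right
      intro y hy
      rcases hmem hy hz with h' | h'
      · exact absurd ((hh h).symm.trans ((hc y hy).symm.trans (hh h'))) hρ.ne'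
      · exact h'
  -- Each wire is reached by some edge, so the two edges cannot lie on the same wire.
  have hcover {h θ : ℝ} (hw : wire h θ ⊆ wires ρ θ₀) :
      ∃ y ∈ Icc (-1 : ℝ) 1, f (y, 0) 2 = h ∨ f (y, ρ) 2 = h := by
    have hp : (0 : ℝ) • wireDir θ + h • zAxis ∈ wire h θ := ⟨0, by simp, rfl⟩
    have := hw hp
    rw [← hf.image_wireEdges] at this
    obtain ⟨⟨y, z⟩, ⟨hy, hz⟩, hq⟩ := this
    have h2 := hh hp
    rw [← hq] at h2
    rcases hz with hz | hz <;> simp only at hz <;> subst hz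
    · exact ⟨y, hy, Or.inl h2⟩
    · exact ⟨y, hy, Or.inr h2⟩
  rcases hedge (Or.inl rfl) with h1 | h1 <;> rcases hedge (Or.inr rfl) with h2 | h2
  · obtain ⟨y, hy, h | h⟩ := hcover (h := ρ) (θ := θ₀) subset_union_right
    · exact absurd (h.symm.trans (hh (h1 y hy))) hρ.ne'
    · exact absurd (h.symm.trans (hh (h2 y hy))) hρ.ne'
  · exact Or.inl fun y hy => ⟨h1 y hy, h2 y hy⟩
  · exact Or.inr fun y hy => ⟨h1 y hy, h2 y hy⟩
  · obtain ⟨y, hy, h | h⟩ := hcover (h := 0) (θ := 0) subset_union_left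
    · exact absurd (h.symm.trans (hh (h1 y hy))) hρ.ne
    · exact absurd (h.symm.trans (hh (h2 y hy))) hρ.ne

/-- The integral over a cone with vertex on a side edge. -/
lemma integral_cone_le (hρ : 0 < ρ) {D : ℝ × ℝ → ℝ} (hD : Continuous D) (h0 : ∀ q, 0 ≤ D q)
    {y₀ s₀ z₁ δ r : ℝ} (hy : y₀ = -1 ∨ y₀ = 1) (hs : s₀ ∈ Icc 0 ρ) (hz : 0 ≤ z₁) (hδ : 0 ≤ δ)
    (hzδ : z₁ + δ ≤ ρ) (hr : 0 ≤ r) (hr1 : r ≤ 1) :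
    ∫ τ in (0 : ℝ)..δ, ∫ s in r..1, s * D (y₀ * (1 - s), s₀ + s * (z₁ + τ - s₀)) ≤
      ∫ q in rect ρ, D q := by
  set E : ℝ → ℝ := fun y => ∫ z in (0 : ℝ)..ρ, D (y, z) with hE
  have hEc : Continuous E := intervalIntegral.continuous_parametric_intervalIntegral_of_continuous'
    (f := fun y z => D (y, z)) (by simpa [Function.uncurry_def] using hD) 0 ρ
  have hE0 (y) : 0 ≤ E y := intervalIntegral.integral_nonneg hρ.le fun _ _ => h0 _
  have hrect : ∫ q in rect ρ, D q = ∫ y in (-1 : ℝ)..1, E y := by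
    rw [rect, Measure.volume_eq_prod, setIntegral_prod, intervalIntegral.integral_of_le (by norm_num),
      integral_Icc_eq_integral_Ioc]
    · simp only [hE, intervalIntegral.integral_of_le hρ.le, integral_Icc_eq_integral_Ioc]
    · exact hD.continuousOn.integrableOn_compact (isCompact_Icc.prod isCompact_Icc)
  have hGc : Continuous (fun x : ℝ × ℝ => x.2 * D (y₀ * (1 - x.2), s₀ + x.2 * (z₁ + x.1 - s₀))) := by
    fun_prop
  -- The segments run from the vertex (y₀, s₀) at s = 0 to the point (0, z₁ + τ) at s = 1, and s is
  -- the Jacobian of (τ, s) ↦ point. For fixed s, the integral in τ covers a part of the segment y =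
  -- y₀(1 - s) of the rectangle.
  rw [intervalIntegral_intervalIntegral_swap
    (F := fun τ s => s * D (y₀ * (1 - s), s₀ + s * (z₁ + τ - s₀)))
    (IntegrableOn.mono_set (hGc.continuousOn.integrableOn_compact
      (isCompact_uIcc (a := 0) (b := δ) |>.prod (isCompact_uIcc (a := r) (b := 1))))
      (prod_mono uIoc_subset_uIcc uIoc_subset_uIcc))]
  calc _ ≤ ∫ s in r..1, E (y₀ * (1 - s)) := by
        refine intervalIntegral.integral_mono_on hr1 (Continuous.intervalIntegrable ?_ _ _)
          (Continuous.intervalIntegrable (by fun_prop) _ _) fun s hs' => ?_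
        · exact intervalIntegral.continuous_parametric_intervalIntegral_of_continuous'
            (f := fun s τ => s * D (y₀ * (1 - s), s₀ + s * (z₁ + τ - s₀)))
            (hGc.comp continuous_swap) 0 δ
        have hs0 : 0 ≤ s := hr.trans hs'.1
        have hs1 := hs'.2
        have e1 : ∀ τ, s₀ + s * (z₁ + τ - s₀) = s₀ + s * (z₁ - s₀) + s * τ := fun τ => by ring
        simp only [e1]
        rw [intervalIntegral.integral_const_mul, ← smul_eq_mul (a := s),
          intervalIntegral.smul_integral_comp_add_mul (fun z => D (y₀ * (1 - s), z))]
        have hs0' := hs.1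
        have hs1' := hs.2
        refine intervalIntegral.integral_mono_interval ?_ ?_ ?_ (.of_forall fun _ => h0 _)
          (Continuous.intervalIntegrable (by fun_prop) _ _)
        · nlinarith
        · nlinarith
        · nlinarith
    _ ≤ ∫ y in (-1 : ℝ)..1, E y := by
        rcases hy with rfl | rfl
        · have := intervalIntegral.integral_comp_sub_right (a := r) (b := 1) E 1
          have e (s : ℝ) : -1 * (1 - s) = s - 1 := by ring
          simp only [e, this]
          exact intervalIntegral.integral_mono_interval (by linarith) (by linarith) (by norm_num)
            (.of_forall fun _ => hE0 _) (hEc.intervalIntegrable _ _)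
        · have := intervalIntegral.integral_comp_sub_left (a := r) (b := 1) E 1
          simp only [one_mul, this]
          exact intervalIntegral.integral_mono_interval (by norm_num) (by linarith) (by linarith)
            (.of_forall fun _ => hE0 _) (hEc.intervalIntegrable _ _)
    _ = _ := hrect.symm

/-- A function of class `C²` that vanishes to first order at a point is bounded by a multiple of the
squared distance. -/
lemma exists_le_sq_dist (hρ : 0 < ρ) {l : ℝ × ℝ → ℝ} (hl : C2 ρ l) {q₀ : ℝ × ℝ} (hq₀ : q₀ ∈ rect ρ)
    (h0 : l q₀ = 0) (hy : dy ρ l q₀ = 0) (hz : dz ρ l q₀ = 0) :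
    ∃ C, 0 ≤ C ∧ ∀ q ∈ rect ρ, l q ≤ C * ‖q - q₀‖ ^ 2 := by
  set D := fderivWithin ℝ l (rect ρ) with hDdef
  have hD1 : C1 ρ D := hl.fderivWithin hρ
  have hD0 : D q₀ = 0 := by
    refine ContinuousLinearMap.ext fun a => ?_
    rw [hDdef, fderivWithin_eq_dy_dz, hy, hz]; simp
  obtain ⟨M, hM⟩ := (isCompact_rect ρ).exists_bound_of_continuousOn
    (hD1.continuousOn_fderivWithin hρ)
  have hM0 : 0 ≤ M := (norm_nonneg _).trans (hM q₀ hq₀)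
  -- The derivative vanishes at q₀ and is Lipschitz. A second mean value estimate, on the part of
  -- the rectangle within distance ‖q - q₀‖ of q₀, gives the square.
  have h1 : ∀ q ∈ rect ρ, ‖D q‖ ≤ M * ‖q - q₀‖ := fun q hq => by
    have := (convex_rect ρ).norm_image_sub_le_of_norm_fderivWithin_le (𝕜 := ℝ)
      (fun x hx => hD1.diff hx) hM hq₀ hq
    rwa [hD0, sub_zero] at this
  refine ⟨M, hM0, fun q hq => ?_⟩
  have h2 := ((convex_rect ρ).inter (convex_closedBall q₀ ‖q - q₀‖)).norm_image_sub_le_of_norm_hasFDerivWithin_le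
    (𝕜 := ℝ) (f := l) (f' := D) (C := M * ‖q - q₀‖)
    (fun x hx => (hl.c1.diff hx.1).hasFDerivWithinAt.mono inter_subset_left)
    (fun x hx => (h1 x hx.1).trans (mul_le_mul_of_nonneg_left
      (by rw [← dist_eq_norm]; exact hx.2) hM0))
    (x := q₀) (y := q) ⟨hq₀, by simp⟩ ⟨hq, by simp [dist_eq_norm]⟩
  rw [h0, sub_zero, Real.norm_eq_abs] at h2
  calc l q ≤ |l q| := le_abs_self _
    _ ≤ _ := h2
    _ = _ := by ring

set_option maxHeartbeats 1000000 in
/-- A critical surface meets the rim of the tube only at the wires. -/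
lemma affineHeight_pos_of_mem_sideEdges (hρ : 0 < ρ) (hf : IsAdmissible ρ θ₀ f)
    (hcrit : ∀ g, IsAdmissibleField ρ θ₀ f g → firstVar ρ f g = 0)
    (hw : ∀ q ∈ rect ρ, f q ∈ wires ρ θ₀ → 0 ≤ affineHeight α β f q)
    (hpos : 0 < affineHeight α β f (0, 0) ∨ 0 < affineHeight α β f (0, ρ)) {q : ℝ × ℝ}
    (hq : q ∈ sideEdges ρ) : 0 < affineHeight α β f q := by
  have hr := hf.isRegular hρ
  have hnn : ∀ q ∈ rect ρ, 0 ≤ affineHeight α β f q := fun q hq =>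
    affineHeight_nonneg hρ hf hcrit hw hq
  obtain ⟨y₀, s₀⟩ := q
  have hqr := sideEdges_subset hq
  obtain ⟨hy, hs⟩ := id hq
  simp only at hy hs
  by_contra! hle
  have hl0 : affineHeight α β f (y₀, s₀) = 0 := le_antisymm hle (hnn _ hqr)
  -- The nonnegative l has an interior minimum along the open side edge.
  have hdz : dz ρ (affineHeight α β f) (y₀, s₀) = 0 := by
    refine IsLocalMin.hasDerivAt_eq_zero (f := fun s => affineHeight α β f (y₀, s)) (a := s₀) ?_
      (hasDerivAt_slice_z (c2_affineHeight hr.c2).c1 (mem_Icc_of_side hy) hs)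
    filter_upwards [Ioo_mem_nhds hs.1 hs.2] with s hs'
    rw [hl0]
    exact hnn _ ⟨mem_Icc_of_side hy, Ioo_subset_Icc_self hs'⟩
  -- By orthogonality the horizontal vector r is tangent to the surface, r = p f_y + t f_z with p ≠
  -- 0. Its zero height component transfers the vanishing from the z-derivative to the y-derivative.
  have hdy : dy ρ (affineHeight α β f) (y₀, s₀) = 0 := by
    rw [dz_affineHeight hρ hr.c2.c1 hqr] at hdz
    rw [dy_affineHeight hρ hr.c2.c1 hqr]
    obtain ⟨p, t, e⟩ := (hr.isFrame hqr).decomp (radial (f (y₀, s₀)))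
    rw [inner_unitNormal_radial_side hρ hf hcrit hq, zero_smul, add_zero] at e
    have e1 := congrArg (fun x => inner ℝ (radial (f (y₀, s₀))) x) e
    have e2 := congrArg (fun x => β * inner ℝ zAxis x) e
    simp only [inner_add_right, real_inner_smul_right] at e1 e2
    rw [inner_radial_dz_side hρ hf hq, inner_radial_self_side hf hq] at e1
    rw [inner_zAxis, radial_two_coord] at e2
    have hp : p ≠ 0 := by rintro rfl; linarith
    have e3 : p * (β * inner ℝ zAxis (dy ρ f (y₀, s₀))) = 0 := by
      linear_combination -e2 - t * hdz
    exact (mul_eq_zero.1 e3).resolve_left hp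
  set l := affineHeight α β f with hl
  have hl2 : C2 ρ l := c2_affineHeight hr.c2
  obtain ⟨C, hC0, hC⟩ := exists_le_sq_dist hρ hl2 hqr hl0 hdy hdz
  -- The cone will join the contact point to a short interval of the line y = 0 on which l ≥ m > 0.
  obtain ⟨z₁, hz₁, hlz₁⟩ : ∃ z ∈ Ioo 0 ρ, 0 < l (0, z) := by
    have hc := continuousOn_slice_z (y := 0) hl2.continuousOn (by simp)
    rcases hpos with h | h
    · have h1 := ((hc 0 ⟨le_rfl, hρ.le⟩).eventually (lt_mem_nhds h)).filter_mono
        (nhdsWithin_mono 0 Ioo_subset_Icc_self)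
      have := left_nhdsWithin_Ioo_neBot hρ
      obtain ⟨z, hz, hz'⟩ := (h1.and self_mem_nhdsWithin).exists
      exact ⟨z, hz', hz⟩
    · have h1 := ((hc ρ ⟨hρ.le, le_rfl⟩).eventually (lt_mem_nhds h)).filter_mono
        (nhdsWithin_mono ρ Ioo_subset_Icc_self)
      have := right_nhdsWithin_Ioo_neBot hρ
      obtain ⟨z, hz, hz'⟩ := (h1.and self_mem_nhdsWithin).exists
      exact ⟨z, hz', hz⟩
  obtain ⟨δ, m, hδ, hm, hzδ, hlm⟩ : ∃ δ m : ℝ, 0 < δ ∧ 0 < m ∧ z₁ + δ < ρ ∧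
      ∀ τ ∈ Icc 0 δ, m ≤ l (0, z₁ + τ) := by
    have hc : ContinuousAt (fun z => l (0, z)) z₁ :=
      (continuousOn_slice_z (y := 0) hl2.continuousOn (by simp)).continuousAt
        (Icc_mem_nhds hz₁.1 hz₁.2)
    obtain ⟨e, he, h⟩ := Metric.eventually_nhds_iff.1
      (hc.eventually (lt_mem_nhds (half_lt_self hlz₁)))
    have hz2 := hz₁.2
    refine ⟨min (e / 2) ((ρ - z₁) / 2), l (0, z₁) / 2, lt_min (by linarith) (by linarith),
      by linarith, ?_, fun τ hτ => (h ?_).le⟩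
    · linarith [min_le_right (e / 2) ((ρ - z₁) / 2)]
    · rw [Real.dist_eq, add_sub_cancel_left, abs_of_nonneg hτ.1]
      linarith [hτ.2, min_le_left (e / 2) ((ρ - z₁) / 2)]
  obtain ⟨hz10, hz1ρ⟩ := hz₁
  obtain ⟨hs0, hsρ⟩ := hs
  -- A cutoff that vanishes on the wire edges only, hence at least η₀ > 0 on the cone.
  set η : ℝ × ℝ → ℝ := fun q => q.2 * (ρ - q.2) with hη
  have hη2 : C2 ρ η := ContDiff.contDiffOn (by fun_prop)
  have hη0 : ∀ q ∈ wireEdges ρ, η q = 0 := by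
    rintro ⟨y, z⟩ ⟨-, hz | hz⟩ <;> simp only at hz <;> simp [hη, hz]
  set R : ℝ := ∫ q in rect ρ, 4 * areaElement ρ f q * ‖gradVec ρ f η q‖ ^ 2 with hR
  obtain ⟨q₁, hq₁, hJmin⟩ := (isCompact_rect ρ).exists_isMinOn ⟨_, hqr⟩
    hr.c1_areaElement.continuousOn
  set J₀ := areaElement ρ f q₁ with hJ₀
  have hJ₀p : 0 < J₀ := hr.areaElement_pos hq₁
  obtain ⟨Ba, hBa⟩ := (isCompact_rect ρ).exists_bound_of_continuousOn hr.c1_dy.continuousOn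
  obtain ⟨Bb, hBb⟩ := (isCompact_rect ρ).exists_bound_of_continuousOn hr.c1_dz.continuousOn
  set zl := min s₀ z₁ with hzl
  set zu := max s₀ (z₁ + δ) with hzu
  have hzlp : 0 < zl := lt_min hs0 hz10
  have hzup : 0 < ρ - zu := sub_pos.2 (max_lt hsρ hzδ)
  set η₀ := zl * (ρ - zu) with hη₀
  have hη₀p : 0 < η₀ := mul_pos hzlp hzup
  set B := Ba + ρ * Bb with hB
  -- Chosen so that B X ≤ A s J₀ η₀² X² + 1/s, by the arithmetic-geometric mean inequality. The
  -- first term is A times the weighted energy density; the second integrates to -log r.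
  set A := B ^ 2 / (4 * (J₀ * η₀ ^ 2)) with hA
  have hA0 : 0 ≤ A := by positivity
  have hAB : 4 * A * (J₀ * η₀ ^ 2) = B ^ 2 := by rw [hA]; field_simp
  set C₂ := C * (1 + ρ) ^ 2 + 1 with hC₂
  have hC₂p : 0 < C₂ := by positivity
  -- the inequality for a cone truncated at distance `r` from its vertex
  have key : ∀ r ∈ Ioo (0 : ℝ) 1, δ * (Real.log m - Real.log C₂ - Real.log r) ≤ A * R := by
    rintro r ⟨hr0, hr1⟩
    -- The regularization ε = r² matches the quadratic bound on l, so that l + ε ≤ C₂ r² at the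
    -- truncated end of each segment.
    have hε : 0 < r ^ 2 := by positivity
    set D : ℝ × ℝ → ℝ := fun q => areaElement ρ f q * η q ^ 2 *
      (‖gradVec ρ f l q‖ / (l q + r ^ 2)) ^ 2 with hD
    have hlε : ∀ q ∈ rect ρ, 0 < l q + r ^ 2 := fun q hq => by have := hnn q hq; linarith
    have hDc : ContinuousOn D (rect ρ) := (hr.c1_areaElement.continuousOn.mul
      (hη2.continuousOn.pow 2)).mul (((hr.continuousOn_gradVec hl2.c1).norm.div
        (hl2.continuousOn.add continuousOn_const) fun q hq => (hlε q hq).ne').pow 2)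
    -- Clamping to the rectangle extends the density continuously to the plane, as the cone integral
    -- requires.
    set pr : ℝ × ℝ → ℝ × ℝ := fun q => (max (-1) (min 1 q.1), max 0 (min ρ q.2)) with hpr
    have hprm (q) : pr q ∈ rect ρ := ⟨⟨le_max_left _ _, max_le (by norm_num) (min_le_left _ _)⟩,
      le_max_left _ _, max_le hρ.le (min_le_left _ _)⟩
    have hprid (q) (hq : q ∈ rect ρ) : pr q = q := by
      obtain ⟨⟨a1, a2⟩, a3, a4⟩ := hq
      simp only [hpr]
      rw [min_eq_right a2, max_eq_right a1, min_eq_right a4, max_eq_right a3]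
    have hDp : Continuous (fun q => D (pr q)) :=
      hDc.comp_continuous (by simp only [hpr]; fun_prop) hprm
    have hD0 (q) : 0 ≤ D (pr q) := by
      have := (hr.areaElement_pos (hprm q)).le
      simp only [hD]; positivity
    have hcone := integral_cone_le hρ hDp hD0 hy ⟨hs0.le, hsρ.le⟩ hz10.le hδ.le hzδ.le hr0.le hr1.le
    have hDR : ∫ q in rect ρ, D (pr q) ≤ R := by
      rw [setIntegral_congr_fun (measurableSet_rect ρ) (g := D) fun q hq => by simp only [hprid q hq]]
      exact integral_log_height_le hρ hf hcrit hnn hη2 hη0 hε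
    -- Along one segment log (l + r²) rises from at most log C₂ + 2 log r to at least log m. The
    -- term 1/s of the derivative estimate pays for only one log r, so the energy must pay for the
    -- other.
    have hline (τ) (hτ : τ ∈ Icc 0 δ) : Real.log m - Real.log C₂ - Real.log r ≤
        A * ∫ s in r..1, s * D (pr (y₀ * (1 - s), s₀ + s * (z₁ + τ - s₀))) := by
      obtain ⟨hτ0, hτδ⟩ := hτ
      set γ : ℝ → ℝ × ℝ := fun s => (y₀ * (1 - s), s₀ + s * (z₁ + τ - s₀)) with hγ
      have hγz {s : ℝ} (h0 : 0 ≤ s) (h1 : s ≤ 1) : zl ≤ (γ s).2 ∧ (γ s).2 ≤ zu := by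
        have a1 : zl ≤ s₀ := min_le_left _ _
        have a2 : zl ≤ z₁ := min_le_right _ _
        have a3 : s₀ ≤ zu := le_max_left _ _
        have a4 : z₁ + δ ≤ zu := le_max_right _ _
        simp only [hγ]
        constructor <;> nlinarith
      have hγm {s : ℝ} (h0 : 0 ≤ s) (h1 : s ≤ 1) : γ s ∈ rect ρ := by
        refine ⟨?_, hzlp.le.trans (hγz h0 h1).1, by linarith [(hγz h0 h1).2]⟩
        rcases hy with rfl | rfl <;> constructor <;> simp only [hγ] <;> linarith
      have hγi {s : ℝ} (h0 : 0 < s) (h1 : s ≤ 1) : γ s ∈ interior (rect ρ) := by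
        rw [interior_rect]
        refine ⟨?_, hzlp.trans_le (hγz h0.le h1).1, by linarith [(hγz h0.le h1).2]⟩
        rcases hy with rfl | rfl <;> constructor <;> simp only [hγ] <;> linarith
      have hγc : Continuous γ := by simp only [hγ]; fun_prop
      set v : ℝ × ℝ := (-y₀, z₁ + τ - s₀) with hv
      have hγd (s : ℝ) : HasDerivAt γ v s := by
        have h1 : HasDerivAt (fun s : ℝ => y₀ * (1 - s)) (-y₀) s := by
          simpa using ((hasDerivAt_id s).const_sub 1).const_mul y₀
        have h2 : HasDerivAt (fun s : ℝ => s₀ + s * (z₁ + τ - s₀)) (z₁ + τ - s₀) s := by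
          simpa using ((hasDerivAt_id s).mul_const (z₁ + τ - s₀)).const_add s₀
        exact h1.prodMk h2
      have hWc : ContinuousOn (fun s => Real.log (l (γ s) + r ^ 2)) (Icc r 1) := by
        refine ContinuousOn.log ?_ fun s hs => (hlε _ (hγm (hr0.le.trans hs.1) hs.2)).ne'
        exact (hl2.continuousOn.comp hγc.continuousOn
          fun s hs => hγm (hr0.le.trans hs.1) hs.2).add continuousOn_const
      have hWd : ∀ s ∈ Ioo r 1, HasDerivWithinAt (fun s => Real.log (l (γ s) + r ^ 2))
          (fderivWithin ℝ l (rect ρ) (γ s) v / (l (γ s) + r ^ 2)) (Ioi s) s := fun s hs => by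
        have hs0 := hr0.trans hs.1
        have h1 : HasFDerivAt l (fderivWithin ℝ l (rect ρ) (γ s)) (γ s) :=
          (hl2.c1.diff (hγm hs0.le hs.2.le)).hasFDerivWithinAt.hasFDerivAt
            (mem_interior_iff_mem_nhds.1 (hγi hs0 hs.2.le))
        exact (((h1.comp_hasDerivAt s (hγd s)).add_const (r ^ 2)).log
          (hlε _ (hγm hs0.le hs.2.le)).ne').hasDerivWithinAt
      have hci : ContinuousOn (fun s : ℝ => s⁻¹) (Icc r 1) :=
        continuousOn_id.inv₀ fun s hs => (hr0.trans_le hs.1).ne'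
      have hcD : Continuous (fun s => s * D (pr (γ s))) := continuous_id.mul (hDp.comp hγc)
      have hφ : ContinuousOn (fun s => A * (s * D (pr (γ s))) + s⁻¹) (Icc r 1) :=
        (continuous_const.mul hcD).continuousOn.add hci
      have h1 := intervalIntegral.sub_le_integral_of_hasDeriv_right_of_le hr1.le hWc hWd
        (hφ.integrableOn_Icc) fun s hs => by
          have hs0 := hr0.trans hs.1
          have hm := hγm hs0.le hs.2.le
          rw [hprid _ hm]
          set X := ‖gradVec ρ f l (γ s)‖ / (l (γ s) + r ^ 2) with hX
          have hX0 : 0 ≤ X := div_nonneg (norm_nonneg _) (hlε _ hm).le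
          have hη1 : η₀ ≤ η (γ s) := mul_le_mul (hγz hs0.le hs.2.le).1
            (sub_le_sub_left (hγz hs0.le hs.2.le).2 ρ) hzup.le
            (hzlp.le.trans (hγz hs0.le hs.2.le).1)
          have hD1 : J₀ * η₀ ^ 2 * X ^ 2 ≤ D (γ s) := by
            have hJ1 : J₀ ≤ areaElement ρ f (γ s) := hJmin hm
            have hJ2 := hJ₀p.le.trans hJ1
            simp only [hD]
            gcongr
          have hdl : fderivWithin ℝ l (rect ρ) (γ s) v ≤ ‖gradVec ρ f l (γ s)‖ * B := by
            rw [fderivWithin_eq_dy_dz, smul_eq_mul, smul_eq_mul, ← hr.inner_gradVec hm]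
            refine (real_inner_le_norm _ _).trans (mul_le_mul_of_nonneg_left ?_ (norm_nonneg _))
            refine (norm_add_le _ _).trans (add_le_add ?_ ?_)
            · rw [norm_smul]
              have : ‖v.1‖ = 1 := by rcases hy with rfl | rfl <;> simp [hv]
              rw [this, one_mul]; exact hBa _ hm
            · rw [norm_smul]
              have : ‖v.2‖ ≤ ρ := by
                rw [Real.norm_eq_abs, abs_le]; simp only [hv]; constructor <;> linarith
              exact mul_le_mul this (hBb _ hm) (norm_nonneg _) hρ.le
          calc _ ≤ ‖gradVec ρ f l (γ s)‖ * B / (l (γ s) + r ^ 2) :=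
                div_le_div_of_nonneg_right hdl (hlε _ hm).le
            _ = B * X := by rw [hX]; ring
            _ ≤ A * (s * (J₀ * η₀ ^ 2 * X ^ 2)) + s⁻¹ := by
                have h2 : 0 ≤ s⁻¹ * (B * s * X / 2 - 1) ^ 2 := by positivity
                have h3 : s⁻¹ * (B * s * X / 2 - 1) ^ 2 =
                    B ^ 2 / 4 * s * X ^ 2 - B * X + s⁻¹ := by field_simp; ring
                rw [h3, ← hAB] at h2
                linarith
            _ ≤ _ := by gcongr
      have hi1 : IntervalIntegrable (fun s => A * (s * D (pr (γ s)))) volume r 1 :=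
        (continuous_const.mul hcD).intervalIntegrable _ _
      have hi2 : IntervalIntegrable (fun s : ℝ => s⁻¹) volume r 1 :=
        ContinuousOn.intervalIntegrable (by rwa [uIcc_of_le hr1.le])
      rw [intervalIntegral.integral_add hi1 hi2,
        intervalIntegral.integral_const_mul, integral_inv_of_pos hr0 one_pos, Real.log_div one_ne_zero
        hr0.ne', Real.log_one] at h1
      have h2 : Real.log m ≤ Real.log (l (γ 1) + r ^ 2) := by
        refine Real.log_le_log hm ?_
        have : γ 1 = (0, z₁ + τ) := by simp [hγ]
        rw [this]
        have := hlm τ ⟨hτ0, hτδ⟩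
        linarith
      have h3 : Real.log (l (γ r) + r ^ 2) ≤ Real.log C₂ + 2 * Real.log r := by
        rw [show 2 * Real.log r = Real.log (r ^ 2) by rw [Real.log_pow]; norm_num,
          ← Real.log_mul hC₂p.ne' hε.ne']
        refine Real.log_le_log (hlε _ (hγm hr0.le hr1.le)) ?_
        have h4 := hC _ (hγm hr0.le hr1.le)
        have h5 : ‖γ r - (y₀, s₀)‖ ≤ r * (1 + ρ) := by
          refine norm_prod_le_iff.2 ⟨?_, ?_⟩
          · simp only [hγ, Prod.fst_sub]
            rw [show y₀ * (1 - r) - y₀ = -(y₀ * r) by ring, norm_neg, norm_mul]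
            have : ‖y₀‖ = 1 := by rcases hy with rfl | rfl <;> simp
            rw [this, one_mul, Real.norm_of_nonneg hr0.le]
            nlinarith
          · simp only [hγ, Prod.snd_sub]
            rw [add_sub_cancel_left, norm_mul, Real.norm_of_nonneg hr0.le]
            refine mul_le_mul_of_nonneg_left ?_ hr0.le
            rw [Real.norm_eq_abs, abs_le]; constructor <;> linarith
        have h6 : C * ‖γ r - (y₀, s₀)‖ ^ 2 ≤ C * (r * (1 + ρ)) ^ 2 := by gcongr
        have h7 : C₂ * r ^ 2 = C * (r * (1 + ρ)) ^ 2 + r ^ 2 := by rw [hC₂]; ring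
        linarith
      linarith
    have hint := intervalIntegral.integral_mono_on (a := 0) (b := δ) hδ.le
      (intervalIntegrable_const (μ := volume) (c := Real.log m - Real.log C₂ - Real.log r)) ?_ hline
    · rw [intervalIntegral.integral_const, intervalIntegral.integral_const_mul, sub_zero,
        smul_eq_mul] at hint
      exact hint.trans (mul_le_mul_of_nonneg_left (hcone.trans hDR) hA0)
    · refine Continuous.intervalIntegrable (continuous_const.mul ?_) _ _
      refine intervalIntegral.continuous_parametric_intervalIntegral_of_continuous'
        (f := fun τ s => s * D (pr (y₀ * (1 - s), s₀ + s * (z₁ + τ - s₀)))) ?_ r 1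
      have : Continuous fun x : ℝ × ℝ => x.2 * D (pr (y₀ * (1 - x.2), s₀ + x.2 * (z₁ + x.1 - s₀))) :=
        continuous_snd.mul (hDp.comp (by fun_prop))
      exact this
  clear_value A R C₂
  -- With r = e^(-T), the left side of `key` is δ(log m - log C₂ + T), and T is large enough to
  -- exceed A R.
  set T := |Real.log m - Real.log C₂| + |A * R / δ| + 1 with hT
  have hTp : 0 < T := by
    have a1 := abs_nonneg (Real.log m - Real.log C₂)
    have a2 := abs_nonneg (A * R / δ)
    linarith
  have h1 := key (Real.exp (-T)) ⟨Real.exp_pos _, Real.exp_lt_one_iff.2 (by linarith)⟩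
  rw [Real.log_exp] at h1
  have h2 := neg_abs_le (Real.log m - Real.log C₂)
  have h3 := le_abs_self (A * R / δ)
  have h4 : δ * (A * R / δ) = A * R := by field_simp
  have h5 : δ * (A * R / δ) < δ * (Real.log m - Real.log C₂ - -T) :=
    mul_lt_mul_of_pos_left (by linarith) hδ
  linarith

/-- The side curves of a critical surface lie strictly between the rims of the tube. -/
lemma height_mem_Ioo_of_mem_sideEdges (hρ : 0 < ρ) (hf : IsAdmissible ρ θ₀ f)
    (hcrit : ∀ g, IsAdmissibleField ρ θ₀ f g → firstVar ρ f g = 0) {q : ℝ × ℝ}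
    (hq : q ∈ sideEdges ρ) : f q 2 ∈ Ioo 0 ρ := by
  have hh {h θ : ℝ} {p : E3} (hp : p ∈ wire h θ) : p 2 = h := by
    obtain ⟨s, hs, rfl⟩ := hp
    simp [wireDir, zAxis]
  have hw {q} (h : f q ∈ wires ρ θ₀) : f q 2 = 0 ∨ f q 2 = ρ := h.imp hh hh
  have h0 : (0 : ℝ) ∈ Icc (-1 : ℝ) 1 := by simp
  constructor
  · have := affineHeight_pos_of_mem_sideEdges (α := 0) (β := 1) hρ hf hcrit (fun q _ h => by
      rw [affineHeight, inner_zAxis]; rcases hw h with h | h <;> rw [h] <;> linarith) (by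
      simp only [affineHeight, inner_zAxis]
      rcases wireEdges_cases hρ hf with h | h
      · right; rw [hh (h 0 h0).2]; linarith
      · left; rw [hh (h 0 h0).1]; linarith) hq
    rw [affineHeight, inner_zAxis] at this
    linarith
  · have := affineHeight_pos_of_mem_sideEdges (α := ρ) (β := -1) hρ hf hcrit (fun q _ h => by
      rw [affineHeight, inner_zAxis]; rcases hw h with h | h <;> rw [h] <;> linarith) (by
      simp only [affineHeight, inner_zAxis]
      rcases wireEdges_cases hρ hf with h | h
      · left; rw [hh (h 0 h0).1]; linarith
      · right; rw [hh (h 0 h0).2]; linarith) hq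
    rw [affineHeight, inner_zAxis] at this
    linarith

end Height

/-! ### The second variation -/

section Pointwise
variable {a b n : E3} {J : ℝ}

/-- The second derivative of the norm of the normal `N` of a family with first and second
derivatives `N₁`, `N₂`. -/
lemma secondDeriv_norm_normal (h : IsFrame a b n J) (va vb wa wb : E3) :
    ((inner ℝ (cross a b) ((cross wa b + cross va vb) + (cross va vb + cross a wb)) +
        inner ℝ (cross va b + cross a vb) (cross va b + cross a vb)) * J -
      inner ℝ (cross a b) (cross va b + cross a vb) *
        (inner ℝ (cross a b) (cross va b + cross a vb) / J)) / J ^ 2 =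
      (2 * tri n va vb + J * ‖(inner ℝ n va : ℝ) • (J⁻¹ • cross b n) +
        (inner ℝ n vb : ℝ) • (J⁻¹ • cross n a)‖ ^ 2) + (tri n wa b + tri n a wb) := by
  have hJ := h.pos.ne'
  -- The part of N₁ orthogonal to n, whose square is what remains in the second derivative of |N|,
  -- has the length of n × N₁ = (n · vb) a - (n · va) b.
  have e1 : inner ℝ (cross va b + cross a vb) (cross va b + cross a vb) -
      inner ℝ n (cross va b + cross a vb) ^ 2 =
      inner ℝ n va ^ 2 * inner ℝ b b - 2 * inner ℝ n va * inner ℝ n vb * inner ℝ a b +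
        inner ℝ n vb ^ 2 * inner ℝ a a := by
    have f1 : cross n (cross va b + cross a vb) =
        (inner ℝ n vb : ℝ) • a - (inner ℝ n va : ℝ) • b := by
      have f2 : cross n (cross va b + cross a vb) = (inner ℝ n b : ℝ) • va -
          (inner ℝ n va : ℝ) • b + ((inner ℝ n vb : ℝ) • a - (inner ℝ n a : ℝ) • vb) := by
        apply ext_coord <;> simp only [cross_zero_coord, cross_one_coord, cross_two_coord,
          inner_coord, PiLp.add_apply, PiLp.sub_apply, PiLp.smul_apply, smul_eq_mul] <;> ring
      rw [f2, h.na, h.nb]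
      module
    have f3 (x : E3) : inner ℝ (cross n x) (cross n x) =
        inner ℝ n n * inner ℝ x x - inner ℝ n x ^ 2 := by
      simp only [inner_coord, cross_zero_coord, cross_one_coord, cross_two_coord]; ring
    have f4 := f3 (cross va b + cross a vb)
    rw [h.nn, one_mul, f1] at f4
    rw [← f4]
    simp only [inner_sub_left, inner_sub_right, real_inner_smul_left, real_inner_smul_right,
      real_inner_comm b a]
    ring
  rw [h.norm_sq_dual, h.cross_eq, real_inner_smul_left, real_inner_smul_left]
  have e2 : inner ℝ n ((cross wa b + cross va vb) + (cross va vb + cross a wb)) =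
      2 * tri n va vb + (tri n wa b + tri n a wb) := by
    simp only [tri, inner_add_right]; ring
  rw [e2]
  generalize inner ℝ n (cross va b + cross a vb) = X at *
  generalize inner ℝ (cross va b + cross a vb) (cross va b + cross a vb) = Y at *
  have e3 : Y = X ^ 2 + (inner ℝ n va ^ 2 * inner ℝ b b -
      2 * inner ℝ n va * inner ℝ n vb * inner ℝ a b + inner ℝ n vb ^ 2 * inner ℝ a a) := by
    linarith
  rw [e3]
  field_simp
  ring

/-- The boundary integrand of the second variation on a side edge. -/
lemma side_pointwise (h : IsFrame a b n J) {r g gz nz : E3} {y₀ c : ℝ} (hy : y₀ ^ 2 = 1)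
    (hrr : inner ℝ r r = (1 : ℝ)) (hnr : inner ℝ n r = (0 : ℝ)) (hrb : inner ℝ r b = (0 : ℝ))
    (hra : 0 < y₀ * inner ℝ r a) (hr2 : r 2 = 0) (hgr : inner ℝ g r = (0 : ℝ))
    (hgz : inner ℝ r gz = -(inner ℝ (radial b) g : ℝ))
    (hnz : inner ℝ r nz = -(inner ℝ (radial b) n : ℝ)) (hc : c = inner ℝ g n) :
    inner ℝ (cross n g) gz + inner ℝ (c • cross n g) nz -
        inner ℝ ((inner ℝ (radial g) (radial g) : ℝ) • cross n r) b =
      -(y₀ * (inner ℝ (‖b‖⁻¹ • b) zAxis ^ 2 * c ^ 2 * ‖b‖)) := by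
  have hb0 : 0 < ‖b‖ := by
    rw [norm_pos_iff]
    rintro rfl
    have h1 : cross a 0 = 0 := (crossL a).map_zero
    have h2 := h.cross_eq
    rw [h1] at h2
    have h3 := congrArg (fun x => inner ℝ n x) h2
    simp only [inner_zero_right, real_inner_smul_right, h.nn, mul_one] at h3
    exact h.pos.ne h3
  have hra0 : inner ℝ r a ≠ (0 : ℝ) := fun h0 => by rw [h0, mul_zero] at hra; exact hra.false
  have hbb : inner ℝ b b = ‖b‖ ^ 2 := real_inner_self_eq_norm_sq b
  -- vectors orthogonal to `r` are combinations of `b` and `n`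
  have hdec (x : E3) (hx : inner ℝ x r = (0 : ℝ)) :
      ∃ β : ℝ, x = β • b + (inner ℝ n x : ℝ) • n := by
    obtain ⟨α, β, e⟩ := h.decomp x
    have e1 := congrArg (fun y => inner ℝ r y) e
    simp only [inner_add_right, real_inner_smul_right, hrb, real_inner_comm n r, hnr,
      real_inner_comm x r, hx] at e1
    have e2 : α * inner ℝ r a = 0 := by linarith
    have hα : α = 0 := (mul_eq_zero.1 e2).resolve_right hra0
    rw [hα, zero_smul, zero_add] at e
    exact ⟨β, e⟩
  -- The conormal b × n is parallel to r because r is tangent to the surface and orthogonal to b.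
  -- The sign is the one of y₀ since the surface points outward at the side; here its position
  -- inside the tube enters.
  have hbn : cross b n = (y₀ * ‖b‖) • r := by
    have e1 : cross b n = (inner ℝ (cross b n) r : ℝ) • r := by
      have : (inner ℝ r r : ℝ) • cross b n - (inner ℝ (cross b n) r : ℝ) • r =
          (inner ℝ r b : ℝ) • cross r n - (inner ℝ n r : ℝ) • cross r b := by
        apply ext_coord <;> simp only [cross_zero_coord, cross_one_coord, cross_two_coord,
          inner_coord, PiLp.sub_apply, PiLp.smul_apply, smul_eq_mul] <;> ring
      rw [hrr, hrb, hnr, one_smul, zero_smul, zero_smul, sub_zero] at this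
      exact sub_eq_zero.1 this
    have e2 : (inner ℝ (cross b n) r : ℝ) ^ 2 = ‖b‖ ^ 2 := by
      have e3 : inner ℝ (cross b n) (cross b n) =
          inner ℝ b b * inner ℝ n n - inner ℝ n b ^ 2 := by
        simp only [inner_coord, cross_zero_coord, cross_one_coord, cross_two_coord]; ring
      rw [h.nn, h.nb, hbb, e1, real_inner_smul_left, real_inner_smul_right, hrr] at e3
      nlinarith
    have e4 : (inner ℝ (cross b n) r : ℝ) * inner ℝ r a = J := by
      rw [← real_inner_smul_left, ← e1, ← h.tri_eq]
      simp only [inner_coord, cross_zero_coord, cross_one_coord, cross_two_coord, tri_coord]; ring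
    have hJ := h.pos
    rw [e1]
    congr 1
    generalize (inner ℝ (cross b n) r : ℝ) = κ at *
    have e5 : (κ - y₀ * ‖b‖) * (κ + y₀ * ‖b‖) = 0 := by
      linear_combination e2 - ‖b‖ ^ 2 * hy
    rcases mul_eq_zero.1 e5 with h1 | h1
    · linarith
    · have : κ = -(y₀ * ‖b‖) := by linarith
      rw [this] at e4
      have : 0 < ‖b‖ * (y₀ * inner ℝ r a) := mul_pos hb0 hra
      linarith
  obtain ⟨τ, eg⟩ := hdec g hgr
  rw [real_inner_comm, ← hc] at eg
  obtain ⟨ζ, ez⟩ := hdec zAxis (by rw [inner_zAxis, hr2])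
  have hzz : inner ℝ zAxis zAxis = (1 : ℝ) := by
    simp only [inner_coord, zAxis_zero_coord, zAxis_one_coord, zAxis_two_coord]
    norm_num
  -- The vertical vector is orthogonal to r, hence a combination of b and n, and so (t · z)² = 1 -
  -- (n · z)². All terms containing the tangential coefficient τ of g will cancel.
  have hnz2 : (1 - n 2 ^ 2) * ‖b‖ ^ 2 = b 2 ^ 2 := by
    have h1 := congrArg (fun x => inner ℝ zAxis x) ez
    have h2 := congrArg (fun x => inner ℝ b x) ez
    simp only [inner_add_right, real_inner_smul_right, hzz, inner_zAxis, real_inner_comm n b, h.nb,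
      real_inner_comm zAxis b, hbb, real_inner_comm zAxis n] at h1 h2
    linear_combination ‖b‖ ^ 2 * h1 - b 2 * h2
  have hng : cross n g = (-(τ * (y₀ * ‖b‖))) • r := by
    have : cross n g = (-τ) • cross b n := by
      rw [eg]
      apply ext_coord <;> simp only [cross_zero_coord, cross_one_coord, cross_two_coord,
          PiLp.add_apply, PiLp.smul_apply, smul_eq_mul] <;> ring
    rw [this, hbn, smul_smul]
    congr 1; ring
  have hnrb : inner ℝ (cross n r) b = y₀ * ‖b‖ := by
    have : inner ℝ (cross n r) b = inner ℝ (cross b n) r := by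
      simp only [inner_coord, cross_zero_coord, cross_one_coord, cross_two_coord]; ring
    rw [this, hbn, real_inner_smul_left, hrr, mul_one]
  have hrad (x y : E3) : inner ℝ (radial x) y = inner ℝ x y - x 2 * y 2 := by
    simp only [inner_coord, radial_zero_coord, radial_one_coord, radial_two_coord]; ring
  rw [inner_radial_radial]
  simp only [hng, real_inner_smul_left, hnrb, hgz, hnz, hrad]
  have i1 : inner ℝ b g = τ * ‖b‖ ^ 2 := by
    rw [eg]; simp only [inner_add_right, real_inner_smul_right, hbb, real_inner_comm n b, h.nb]; ring
  have i2 : inner ℝ g g = τ ^ 2 * ‖b‖ ^ 2 + c ^ 2 := by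
    conv_lhs => rw [eg]
    simp only [inner_add_left, inner_add_right, real_inner_smul_left, real_inner_smul_right, hbb,
      real_inner_comm n b, h.nb, h.nn]
    ring
  have i3 : g 2 = τ * b 2 + c * n 2 := by
    rw [eg]; simp
  rw [i1, i2, i3, real_inner_comm n b, h.nb, real_inner_comm, inner_zAxis]
  field_simp
  linear_combination (-c ^ 2 * y₀) * hnz2
end Pointwise

/-- The quadratic form of the second variation, in terms of the normal component of the velocity. -/
def stabilityForm (ρ : ℝ) (f : ℝ × ℝ → E3) (c : ℝ × ℝ → ℝ) : ℝ :=
  (∫ q in rect ρ, (areaElement ρ f q * ‖gradVec ρ f c q‖ ^ 2 +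
    2 * tri (unitNormal ρ f q) (dy ρ (unitNormal ρ f) q) (dz ρ (unitNormal ρ f) q) * c q ^ 2)) -
  sideIntegral ρ f fun q => inner ℝ (sideTangent ρ f q) zAxis ^ 2 * c q ^ 2

/-- The second variation without the contribution of the acceleration. -/
def secondVar (ρ : ℝ) (f g : ℝ × ℝ → E3) : ℝ :=
  ∫ q in rect ρ, (2 * tri (unitNormal ρ f q) (dy ρ g q) (dz ρ g q) +
    areaElement ρ f q * ‖(inner ℝ (unitNormal ρ f q) (dy ρ g q) : ℝ) • dualY ρ f q +
      (inner ℝ (unitNormal ρ f q) (dz ρ g q) : ℝ) • dualZ ρ f q‖ ^ 2)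

/-! ### Velocity and acceleration of admissible families. -/

section Family
variable {ρ θ₀ σ a b : ℝ} {f : ℝ × ℝ → E3} {G : ℕ → ℝ → ℝ × ℝ → E3}

lemma IsRegular.continuousOn_firstVar (hf : IsRegular ρ f) {g : ℝ × ℝ → E3} (hg : C1 ρ g) :
    ContinuousOn (fun q => tri (unitNormal ρ f q) (dy ρ g q) (dz ρ f q) +
      tri (unitNormal ρ f q) (dy ρ f q) (dz ρ g q)) (rect ρ) :=
  (continuousOn_tri hf.c1_unitNormal.continuousOn (hg.continuousOn_dy hf.rho_pos)
    hf.c1_dz.continuousOn).add (continuousOn_tri hf.c1_unitNormal.continuousOn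
      hf.c1_dy.continuousOn (hg.continuousOn_dz hf.rho_pos))

lemma IsRegular.continuousOn_secondVar (hf : IsRegular ρ f) {g : ℝ × ℝ → E3} (hg : C1 ρ g) :
    ContinuousOn (fun q => 2 * tri (unitNormal ρ f q) (dy ρ g q) (dz ρ g q) +
      areaElement ρ f q * ‖(inner ℝ (unitNormal ρ f q) (dy ρ g q) : ℝ) • dualY ρ f q +
        (inner ℝ (unitNormal ρ f q) (dz ρ g q) : ℝ) • dualZ ρ f q‖ ^ 2) (rect ρ) := by
  have hρ := hf.rho_pos
  have hn := hf.c1_unitNormal.continuousOn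
  have hy := hg.continuousOn_dy hρ
  have hz := hg.continuousOn_dz hρ
  exact (continuousOn_const.mul (continuousOn_tri hn hy hz)).add
    (hf.c1_areaElement.continuousOn.mul ((((hn.inner (𝕜 := ℝ) hy).smul
      hf.c1_dualY.continuousOn).add ((hn.inner (𝕜 := ℝ) hz).smul
        hf.c1_dualZ.continuousOn)).norm.pow 2))

/-- The second parameter derivative of the normal is linear in the acceleration and quadratic in the
velocity, so the second derivative of the energy splits into a first variation and `secondVar`. -/
lemma C2Jet.deriv_deriv_energy_zero (hf : IsRegular ρ f) (ha : a < 0) (hb : 0 < b)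
    (hG : C2Jet ρ a b G) (h0 : ∀ t ∈ Ioo a b, ∀ q ∈ rect ρ, normalJet ρ G 0 t q ≠ 0)
    (hGf : EqOn (G 0 0) f (rect ρ)) {g : ℝ × ℝ → E3} (hGg : EqOn (G 1 0) g (rect ρ)) :
    deriv (deriv fun s => energy ρ σ (G 0 s)) 0 = σ * (secondVar ρ f g + firstVar ρ f (G 2 0)) := by
  have ht : (0 : ℝ) ∈ Ioo a b := ⟨ha, hb⟩
  have hg : C1 ρ g := ((hG.c2 1 (by norm_num) 0 ht).c1).congr hGg.symm
  rw [hG.deriv_deriv_energy hf.rho_pos h0 ht, integral_const_mul, secondVar, firstVar,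
    ← integral_add (integrableOn_rect (hf.continuousOn_secondVar hg))
      (integrableOn_rect (hf.continuousOn_firstVar (hG.c2 2 le_rfl 0 ht).c1))]
  congr 1
  refine setIntegral_congr_fun (measurableSet_rect ρ) fun q hq => ?_
  simp only [normalJet]
  rw [dy_congr hGf hq, dz_congr hGf hq, dy_congr hGg hq, dz_congr hGg hq]
  exact secondDeriv_norm_normal (hf.isFrame hq) _ _ _ _

/-- The component orthogonal to a wire. -/
def wireL (θ : ℝ) : E3 →L[ℝ] E3 :=
  ContinuousLinearMap.id ℝ E3 - (innerSL ℝ (wireDir θ)).smulRight (wireDir θ)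

lemma wireL_apply (θ : ℝ) (x : E3) : wireL θ x = x - (inner ℝ x (wireDir θ) : ℝ) • wireDir θ := by
  simp [wireL, real_inner_comm]

lemma wireL_eq_zero_iff {θ : ℝ} {x : E3} :
    wireL θ x = 0 ↔ x = (inner ℝ x (wireDir θ) : ℝ) • wireDir θ := by
  rw [wireL_apply, sub_eq_zero]

lemma inner_wireDir_self (θ : ℝ) : inner ℝ (wireDir θ) (wireDir θ) = (1 : ℝ) := by
  simp only [inner_coord, wireDir_zero_coord, wireDir_one_coord, wireDir_two_coord]
  linear_combination Real.sin_sq_add_cos_sq θ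

lemma wireL_smul_wireDir (θ s : ℝ) : wireL θ (s • wireDir θ) = 0 := by
  rw [wireL_eq_zero_iff, real_inner_smul_left, inner_wireDir_self, mul_one]

lemma wireL_of_mem_wire {h θ : ℝ} {p : E3} (hp : p ∈ wire h θ) : wireL θ p = h • zAxis := by
  obtain ⟨s, hs, rfl⟩ := hp
  have : inner ℝ zAxis (wireDir θ) = (0 : ℝ) := by rw [inner_zAxis, wireDir_two_coord]
  rw [map_add, wireL_smul_wireDir, wireL_apply, real_inner_smul_left, this]
  simp

lemma wireL_radial {h θ : ℝ} {p : E3} (hp : p ∈ wire h θ) : wireL θ (radial p) = 0 := by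
  obtain ⟨s, hs, rfl⟩ := hp
  have : radial (s • wireDir θ + h • zAxis) = s • wireDir θ := by
    apply ext_coord <;> simp [wireDir_two_coord]
  rw [this, wireL_smul_wireDir]

lemma height_of_mem_wire {h θ : ℝ} {p : E3} (hp : p ∈ wire h θ) : p 2 = h := by
  obtain ⟨s, hs, rfl⟩ := hp
  simp [wireDir_two_coord]

lemma isAdmissibleField_iff {g : ℝ × ℝ → E3} : IsAdmissibleField ρ θ₀ f g ↔ C2 ρ g ∧
    (∀ q ∈ rect ρ, f q ∈ wire 0 0 → wireL 0 (g q) = 0) ∧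
    (∀ q ∈ rect ρ, f q ∈ wire ρ θ₀ → wireL θ₀ (g q) = 0) ∧
    ∀ q ∈ sideEdges ρ, inner ℝ (g q) (radial (f q)) = 0 := by
  constructor
  · rintro ⟨h1, h2, h3, h4⟩
    exact ⟨h1, fun q hq h => wireL_eq_zero_iff.2 (h2 q hq h),
      fun q hq h => wireL_eq_zero_iff.2 (h3 q hq h), h4⟩
  · rintro ⟨h1, h2, h3, h4⟩
    exact ⟨h1, fun q hq h => wireL_eq_zero_iff.1 (h2 q hq h),
      fun q hq h => wireL_eq_zero_iff.1 (h3 q hq h), h4⟩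

/-- A family of admissible surfaces keeps each wire edge on its wire. -/
lemma mem_wire_of_family (hρ : 0 < ρ) (hG : C2Jet ρ a b G)
    (hadm : ∀ t ∈ Ioo a b, IsAdmissible ρ θ₀ (G 0 t)) {q : ℝ × ℝ} (hq : q ∈ wireEdges ρ)
    {s t : ℝ} (hs : s ∈ Ioo a b) (ht : t ∈ Ioo a b) :
    (G 0 s q ∈ wire 0 0 → G 0 t q ∈ wire 0 0) ∧ (G 0 s q ∈ wire ρ θ₀ → G 0 t q ∈ wire ρ θ₀) := by
  have hmem (t) (ht : t ∈ Ioo a b) : G 0 t q ∈ wires ρ θ₀ := (hadm t ht).image_wireEdges ▸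
    mem_image_of_mem (G 0 t) hq
  have hval (t) (ht : t ∈ Ioo a b) : G 0 t q 2 ∈ ({0, ρ} : Set ℝ) :=
    (hmem t ht).imp height_of_mem_wire height_of_mem_wire
  have hcont : ContinuousOn (fun t => G 0 t q 2) (Ioo a b) :=
    (EuclideanSpace.proj (𝕜 := ℝ) (2 : Fin 3)).continuous.comp_continuousOn
      (continuousOn_param_left (hG.continuousOn (by norm_num)) (wireEdges_subset hρ hq))
  have hc : G 0 s q 2 = G 0 t q 2 := isPreconnected_Ioo.constant_of_mapsTo (T := {0, ρ})
    (Set.toFinite _).isDiscrete hcont hval hs ht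
  constructor <;> intro h <;> have h1 := height_of_mem_wire h <;> rw [hc] at h1
  · exact (hmem t ht).resolve_right fun h2 => hρ.ne (h1.symm.trans (height_of_mem_wire h2))
  · exact (hmem t ht).resolve_left fun h2 => hρ.ne' (h1.symm.trans (height_of_mem_wire h2))

/-- The acceleration of a family of admissible surfaces is admissible up to the centripetal
acceleration on the cylinder. -/
lemma C2Jet.isAdmissibleField_acceleration (hρ : 0 < ρ) (ha : a < 0) (hb : 0 < b)
    (hf : IsAdmissible ρ θ₀ f) (hG : C2Jet ρ a b G)
    (hadm : ∀ t ∈ Ioo a b, IsAdmissible ρ θ₀ (G 0 t)) (hGf : EqOn (G 0 0) f (rect ρ)) :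
    IsAdmissibleField ρ θ₀ f (fun q => G 2 0 q +
      (inner ℝ (radial (G 1 0 q)) (radial (G 1 0 q)) : ℝ) • radial (f q)) := by
  have h0 : (0 : ℝ) ∈ Ioo a b := ⟨ha, hb⟩
  have hr1 : C2 ρ (fun q => radial (G 1 0 q)) := contDiffOn_radial (hG.c2 1 (by norm_num) 0 h0)
  have hnb : ∀ t ∈ Ioo a b, Ioo a b ∈ nhds t := fun t ht => Ioo_mem_nhds ht.1 ht.2
  -- The point stays on one wire for all times, so its component off the wire direction is constant
  -- and both time derivatives are parallel to the wire; the centripetal correction is too.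
  have hwire {h θ : ℝ} {q : ℝ × ℝ} (hq : q ∈ rect ρ) (hw : ∀ t ∈ Ioo a b, G 0 t q ∈ wire h θ) :
      wireL θ (G 2 0 q + (inner ℝ (radial (G 1 0 q)) (radial (G 1 0 q)) : ℝ) • radial (f q)) = 0 := by
    have h1 : ∀ t ∈ Ioo a b, wireL θ (G 1 t q) = 0 := fun t ht => by
      have d1 := (wireL θ).hasFDerivAt.comp_hasDerivAt t (hG.hasDerivAt 0 (by norm_num) t ht q hq)
      refine d1.unique ((hasDerivAt_const t (h • zAxis)).congr_of_eventuallyEq ?_)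
      filter_upwards [hnb t ht] with s hs using wireL_of_mem_wire (hw s hs)
    have h2 : wireL θ (G 2 0 q) = 0 := by
      have d1 := (wireL θ).hasFDerivAt.comp_hasDerivAt 0 (hG.hasDerivAt 1 (by norm_num) 0 h0 q hq)
      refine d1.unique ((hasDerivAt_const 0 0).congr_of_eventuallyEq ?_)
      filter_upwards [hnb 0 h0] with s hs using h1 s hs
    have h3 := wireL_radial (hw 0 h0)
    rw [hGf hq] at h3
    rw [map_add, map_smul, h2, h3, smul_zero, add_zero]
  refine isAdmissibleField_iff.2 ⟨?_, fun q hq h => hwire (h := 0) hq fun t ht => ?_,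
    fun q hq h => hwire (h := ρ) hq fun t ht => ?_, fun q hq => ?_⟩
  · exact (hG.c2 2 le_rfl 0 h0).add ((hr1.inner ℝ hr1).smul (contDiffOn_radial hf.contDiffOn))
  · refine (mem_wire_of_family hρ hG hadm (hf.mem_wireEdges hρ hq (Or.inl h)) h0 ht).1 ?_
    rwa [hGf hq]
  · refine (mem_wire_of_family hρ hG hadm (hf.mem_wireEdges hρ hq (Or.inr h)) h0 ht).2 ?_
    rwa [hGf hq]
  -- Differentiating |radial F|² = 1 twice gives r · F'' = -|radial F'|².
  · have hqr := sideEdges_subset hq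
    have d0 (t) (ht : t ∈ Ioo a b) := radialL.hasFDerivAt.comp_hasDerivAt t
      (hG.hasDerivAt 0 (by norm_num) t ht q hqr)
    have d1 := radialL.hasFDerivAt.comp_hasDerivAt 0 (hG.hasDerivAt 1 (by norm_num) 0 h0 q hqr)
    have h1 : ∀ t ∈ Ioo a b, (inner ℝ (radial (G 0 t q)) (radial (G 1 t q)) : ℝ) = 0 := fun t ht => by
      have e := ((d0 t ht).inner ℝ (d0 t ht)).unique
        ((hasDerivAt_const t (1 : ℝ)).congr_of_eventuallyEq (by
          filter_upwards [hnb t ht] with s hs using inner_radial_self_side (hadm s hs) hq))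
      have e2 : (inner ℝ (radial (G 0 t q)) (radial (G 1 t q)) : ℝ) +
        inner ℝ (radial (G 1 t q)) (radial (G 0 t q)) = 0 := e
      rw [real_inner_comm (radial (G 0 t q))] at e2
      linarith
    have h2 : (inner ℝ (radial (G 0 0 q)) (radial (G 2 0 q)) : ℝ) +
        inner ℝ (radial (G 1 0 q)) (radial (G 1 0 q)) = 0 :=
      ((d0 0 h0).inner ℝ d1).unique ((hasDerivAt_const 0 (0 : ℝ)).congr_of_eventuallyEq (by
        filter_upwards [hnb 0 h0] with s hs using h1 s hs))
    rw [hGf hqr, inner_radial_radial, real_inner_comm] at h2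
    rw [inner_add_left, real_inner_smul_left, inner_radial_self_side hf hq, mul_one, h2]

end Family

/-! ### The second variation in terms of the normal component. -/

section Form
variable {ρ θ₀ σ a b : ℝ} {f g : ℝ × ℝ → E3}

lemma map_dy_edge {F : Type*} [NormedAddCommGroup F] [NormedSpace ℝ F] {u : ℝ × ℝ → E3}
    (hu : C1 ρ u) (T : E3 →L[ℝ] F) {k : F} {z : ℝ} (hz : z ∈ Icc 0 ρ)
    (h : ∀ y ∈ Icc (-1 : ℝ) 1, T (u (y, z)) = k) {y : ℝ} (hy : y ∈ Icc (-1 : ℝ) 1) :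
    T (dy ρ u (y, z)) = 0 := by
  have h1 := T.hasFDerivAt.comp_hasDerivWithinAt y (hasDerivWithinAt_slice_y hu hy hz)
  have h2 : HasDerivWithinAt (T ∘ fun s => u (s, z)) 0 (Icc (-1) 1) y :=
    (hasDerivWithinAt_const y _ k).congr (fun s hs => h s hs) (h y hy)
  exact (uniqueDiffOn_Icc (by norm_num) y hy).eq_deriv _ h1 h2

lemma dz_side_eq_zero {u : ℝ × ℝ → ℝ} (hu : C1 ρ u) (h : ∀ q ∈ sideEdges ρ, u q = 0) {y s : ℝ}
    (hy : y = -1 ∨ y = 1) (hs : s ∈ Ioo 0 ρ) : dz ρ u (y, s) = 0 := by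
  refine (hasDerivAt_slice_z hu (mem_Icc_of_side hy) hs).unique
    ((hasDerivAt_const s (0 : ℝ)).congr_of_eventuallyEq ?_)
  filter_upwards [Ioo_mem_nhds hs.1 hs.2] with t ht using h _ (mem_sideEdges hy ht)

lemma edge_subset_wire (hρ : 0 < ρ) (hf : IsAdmissible ρ θ₀ f) {z : ℝ} (hz : z = 0 ∨ z = ρ) :
    (∀ y ∈ Icc (-1 : ℝ) 1, f (y, z) ∈ wire 0 0) ∨
      ∀ y ∈ Icc (-1 : ℝ) 1, f (y, z) ∈ wire ρ θ₀ := by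
  rcases wireEdges_cases hρ hf with h | h <;> rcases hz with rfl | rfl
  · exact Or.inl fun y hy => (h y hy).1
  · exact Or.inr fun y hy => (h y hy).2
  · exact Or.inr fun y hy => (h y hy).1
  · exact Or.inl fun y hy => (h y hy).2

/-- On a wire edge everything in the boundary integrand is parallel to the wire. -/
lemma edge_pointwise (hf : IsRegular ρ f) (hg : C1 ρ g) {z k θ : ℝ} (hz : z ∈ Icc 0 ρ)
    (hw : ∀ y ∈ Icc (-1 : ℝ) 1, f (y, z) ∈ wire k θ)
    (hgw : ∀ y ∈ Icc (-1 : ℝ) 1, wireL θ (g (y, z)) = 0) {y : ℝ} (hy : y ∈ Icc (-1 : ℝ) 1) :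
    inner ℝ (g (y, z)) (unitNormal ρ f (y, z)) = (0 : ℝ) ∧
    inner ℝ (cross (unitNormal ρ f (y, z)) (g (y, z))) (dy ρ g (y, z)) = (0 : ℝ) ∧
    inner ℝ (cross (unitNormal ρ f (y, z)) (radial (f (y, z)))) (dy ρ f (y, z)) = (0 : ℝ) := by
  have hq : (y, z) ∈ rect ρ := ⟨hy, hz⟩
  have f1 := map_dy_edge hf.c2.c1 (wireL θ) hz (fun y hy => wireL_of_mem_wire (hw y hy)) hy
  have g1 := map_dy_edge hg (wireL θ) hz hgw hy
  have g0 := hgw y hy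
  have r0 := wireL_radial (hw y hy)
  have hfr := hf.isFrame hq
  rw [wireL_eq_zero_iff] at f1 g1 g0 r0
  have hcp (n x y : E3) (s t : ℝ) (d : E3) (hx : x = s • d) (hy : y = t • d) :
      inner ℝ (cross n x) y = (0 : ℝ) := by
    rw [hx, hy]
    simp only [inner_coord, cross_zero_coord, cross_one_coord, cross_two_coord, PiLp.smul_apply,
      smul_eq_mul]
    ring
  refine ⟨?_, hcp _ _ _ _ _ _ g0 g1, hcp _ _ _ _ _ _ r0 f1⟩
  have h1 := hfr.na
  -- f_y is parallel to the wire and nonzero by immersion, so n is orthogonal to the wire direction,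
  -- and therefore to g.
  have h2 : inner ℝ (dy ρ f (y, z)) (wireDir θ) ≠ (0 : ℝ) := fun h => by
    rw [h, zero_smul] at f1
    have h3 := hfr.tri_eq
    rw [f1] at h3
    have h4 : tri (unitNormal ρ f (y, z)) 0 (dz ρ f (y, z)) = 0 := by
      simp only [tri_coord, PiLp.zero_apply]; ring
    exact hfr.pos.ne (h4.symm.trans h3)
  rw [f1, real_inner_smul_right] at h1
  have h3 := (mul_eq_zero.1 h1).resolve_left h2
  rw [g0, real_inner_smul_left, real_inner_comm (unitNormal ρ f (y, z)), h3, mul_zero]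

lemma continuousOn_stability (hf : IsRegular ρ f) {c : ℝ × ℝ → ℝ} (hc : C1 ρ c) :
    ContinuousOn (fun q => areaElement ρ f q * ‖gradVec ρ f c q‖ ^ 2 +
      2 * tri (unitNormal ρ f q) (dy ρ (unitNormal ρ f) q) (dz ρ (unitNormal ρ f) q) * c q ^ 2)
      (rect ρ) := by
  have hn := hf.c1_unitNormal
  exact (hf.c1_areaElement.continuousOn.mul ((hf.continuousOn_gradVec hc).norm.pow 2)).add
    ((continuousOn_const.mul (continuousOn_tri hn.continuousOn (hn.continuousOn_dy hf.rho_pos)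
      (hn.continuousOn_dz hf.rho_pos))).mul (hc.continuousOn.pow 2))

/-- The second variation along a family of admissible surfaces, computed from the velocity. -/
lemma secondVar_sub_firstVar_eq (hρ : 0 < ρ) (hf : IsAdmissible ρ θ₀ f)
    (hcrit : ∀ g, IsAdmissibleField ρ θ₀ f g → firstVar ρ f g = 0)
    (hg : IsAdmissibleField ρ θ₀ f g) :
    secondVar ρ f g -
        firstVar ρ f (fun q => (inner ℝ (radial (g q)) (radial (g q)) : ℝ) • radial (f q)) =
      stabilityForm ρ f fun q => inner ℝ (g q) (unitNormal ρ f q) := by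
  have hr := hf.isRegular hρ
  obtain ⟨hg2, hg3, hg4, hg5⟩ := isAdmissibleField_iff.1 hg
  set n := unitNormal ρ f with hn
  have hn1 : C1 ρ n := hr.c1_unitNormal
  set c : ℝ × ℝ → ℝ := fun q => inner ℝ (g q) (n q) with hc
  have hc1 : C1 ρ c := hg2.c1.inner ℝ hn1
  set m : ℝ × ℝ → ℝ := fun q => inner ℝ (radial (g q)) (radial (g q)) with hm
  have hrg : C2 ρ (fun q => radial (g q)) := contDiffOn_radial hg2
  have hrf : C2 ρ (fun q => radial (f q)) := contDiffOn_radial hr.c2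
  have hm1 : C2 ρ m := hrg.inner ℝ hrg
  have hu1 : C1 ρ (fun q => cross (n q) (g q)) := contDiffOn_cross hn1 hg2.c1
  have hu2 : C1 ρ (fun q => c q • cross (n q) (g q)) := hc1.smul hu1
  have hu3 : C1 ρ (fun q => cross (n q) (m q • radial (f q))) :=
    contDiffOn_cross hn1 (C2.c1 (hm1.smul hrf))
  have hmr : C1 ρ (fun q => m q • radial (f q)) := C2.c1 (hm1.smul hrf)
  -- By minimality only the boundary part of the first variation of the centripetal field remains.
  have e1 : firstVar ρ f (fun q => m q • radial (f q)) =
      bdryIntegral ρ (fun q => cross (n q) (m q • radial (f q))) f := by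
    rw [hr.firstVar_eq hmr, add_eq_left]
    refine (setIntegral_congr_fun (measurableSet_rect ρ) fun q hq => ?_).trans
      (integral_zero _ _)
    simp only [meanDensity_eq_zero hρ hf hcrit hq, zero_mul]
  have hi1 := integrableOn_rect (continuousOn_stability hr hc1)
  have hi2 := integrableOn_rect (IsRegular.continuousOn_green hρ hu1 hg2.c1)
  have hi3 := integrableOn_rect (IsRegular.continuousOn_green hρ hu2 hn1)
  -- Green's theorem for the two exact forms, one with w = g and one with w = n; in the latter w is
  -- only C¹.
  have e2 : secondVar ρ f g = (∫ q in rect ρ, (areaElement ρ f q * ‖gradVec ρ f c q‖ ^ 2 +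
      2 * tri (n q) (dy ρ n q) (dz ρ n q) * c q ^ 2)) +
      bdryIntegral ρ (fun q => cross (n q) (g q)) g +
      bdryIntegral ρ (fun q => c q • cross (n q) (g q)) n := by
    have hi12 := hi1.add hi2
    rw [← integral_green hρ hu1 hg2.c1, ← integral_green hρ hu2 hn1, ← integral_add hi1 hi2]
    refine Eq.trans (setIntegral_congr_fun (measurableSet_rect ρ) fun q hq => ?_)
      (integral_add hi12 hi3)
    have hH : tri (n q) (dy ρ n q) (dz ρ f q) + tri (n q) (dy ρ f q) (dz ρ n q) = 0 :=
      meanDensity_eq_zero hρ hf hcrit hq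
    have h1 := secondVariation_pointwise (hr.isFrame hq) (hr.inner_unitNormal_dy hq)
      (hr.inner_unitNormal_dz hq) (hr.inner_dy_dz_unitNormal hq) hH
      (c := c q) rfl (dy_inner hρ hg2.c1 hn1 hq) (dz_inner hρ hg2.c1 hn1 hq)
    rw [dy_smul hρ hc1 hu1 hq, dz_smul hρ hc1 hu1 hq, dy_cross hρ hn1 hg2.c1 hq,
      dz_cross hρ hn1 hg2.c1 hq]
    exact h1
  -- the boundary terms
  have hedge {z k θ : ℝ} (hz : z ∈ Icc 0 ρ) (hw : ∀ y ∈ Icc (-1 : ℝ) 1, f (y, z) ∈ wire k θ)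
      (hgw : ∀ y ∈ Icc (-1 : ℝ) 1, wireL θ (g (y, z)) = 0) :
      (∫ s in (-1 : ℝ)..1, inner ℝ (cross (n (s, z)) (g (s, z))) (dy ρ g (s, z)) : ℝ) = 0 ∧
      (∫ s in (-1 : ℝ)..1, inner ℝ (c (s, z) • cross (n (s, z)) (g (s, z))) (dy ρ n (s, z)) : ℝ)
        = 0 ∧
      (∫ s in (-1 : ℝ)..1, inner ℝ (cross (n (s, z)) (m (s, z) • radial (f (s, z))))
        (dy ρ f (s, z)) : ℝ) = 0 := by
    have key (s) (hs : s ∈ uIoc (-1 : ℝ) 1) := edge_pointwise hr hg2.c1 hz hw hgw (y := s) (by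
      rw [uIoc_of_le (by norm_num)] at hs; exact Ioc_subset_Icc_self hs)
    refine ⟨intervalIntegral.integral_zero_ae (.of_forall fun s hs => (key s hs).2.1),
      intervalIntegral.integral_zero_ae (.of_forall fun s hs => ?_),
      intervalIntegral.integral_zero_ae (.of_forall fun s hs => ?_)⟩
    · have : c (s, z) = 0 := (key s hs).1
      rw [this, zero_smul, inner_zero_left]
    · have h1 : cross (n (s, z)) (m (s, z) • radial (f (s, z))) =
          m (s, z) • cross (n (s, z)) (radial (f (s, z))) := (crossL (n (s, z))).map_smul _ _
      rw [h1, real_inner_smul_left, (key s hs).2.2, mul_zero]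
  have hedges : ∀ z, (z = 0 ∨ z = ρ) →
      (∫ s in (-1 : ℝ)..1, inner ℝ (cross (n (s, z)) (g (s, z))) (dy ρ g (s, z)) : ℝ) = 0 ∧
      (∫ s in (-1 : ℝ)..1, inner ℝ (c (s, z) • cross (n (s, z)) (g (s, z))) (dy ρ n (s, z)) : ℝ)
        = 0 ∧
      (∫ s in (-1 : ℝ)..1, inner ℝ (cross (n (s, z)) (m (s, z) • radial (f (s, z))))
        (dy ρ f (s, z)) : ℝ) = 0 := by
    intro z hz
    have hzI : z ∈ Icc 0 ρ := by rcases hz with rfl | rfl <;> simp [hρ.le]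
    rcases edge_subset_wire hρ hf hz with h | h
    · exact hedge hzI h fun y hy => hg3 _ ⟨hy, hzI⟩ (h y hy)
    · exact hedge hzI h fun y hy => hg4 _ ⟨hy, hzI⟩ (h y hy)
  -- The three boundary integrals have to be added before they simplify: separately they depend on
  -- the tangential part of g.
  have hside (y₀ : ℝ) (hy : y₀ = -1 ∨ y₀ = 1) :
      (∫ s in (0 : ℝ)..ρ, inner ℝ (cross (n (y₀, s)) (g (y₀, s))) (dz ρ g (y₀, s)) : ℝ) +
      (∫ s in (0 : ℝ)..ρ, inner ℝ (c (y₀, s) • cross (n (y₀, s)) (g (y₀, s))) (dz ρ n (y₀, s)) : ℝ)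
      - (∫ s in (0 : ℝ)..ρ, inner ℝ (cross (n (y₀, s)) (m (y₀, s) • radial (f (y₀, s))))
        (dz ρ f (y₀, s)) : ℝ) =
      -(y₀ * ∫ s in (0 : ℝ)..ρ, inner ℝ (sideTangent ρ f (y₀, s)) zAxis ^ 2 * c (y₀, s) ^ 2 *
        ‖dz ρ f (y₀, s)‖) := by
    have hyI := mem_Icc_of_side hy
    have hii {u : ℝ × ℝ → ℝ} (hu : ContinuousOn u (rect ρ)) :
        IntervalIntegrable (fun s => u (y₀, s)) volume 0 ρ :=
      ContinuousOn.intervalIntegrable (by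
        rw [uIcc_of_le hρ.le]; exact continuousOn_slice_z hu hyI)
    have j1 := hii (hu1.continuousOn.inner (𝕜 := ℝ) (hg2.c1.continuousOn_dz hρ))
    have j2 := hii (hu2.continuousOn.inner (𝕜 := ℝ) (hn1.continuousOn_dz hρ))
    have j3 := hii (hu3.continuousOn.inner (𝕜 := ℝ) (hr.c2.c1.continuousOn_dz hρ))
    rw [← intervalIntegral.integral_add j1 j2, ← intervalIntegral.integral_sub (j1.add j2) j3,
      ← intervalIntegral.integral_const_mul, ← intervalIntegral.integral_neg]
    refine intervalIntegral.integral_congr_Ioo_of_le hρ.le fun s hs => ?_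
    have hq := mem_sideEdges hy hs
    have hqr := sideEdges_subset hq
    have hcr : cross (n (y₀, s)) (m (y₀, s) • radial (f (y₀, s))) =
        m (y₀, s) • cross (n (y₀, s)) (radial (f (y₀, s))) := (crossL (n (y₀, s))).map_smul _ _
    -- Differentiation of r · x = 0 along the side; used for x = g and, by orthogonality to the
    -- tube, for x = n.
    have hd {x : ℝ × ℝ → E3} (hx : C1 ρ x)
        (h0 : ∀ q ∈ sideEdges ρ, (inner ℝ (radial (f q)) (x q) : ℝ) = 0) :
        inner ℝ (radial (f (y₀, s))) (dz ρ x (y₀, s)) =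
          -(inner ℝ (radial (dz ρ f (y₀, s))) (x (y₀, s)) : ℝ) := by
      have := dz_side_eq_zero (hrf.c1.inner ℝ hx) h0 hy hs
      rw [dz_inner hρ hrf.c1 hx hqr, dz_radial hρ hr.c2.c1 hqr] at this
      linarith
    have := side_pointwise (hr.isFrame hqr) (y₀ := y₀) (c := c (y₀, s))
      (by rcases hy with rfl | rfl <;> norm_num)
      (inner_radial_self_side hf hq) (inner_unitNormal_radial_side hρ hf hcrit hq)
      (inner_radial_dz_side hρ hf hq) (inner_radial_dy_side_pos hρ hf hcrit hy hs)
      (radial_two_coord _) (hg5 _ hq)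
      (hd hg2.c1 fun q hq => by rw [real_inner_comm]; exact hg5 q hq)
      (hd hn1 fun q hq => by
        rw [real_inner_comm]; exact inner_unitNormal_radial_side hρ hf hcrit hq) rfl
    simp only [hcr]
    exact this
  have s1 := hside 1 (Or.inr rfl)
  have s2 := hside (-1) (Or.inl rfl)
  obtain ⟨a1, a2, a3⟩ := hedges 0 (Or.inl rfl)
  obtain ⟨b1, b2, b3⟩ := hedges ρ (Or.inr rfl)
  rw [e1, e2, stabilityForm, sideIntegral]
  simp only [bdryIntegral, a1, a2, a3, b1, b2, b3]
  linarith

/-- The second variation formula. -/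
theorem deriv_deriv_energy_eq (hρ : 0 < ρ) (hf : IsAdmissible ρ θ₀ f)
    (hcrit : ∀ g, IsAdmissibleField ρ θ₀ f g → firstVar ρ f g = 0)
    (hg : IsAdmissibleField ρ θ₀ f g) (ha : a < 0) (hb : 0 < b) {F : ℝ → ℝ × ℝ → E3}
    (hF : IsC2Family ρ a b F) (hadm : ∀ t ∈ Ioo a b, IsAdmissible ρ θ₀ (F t))
    (hv : ∀ q ∈ rect ρ, F 0 q = f q ∧ HasDerivAt (fun t => F t q) (g q) 0) :
    deriv (deriv fun t => energy ρ σ (F t)) 0 =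
      σ * stabilityForm ρ f fun q => inner ℝ (g q) (unitNormal ρ f q) := by
  obtain ⟨G, hG, rfl⟩ := hF.exists_jet
  have h0 : (0 : ℝ) ∈ Ioo a b := ⟨ha, hb⟩
  have hGf : EqOn (G 0 0) f (rect ρ) := fun q hq => (hv q hq).1
  have hGg : EqOn (G 1 0) g (rect ρ) := fun q hq =>
    (hG.hasDerivAt 0 (by norm_num) 0 h0 q hq).unique (hv q hq).2
  have hr := hf.isRegular hρ
  rw [hG.deriv_deriv_energy_zero hr ha hb (fun t ht q hq => ((hadm t ht).isRegular hρ).cross_ne q hq)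
    hGf hGg, ← secondVar_sub_firstVar_eq hρ hf hcrit hg]
  -- Criticality applied to the corrected acceleration: the first variation of the acceleration is
  -- minus that of the centripetal field.
  have h1 := hcrit _ (hG.isAdmissibleField_acceleration hρ ha hb hf hadm hGf)
  have hrg : C2 ρ (fun q => radial (g q)) := contDiffOn_radial hg.c2
  have hm : C1 ρ (fun q => (inner ℝ (radial (g q)) (radial (g q)) : ℝ) • radial (f q)) :=
    C2.c1 ((hrg.inner ℝ hrg).smul (contDiffOn_radial hr.c2))
  have h2 : firstVar ρ f (fun q => G 2 0 q +
      (inner ℝ (radial (G 1 0 q)) (radial (G 1 0 q)) : ℝ) • radial (f q)) =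
      firstVar ρ f (G 2 0) +
        firstVar ρ f (fun q => (inner ℝ (radial (g q)) (radial (g q)) : ℝ) • radial (f q)) := by
    have h2c := (hG.c2 2 le_rfl 0 h0).c1
    rw [firstVar, firstVar, firstVar, ← integral_add (integrableOn_rect (hr.continuousOn_firstVar h2c))
      (integrableOn_rect (hr.continuousOn_firstVar hm))]
    refine setIntegral_congr_fun (measurableSet_rect ρ) fun q hq => ?_
    have e : EqOn (fun q => G 2 0 q +
      (inner ℝ (radial (G 1 0 q)) (radial (G 1 0 q)) : ℝ) • radial (f q)) (fun q => G 2 0 q +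
      (inner ℝ (radial (g q)) (radial (g q)) : ℝ) • radial (f q)) (rect ρ) := fun q hq => by
        simp only [hGg hq]
    rw [dy_congr e hq, dz_congr e hq, dy_add hρ h2c hm hq, dz_add hρ h2c hm hq]
    simp only [tri_coord, PiLp.add_apply]
    ring
  rw [h2] at h1
  congr 1
  linarith

end Form

/-! ### Approximation of admissible normal components -/

section Approximation
open Filter
open scoped Topology
variable {ρ θ₀ : ℝ} {f : ℝ × ℝ → E3}

section Comp
variable {F : Type*} [NormedAddCommGroup F] [NormedSpace ℝ F] {A : ℝ × ℝ → ℝ × ℝ}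
  {A' : (ℝ × ℝ) →L[ℝ] ℝ × ℝ}

lemma BddLim.comp {u : ℕ → ℝ × ℝ → F} {g : ℝ × ℝ → F} (hu : BddLim ρ u g)
    (hA : MapsTo A (rect ρ) (rect ρ)) : BddLim ρ (fun k q => u k (A q)) (fun q => g (A q)) := by
  obtain ⟨M, hM⟩ := hu.bound
  exact ⟨fun q hq => hu.tendsto _ (hA hq), M, fun k q hq => hM k _ (hA hq)⟩

lemma fderivWithin_comp_affine (hρ : 0 < ρ) (hA : MapsTo A (rect ρ) (rect ρ))
    (hA' : ∀ q, HasFDerivAt A A' q) {u : ℝ × ℝ → F} (hu : C1 ρ u) {q : ℝ × ℝ} (hq : q ∈ rect ρ)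
    (e : ℝ × ℝ) : fderivWithin ℝ (fun p => u (A p)) (rect ρ) q e =
      (A' e).1 • dy ρ u (A q) + (A' e).2 • dz ρ u (A q) := by
  have h := ((hu.diff (hA hq)).hasFDerivWithinAt.comp q (hA' q).hasFDerivWithinAt hA).fderivWithin
    (uniqueDiffOn_rect hρ q hq)
  have h2 : fderivWithin ℝ (fun p => u (A p)) (rect ρ) q =
    (fderivWithin ℝ u (rect ρ) (A q)).comp A' := h
  rw [h2, ContinuousLinearMap.comp_apply, fderivWithin_eq_dy_dz]

lemma C1Lim.comp (hρ : 0 < ρ) {u : ℕ → ℝ × ℝ → F} {g : ℝ × ℝ → F} (hu : C1Lim ρ u g)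
    (hu' : ∀ k, C1 ρ (u k)) (hg : C1 ρ g) (hA : MapsTo A (rect ρ) (rect ρ))
    (hA' : ∀ q, HasFDerivAt A A' q) : C1Lim ρ (fun k q => u k (A q)) (fun q => g (A q)) := by
  have key (e : ℝ × ℝ) : BddLim ρ (fun k q => (A' e).1 • dy ρ (u k) (A q) +
      (A' e).2 • dz ρ (u k) (A q)) fun q => (A' e).1 • dy ρ g (A q) + (A' e).2 • dz ρ g (A q) :=
    ((BddLim.const continuousOn_const).bilin (ContinuousLinearMap.lsmul ℝ ℝ)
      (hu.lim_dy.comp hA)).add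
    ((BddLim.const continuousOn_const).bilin (ContinuousLinearMap.lsmul ℝ ℝ)
      (hu.lim_dz.comp hA))
  exact ⟨hu.lim.comp hA,
    (key (1, 0)).congr (fun k q hq => fderivWithin_comp_affine hρ hA hA' (hu' k) hq _)
      fun q hq => fderivWithin_comp_affine hρ hA hA' hg hq _,
    (key (0, 1)).congr (fun k q hq => fderivWithin_comp_affine hρ hA hA' (hu' k) hq _)
      fun q hq => fderivWithin_comp_affine hρ hA hA' hg hq _⟩

/-- Approximation by `C²` functions that vanish on two subsets: `A` and `B` are projections to these
sets, and `p`, `1 - p` are the interpolation weights. -/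
lemma exists_c1Lim_vanishing (hρ : 0 < ρ) {g : ℝ × ℝ → ℝ} (hg : C1 ρ g) {A B : ℝ × ℝ → ℝ × ℝ}
    {A' B' : (ℝ × ℝ) →L[ℝ] ℝ × ℝ} (hA : MapsTo A (rect ρ) (rect ρ))
    (hA' : ∀ q, HasFDerivAt A A' q) (hB : MapsTo B (rect ρ) (rect ρ))
    (hB' : ∀ q, HasFDerivAt B B' q) (hA2 : ContDiff ℝ 2 A) (hB2 : ContDiff ℝ 2 B)
    {p : ℝ × ℝ → ℝ} (hp : ContDiff ℝ 2 p) (hgA : ∀ q ∈ rect ρ, g (A q) = 0)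
    (hgB : ∀ q ∈ rect ρ, g (B q) = 0) :
    ∃ u : ℕ → ℝ × ℝ → ℝ, (∀ k, C2 ρ (u k)) ∧ C1Lim ρ u g ∧
      ∀ k q, (A q = q → p q = 1 → u k q = 0) ∧ (B q = q → p q = 0 → u k q = 0) := by
  obtain ⟨u, hu2, hu⟩ := exists_c1Lim hρ hg
  have hu1 (k) : C1 ρ (u k) := C2.c1 (hu2 k).contDiffOn
  have hAc : C1 ρ A := (hA2.of_le (by norm_num)).contDiffOn
  have hBc : C1 ρ B := (hB2.of_le (by norm_num)).contDiffOn
  have hp1 : C1 ρ p := (hp.of_le (by norm_num)).contDiffOn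
  have hp2 : C1 ρ (fun q => 1 - p q) := contDiffOn_const.sub hp1
  have huA (k) : C1 ρ (fun q => u k (A q)) := (hu1 k).comp hAc hA
  have huB (k) : C1 ρ (fun q => u k (B q)) := (hu1 k).comp hBc hB
  have hgA1 : C1 ρ (fun q => g (A q)) := hg.comp hAc hA
  have hgB1 : C1 ρ (fun q => g (B q)) := hg.comp hBc hB
  have hpuA (k) : C1 ρ (fun q => p q * u k (A q)) := hp1.mul (huA k)
  have hpuB (k) : C1 ρ (fun q => (1 - p q) * u k (B q)) := hp2.mul (huB k)
  have hpgA : C1 ρ (fun q => p q * g (A q)) := hp1.mul hgA1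
  have hpgB : C1 ρ (fun q => (1 - p q) * g (B q)) := hp2.mul hgB1
  have lA : C1Lim ρ (fun k q => p q * u k (A q)) (fun q => p q * g (A q)) :=
    (C1Lim.const hρ hp1).bilin hρ (ContinuousLinearMap.mul ℝ ℝ) (hu.comp hρ hu1 hg hA hA')
      (fun _ => hp1) huA hp1 hgA1
  have lB : C1Lim ρ (fun k q => (1 - p q) * u k (B q)) (fun q => (1 - p q) * g (B q)) :=
    (C1Lim.const hρ hp2).bilin hρ (ContinuousLinearMap.mul ℝ ℝ) (hu.comp hρ hu1 hg hB hB')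
      (fun _ => hp2) huB hp2 hgB1
  -- Subtracting the interpolation of the values on the two sets produces the exact zeros. In the
  -- limit nothing is subtracted, since g vanishes on both sets.
  refine ⟨fun k q => u k q - p q * u k (A q) - (1 - p q) * u k (B q), fun k => ?_, ?_,
    fun k q => ⟨fun h1 h2 => ?_, fun h1 h2 => ?_⟩⟩
  · exact ContDiff.contDiffOn (((hu2 k).sub (hp.mul ((hu2 k).comp hA2))).sub
      ((contDiff_const.sub hp).mul ((hu2 k).comp hB2)))
  · refine ((hu.sub hρ lA hu1 hpuA hg hpgA).sub hρ lB (fun k => (hu1 k).sub (hpuA k)) hpuB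
      (hg.sub hpgA) hpgB).congr fun q hq => ?_
    simp only [hgA q hq, hgB q hq, mul_zero, sub_zero]
  · simp only [h1, h2]; ring
  · simp only [h1, h2]; ring

end Comp

lemma exists_c1Lim_vanishing_wireEdges (hρ : 0 < ρ) {g : ℝ × ℝ → ℝ} (hg : C1 ρ g)
    (h0 : ∀ q ∈ wireEdges ρ, g q = 0) :
    ∃ u : ℕ → ℝ × ℝ → ℝ, (∀ k, C2 ρ (u k)) ∧ C1Lim ρ u g ∧ ∀ k, ∀ q ∈ wireEdges ρ, u k q = 0 := by
  have hd (z : ℝ) (q : ℝ × ℝ) : HasFDerivAt (fun q : ℝ × ℝ => (q.1, z))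
      ((ContinuousLinearMap.fst ℝ ℝ ℝ).prod 0) q :=
    hasFDerivAt_fst.prodMk (hasFDerivAt_const z q)
  obtain ⟨u, hu, hl, h⟩ := exists_c1Lim_vanishing hρ hg (A := fun q => (q.1, 0))
    (B := fun q => (q.1, ρ)) (p := fun q => 1 - q.2 / ρ) (fun q hq => ⟨hq.1, le_rfl, hρ.le⟩) (hd 0)
    (fun q hq => ⟨hq.1, hρ.le, le_rfl⟩) (hd ρ) (by fun_prop) (by fun_prop) (by fun_prop)
    (fun q hq => h0 _ ⟨hq.1, Or.inl rfl⟩) (fun q hq => h0 _ ⟨hq.1, Or.inr rfl⟩)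
  refine ⟨u, hu, hl, fun k q hq => ?_⟩
  obtain ⟨y, z⟩ := q
  rcases hq.2 with hz | hz <;> simp only at hz <;> subst hz
  · exact (h k (y, 0)).1 rfl (by simp)
  · exact (h k (y, z)).2 rfl (by simp [hρ.ne'])

lemma exists_c1Lim_vanishing_sides (hρ : 0 < ρ) {g : ℝ × ℝ → ℝ} (hg : C1 ρ g)
    (h0 : ∀ y z, (y = -1 ∨ y = 1) → z ∈ Icc 0 ρ → g (y, z) = 0) :
    ∃ u : ℕ → ℝ × ℝ → ℝ, (∀ k, C2 ρ (u k)) ∧ C1Lim ρ u g ∧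
      ∀ k y z, (y = -1 ∨ y = 1) → u k (y, z) = 0 := by
  have hd (y : ℝ) (q : ℝ × ℝ) : HasFDerivAt (fun q : ℝ × ℝ => (y, q.2))
      ((0 : (ℝ × ℝ) →L[ℝ] ℝ).prod (ContinuousLinearMap.snd ℝ ℝ ℝ)) q :=
    (hasFDerivAt_const y q).prodMk hasFDerivAt_snd
  obtain ⟨u, hu, hl, h⟩ := exists_c1Lim_vanishing hρ hg (A := fun q => (-1, q.2))
    (B := fun q => (1, q.2)) (p := fun q => (1 - q.1) / 2) (fun q hq => ⟨by simp, hq.2⟩) (hd (-1))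
    (fun q hq => ⟨by simp, hq.2⟩) (hd 1) (by fun_prop) (by fun_prop) (by fun_prop)
    (fun q hq => h0 _ _ (Or.inl rfl) hq.2) (fun q hq => h0 _ _ (Or.inr rfl) hq.2)
  refine ⟨u, hu, hl, fun k y z hy => ?_⟩
  rcases hy with rfl | rfl
  · exact (h k (-1, z)).1 rfl (by norm_num)
  · exact (h k (1, z)).2 rfl (by norm_num)

/-- The boundary integrand of the stability form has a continuous density. -/
lemma sideIntegral_eq (f : ℝ × ℝ → E3) (c : ℝ × ℝ → ℝ) :
    sideIntegral ρ f (fun q => inner ℝ (sideTangent ρ f q) zAxis ^ 2 * c q ^ 2) =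
      (∫ s in (0 : ℝ)..ρ, ‖dz ρ f (-1, s)‖⁻¹ * inner ℝ (dz ρ f (-1, s)) zAxis ^ 2 * c (-1, s) ^ 2) +
      ∫ s in (0 : ℝ)..ρ, ‖dz ρ f (1, s)‖⁻¹ * inner ℝ (dz ρ f (1, s)) zAxis ^ 2 * c (1, s) ^ 2 := by
  have h (q : ℝ × ℝ) : inner ℝ (sideTangent ρ f q) zAxis ^ 2 * c q ^ 2 * ‖dz ρ f q‖ =
      ‖dz ρ f q‖⁻¹ * inner ℝ (dz ρ f q) zAxis ^ 2 * c q ^ 2 := by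
    rw [sideTangent, real_inner_smul_left]
    by_cases h0 : ‖dz ρ f q‖ = 0
    · simp [h0]
    · field_simp
  simp only [sideIntegral, h]

lemma IsRegular.dz_ne_zero (hf : IsRegular ρ f) {q : ℝ × ℝ} (hq : q ∈ rect ρ) : dz ρ f q ≠ 0 := by
  intro h
  refine hf.cross_ne q hq ?_
  rw [h]
  exact (crossL (dy ρ f q)).map_zero

lemma IsRegular.continuousOn_sideDensity (hf : IsRegular ρ f) : ContinuousOn
    (fun q => ‖dz ρ f q‖⁻¹ * inner ℝ (dz ρ f q) zAxis ^ 2) (rect ρ) :=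
  (hf.c1_dz.continuousOn.norm.inv₀ fun _ hq => norm_ne_zero_iff.2 (hf.dz_ne_zero hq)).mul
    ((hf.c1_dz.continuousOn.inner continuousOn_const).pow 2)

lemma tendsto_sideIntegral (hf : IsRegular ρ f) {u : ℕ → ℝ × ℝ → ℝ} {c : ℝ × ℝ → ℝ}
    (hu : BddLim ρ u c) (hc : ∀ k, ContinuousOn (u k) (rect ρ)) :
    Tendsto (fun k => sideIntegral ρ f fun q => inner ℝ (sideTangent ρ f q) zAxis ^ 2 * u k q ^ 2)
      atTop (𝓝 (sideIntegral ρ f fun q => inner ℝ (sideTangent ρ f q) zAxis ^ 2 * c q ^ 2)) := by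
  simp only [sideIntegral_eq f]
  simp only [sq (u _ _), sq (c _)]
  have hl := (BddLim.const hf.continuousOn_sideDensity).mul (hu.mul hu)
  have hk (k) := hf.continuousOn_sideDensity.mul ((hc k).mul (hc k))
  exact (hl.integral_z hf.rho_pos hk (y := -1) (by simp)).add
    (hl.integral_z hf.rho_pos hk (y := 1) (by simp))

/-- The form involves c and its first derivatives only, with continuous coefficients, so bounded C¹
convergence suffices. This is what makes the lower regularity of n harmless. -/
lemma tendsto_stabilityForm (hf : IsRegular ρ f) {u : ℕ → ℝ × ℝ → ℝ} {c : ℝ × ℝ → ℝ}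
    (hu : C1Lim ρ u c) (hc : ∀ k, C1 ρ (u k)) :
    Tendsto (fun k => stabilityForm ρ f (u k)) atTop (𝓝 (stabilityForm ρ f c)) := by
  have hρ := hf.rho_pos
  refine Tendsto.sub ?_ (tendsto_sideIntegral hf hu.lim fun k => (hc k).continuousOn)
  have hn := hf.c1_unitNormal
  have l1 : BddLim ρ (fun k => gradVec ρ f (u k)) (gradVec ρ f c) :=
    (hu.lim_dy.bilin (ContinuousLinearMap.lsmul ℝ ℝ) (.const hf.c1_dualY.continuousOn)).add
      (hu.lim_dz.bilin (ContinuousLinearMap.lsmul ℝ ℝ) (.const hf.c1_dualZ.continuousOn))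
  have l2 := (BddLim.const hf.c1_areaElement.continuousOn).mul (l1.inner l1)
  have l3 := (BddLim.const (continuousOn_const.mul (continuousOn_tri hn.continuousOn
    (hn.continuousOn_dy hρ) (hn.continuousOn_dz hρ)) (f := fun _ => (2 : ℝ)))).mul
      (hu.lim.mul hu.lim)
  refine ((l2.add l3).congr (fun k q hq => ?_) fun q hq => ?_).integral
    fun k => continuousOn_stability hf (hc k)
  · simp only [real_inner_self_eq_norm_sq, sq (u k q), Pi.mul_apply]
  · simp only [real_inner_self_eq_norm_sq, sq (c q), Pi.mul_apply]

lemma stabilityForm_congr (hρ : 0 < ρ) {c c' : ℝ × ℝ → ℝ} (h : EqOn c c' (rect ρ)) :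
    stabilityForm ρ f c = stabilityForm ρ f c' := by
  unfold stabilityForm sideIntegral
  have hs {y : ℝ} (hy : y ∈ Icc (-1 : ℝ) 1) {s : ℝ} (hs : s ∈ uIcc 0 ρ) : c (y, s) = c' (y, s) :=
    h ⟨hy, by rwa [uIcc_of_le hρ.le] at hs⟩
  congr 1
  · refine setIntegral_congr_fun (measurableSet_rect ρ) fun q hq => ?_
    simp only [gradVec, dy_congr h hq, dz_congr h hq, h hq]
  · congr 1 <;> refine intervalIntegral.integral_congr fun s hs' => ?_
    · simp only [hs (y := -1) (by simp) hs']
    · simp only [hs (y := 1) (by simp) hs']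

lemma stabilityForm_eq_sub (hf : IsRegular ρ f) (c : E3 → ℝ) :
    stabilityForm ρ f (c ∘ f) =
      surfIntegral ρ f (fun q => ‖surfGrad ρ f (c ∘ f) q‖ ^ 2 +
        2 * gaussCurv ρ f q * c (f q) ^ 2) -
      sideIntegral ρ f (fun q => inner ℝ (sideTangent ρ f q) zAxis ^ 2 * c (f q) ^ 2) := by
  rw [stabilityForm, surfIntegral]
  congr 1
  refine setIntegral_congr_fun (measurableSet_rect ρ) fun q hq => ?_
  have h1 := hf.gaussCurv_mul_areaElement hq
  simp only [norm_surfGrad_sq, Function.comp_apply]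
  rw [← h1, gradVec]
  ring

/-- Positivity on `C²` functions extends to `C¹` functions. -/
lemma stabilityForm_nonneg_of_c1 (hf : IsRegular ρ f)
    (h : ∀ u, C2 ρ u → (∀ q ∈ wireEdges ρ, u q = 0) → 0 ≤ stabilityForm ρ f u) {c : ℝ × ℝ → ℝ}
    (hc : C1 ρ c) (h0 : ∀ q ∈ wireEdges ρ, c q = 0) : 0 ≤ stabilityForm ρ f c := by
  obtain ⟨u, hu, hl, hu0⟩ := exists_c1Lim_vanishing_wireEdges hf.rho_pos hc h0
  exact ge_of_tendsto' (tendsto_stabilityForm hf hl fun k => (hu k).c1) fun k => h _ (hu k) (hu0 k)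

lemma IsAdmissibleField.inner_unitNormal_wireEdges (hρ : 0 < ρ) (hf : IsAdmissible ρ θ₀ f)
    {g : ℝ × ℝ → E3} (hg : IsAdmissibleField ρ θ₀ f g) {q : ℝ × ℝ} (hq : q ∈ wireEdges ρ) :
    inner ℝ (g q) (unitNormal ρ f q) = (0 : ℝ) := by
  obtain ⟨hg2, hg3, hg4, hg5⟩ := isAdmissibleField_iff.1 hg
  have hr := hf.isRegular hρ
  obtain ⟨y, z⟩ := q
  obtain ⟨hy, hz⟩ := hq
  simp only at hy hz
  have hzI : z ∈ Icc 0 ρ := by rcases hz with rfl | rfl <;> simp [hρ.le]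
  rcases edge_subset_wire hρ hf hz with h | h
  · exact (edge_pointwise hr hg2.c1 hzI h (fun y hy => hg3 _ ⟨hy, hzI⟩ (h y hy)) hy).1
  · exact (edge_pointwise hr hg2.c1 hzI h (fun y hy => hg4 _ ⟨hy, hzI⟩ (h y hy)) hy).1

end Approximation

/-! ### A smooth soft threshold -/

section Threshold
open Filter
open scoped Topology

/-- `x - arctan x` on the positive half-line, extended by zero. -/
def arctanGap (x : ℝ) : ℝ := max x 0 - Real.arctan (max x 0)

lemma arctanGap_of_nonpos {x : ℝ} (hx : x ≤ 0) : arctanGap x = 0 := by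
  simp [arctanGap, max_eq_right hx]

/-- The slope x²/(1 + x²) on the positive half-line lies in [0, 1) and vanishes to second order at
0, so the extension by zero is C²; subtracting the bounded arctan keeps the function within a
constant of the positive part. -/
lemma hasDerivAt_arctanGap (x : ℝ) :
    HasDerivAt arctanGap (max x 0 ^ 2 / (1 + max x 0 ^ 2)) x := by
  have hc : Continuous arctanGap :=
    (continuous_id.max continuous_const).sub
      (Real.continuous_arctan.comp (continuous_id.max continuous_const))
  have hc' : Continuous fun x : ℝ => max x 0 ^ 2 / (1 + max x 0 ^ 2) :=
    Continuous.div (by fun_prop) (by fun_prop) fun x => by positivity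
  refine hasDerivAt_of_hasDerivAt_of_ne' (x := 0)
    (g := fun x : ℝ => max x 0 ^ 2 / (1 + max x 0 ^ 2)) (fun y hy => ?_) hc.continuousAt
    hc'.continuousAt x
  rcases hy.lt_or_gt with h | h
  · refine ((hasDerivAt_const y (0 : ℝ)).congr_of_eventuallyEq ?_).congr_deriv
      (by simp [max_eq_right h.le])
    filter_upwards [gt_mem_nhds h] with z hz using arctanGap_of_nonpos hz.le
  · refine (((hasDerivAt_id y).sub (Real.hasDerivAt_arctan y)).congr_of_eventuallyEq
      ?_).congr_deriv ?_
    · filter_upwards [lt_mem_nhds h] with z hz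
      simp [arctanGap, max_eq_left hz.le]
    · rw [max_eq_left h.le]
      field_simp
      ring

lemma contDiff_arctanGap : ContDiff ℝ 2 arctanGap := by
  have h : deriv arctanGap = fun x => max x 0 ^ 2 / (1 + max x 0 ^ 2) :=
    funext fun x => (hasDerivAt_arctanGap x).deriv
  rw [show (2 : WithTop ℕ∞) = 1 + 1 by norm_num, contDiff_succ_iff_deriv, h]
  exact ⟨fun x => (hasDerivAt_arctanGap x).differentiableAt, by simp,
    contDiff_max_pow_two.div (contDiff_const.add contDiff_max_pow_two) fun x => by positivity⟩

/-- A soft threshold: a contraction of class `C²` close to the identity that vanishes on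
`[-δ, δ]`. -/
def softThreshold (δ x : ℝ) : ℝ := δ * (arctanGap (x / δ - 1) - arctanGap (-x / δ - 1))

lemma contDiff_softThreshold (δ : ℝ) : ContDiff ℝ 2 (softThreshold δ) :=
  contDiff_const.mul ((contDiff_arctanGap.comp ((contDiff_id.div_const δ).sub contDiff_const)).sub
    (contDiff_arctanGap.comp ((contDiff_neg.div_const δ).sub contDiff_const)))

lemma softThreshold_eq_zero {δ x : ℝ} (hδ : 0 < δ) (hx : |x| ≤ δ) : softThreshold δ x = 0 := by
  obtain ⟨h1, h2⟩ := abs_le.1 hx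
  rw [softThreshold, arctanGap_of_nonpos, arctanGap_of_nonpos, sub_self, mul_zero]
  · rw [sub_nonpos, div_le_one hδ]; linarith
  · rw [sub_nonpos, div_le_one hδ]; linarith

/-- At every x at most one of the two gaps has nonzero slope, so their sum is still bounded by 1. -/
lemma exists_hasDerivAt_softThreshold {δ : ℝ} (hδ : 0 < δ) (x : ℝ) :
    ∃ T', T' ^ 2 ≤ 1 ∧ HasDerivAt (softThreshold δ) T' x := by
  set ψ : ℝ → ℝ := fun x => max x 0 ^ 2 / (1 + max x 0 ^ 2) with hψ
  have hψ0 (x) : 0 ≤ ψ x := by simp only [hψ]; positivity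
  have hψ1 (x) : ψ x ≤ 1 := by
    simp only [hψ]
    rw [div_le_one (by positivity)]
    linarith
  have hψn {x} (hx : x ≤ 0) : ψ x = 0 := by simp [hψ, max_eq_right hx]
  have h1 : HasDerivAt (fun x : ℝ => x / δ - 1) (1 / δ) x :=
    ((hasDerivAt_id x).div_const δ).sub_const 1
  have h2 : HasDerivAt (fun x : ℝ => -x / δ - 1) (-1 / δ) x :=
    ((hasDerivAt_id x).neg.div_const δ).sub_const 1
  have h3 := (((hasDerivAt_arctanGap _).comp x h1).sub
    ((hasDerivAt_arctanGap _).comp x h2)).const_mul δ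
  refine ⟨ψ (x / δ - 1) + ψ (-x / δ - 1), ?_, h3.congr_deriv ?_⟩
  · rcases le_total 0 x with hx | hx
    · have : -x / δ - 1 ≤ 0 := by
        have : -x / δ ≤ 0 := div_nonpos_of_nonpos_of_nonneg (by linarith) hδ.le
        linarith
      rw [hψn this, add_zero, sq_le_one_iff₀ (hψ0 _)]
      exact hψ1 _
    · have : x / δ - 1 ≤ 0 := by
        have : x / δ ≤ 0 := div_nonpos_of_nonpos_of_nonneg hx hδ.le
        linarith
      rw [hψn this, zero_add, sq_le_one_iff₀ (hψ0 _)]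
      exact hψ1 _
  · simp only [hψ]
    field_simp
    ring

/-- In units of δ, the piecewise linear threshold misses the identity by at most 1, and the arctan
terms add at most 2. -/
lemma abs_softThreshold_sub_le {δ : ℝ} (hδ : 0 < δ) (x : ℝ) :
    |softThreshold δ x - x| ≤ 3 * δ := by
  set y := x / δ with hy
  have hx : x = δ * y := by rw [hy]; field_simp
  have e : softThreshold δ x - x = δ * ((max (y - 1) 0 - max (-y - 1) 0 - y) -
      (Real.arctan (max (y - 1) 0) - Real.arctan (max (-y - 1) 0))) := by
    rw [softThreshold, ← hy, neg_div, ← hy, arctanGap, arctanGap]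
    rw [hx]; ring
  rw [e, abs_mul, abs_of_pos hδ, mul_comm 3]
  refine mul_le_mul_of_nonneg_left ?_ hδ.le
  have h1 : |max (y - 1) 0 - max (-y - 1) 0 - y| ≤ 1 := by
    rw [abs_le]
    rcases max_cases (y - 1) 0 with h | h <;> rcases max_cases (-y - 1) 0 with h' | h' <;>
      constructor <;> linarith [h.1, h.2, h'.1, h'.2]
  have h2 : |Real.arctan (max (y - 1) 0) - Real.arctan (max (-y - 1) 0)| ≤ 2 := by
    have a0 {t : ℝ} : 0 ≤ Real.arctan (max t 0) := Real.arctan_nonneg.2 (le_max_right _ _)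
    have a1 {t : ℝ} : Real.arctan t ≤ 2 := by
      linarith [Real.arctan_lt_pi_div_two t, Real.pi_lt_four]
    rw [abs_le]
    constructor <;> linarith [a0 (t := y - 1), a0 (t := -y - 1), a1 (t := max (y - 1) 0),
      a1 (t := max (-y - 1) 0)]
  rw [abs_le] at *
  constructor <;> linarith [h1.1, h1.2, h2.1, h2.2]

end Threshold

/-! ### Equivalence of stability and positivity of the quadratic form. -/

section Stable
open Filter
open scoped Topology ContDiff
variable {ρ θ₀ σ : ℝ} {f g : ℝ × ℝ → E3}

/-- Positivity for the truncations of a function implies positivity. -/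
lemma stabilityForm_nonneg_of_softThreshold (hf : IsRegular ρ f) {u : ℝ × ℝ → ℝ} (hu : C1 ρ u)
    (h : ∀ δ > 0, 0 ≤ stabilityForm ρ f fun q => softThreshold δ (u q)) :
    0 ≤ stabilityForm ρ f u := by
  have hρ := hf.rho_pos
  have hn := hf.c1_unitNormal
  set κ : ℝ × ℝ → ℝ := fun q =>
    2 * tri (unitNormal ρ f q) (dy ρ (unitNormal ρ f) q) (dz ρ (unitNormal ρ f) q) with hκ
  have hκc : ContinuousOn κ (rect ρ) := continuousOn_const.mul (continuousOn_tri hn.continuousOn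
    (hn.continuousOn_dy hρ) (hn.continuousOn_dz hρ))
  set D : ℝ × ℝ → ℝ := fun q => areaElement ρ f q * ‖gradVec ρ f u q‖ ^ 2 with hD
  have hDc : ContinuousOn D (rect ρ) :=
    hf.c1_areaElement.continuousOn.mul ((hf.continuousOn_gradVec hu).norm.pow 2)
  have hpos (k : ℕ) : (0 : ℝ) < 1 / ((k : ℝ) + 1) := Nat.one_div_pos_of_nat
  set w : ℕ → ℝ × ℝ → ℝ := fun k q => softThreshold (1 / ((k : ℝ) + 1)) (u q) with hw
  have hw1 (k) : C1 ρ (w k) :=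
    ((contDiff_softThreshold _).of_le (by norm_num)).comp_contDiffOn hu
  have hlim : BddLim ρ w u := by
    obtain ⟨M, hM⟩ := (isCompact_rect ρ).exists_bound_of_continuousOn hu.continuousOn
    have hb (k : ℕ) (q) : ‖w k q - u q‖ ≤ 3 * (1 / ((k : ℝ) + 1)) :=
      abs_softThreshold_sub_le (hpos k) (u q)
    refine ⟨fun q hq => ?_, M + 3, fun k q hq => ?_⟩
    · rw [tendsto_iff_norm_sub_tendsto_zero]
      refine squeeze_zero (fun _ => norm_nonneg _) (fun k => hb k q) ?_
      simpa using tendsto_one_div_add_atTop_nhds_zero_nat (𝕜 := ℝ).const_mul 3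
    · have h1 : 1 / ((k : ℝ) + 1) ≤ 1 := by
        rw [div_le_one (by positivity)]; linarith [k.cast_nonneg (α := ℝ)]
      calc ‖w k q‖ = ‖u q + (w k q - u q)‖ := by congr 1; ring
        _ ≤ _ := norm_add_le _ _
        _ ≤ M + 3 := add_le_add (hM q hq) ((hb k q).trans (by linarith))
  have hkc (k) : ContinuousOn (fun q => D q + κ q * (w k q * w k q)) (rect ρ) :=
    hDc.add (hκc.mul ((hw1 k).continuousOn.mul (hw1 k).continuousOn))
  -- The gradient term is frozen at that of u: truncation has slope at most 1 and can only decrease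
  -- it. Hence only the zero-order terms have to converge.
  have l1 := ((BddLim.const hDc).add ((BddLim.const hκc).mul (hlim.mul hlim))).integral hkc
  have l2 := l1.sub (tendsto_sideIntegral hf hlim fun k => (hw1 k).continuousOn)
  have e : stabilityForm ρ f u = (∫ q in rect ρ, (D q + κ q * (u q * u q))) -
      sideIntegral ρ f fun q => inner ℝ (sideTangent ρ f q) zAxis ^ 2 * u q ^ 2 := by
    simp only [stabilityForm, hD, hκ, sq (u _)]
  rw [e]
  refine ge_of_tendsto' l2 fun k => (h _ (hpos k)).trans ?_
  refine sub_le_sub_right ?_ _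
  refine setIntegral_mono_on (integrableOn_rect (continuousOn_stability hf (hw1 k)))
    (integrableOn_rect (hkc k)) (measurableSet_rect ρ) fun q hq => ?_
  obtain ⟨T', hT', hT⟩ := exists_hasDerivAt_softThreshold (hpos k) (u q)
  have eg : gradVec ρ f (w k) q = T' • gradVec ρ f u q := by
    have e1 : dy ρ (w k) q = dy ρ u q • T' := dy_comp_real hρ hT hu hq
    have e2 : dz ρ (w k) q = dz ρ u q • T' := dz_comp_real hρ hT hu hq
    rw [gradVec, gradVec, e1, e2, smul_eq_mul, smul_eq_mul]
    module
  have e3 : areaElement ρ f q * ‖gradVec ρ f (w k) q‖ ^ 2 ≤ D q := by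
    rw [eg, norm_smul, mul_pow, Real.norm_eq_abs, sq_abs]
    refine mul_le_mul_of_nonneg_left ?_ (hf.areaElement_pos hq).le
    exact mul_le_of_le_one_left (by positivity) hT'
  have e4 : κ q * w k q ^ 2 = κ q * (w k q * w k q) := by rw [sq]
  exact add_le_add e3 e4.le

/-- Approximation of the unit normal by `C²` fields that are tangent to the cylinder. -/
lemma exists_c1Lim_unitNormal (hρ : 0 < ρ) (hf : IsAdmissible ρ θ₀ f)
    (hcrit : ∀ g, IsAdmissibleField ρ θ₀ f g → firstVar ρ f g = 0) :
    ∃ N : ℕ → ℝ × ℝ → E3, (∀ k, C2 ρ (N k)) ∧ C1Lim ρ N (unitNormal ρ f) ∧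
      ∀ k, ∀ q ∈ sideEdges ρ, inner ℝ (N k q) (radial (f q)) = (0 : ℝ) := by
  have hr := hf.isRegular hρ
  have hn := hr.c1_unitNormal
  have hrad : C2 ρ (fun q => radial (f q)) := contDiffOn_radial hr.c2
  set s : ℝ × ℝ → ℝ := fun q => inner ℝ (unitNormal ρ f q) (radial (f q)) with hs
  have hs1 : C1 ρ s := hn.inner ℝ hrad.c1
  have hs0 : ∀ y z, (y = -1 ∨ y = 1) → z ∈ Icc 0 ρ → s (y, z) = 0 := by
    intro y z hy hz
    have hcont := continuousOn_slice_z hs1.continuousOn (mem_Icc_of_side hy)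
    have : EqOn (fun z => s (y, z)) (fun _ => 0) (Icc 0 ρ) := by
      refine EqOn.of_subset_closure (s := Ioo 0 ρ) (fun z hz => ?_) hcont continuousOn_const
        Ioo_subset_Icc_self (closure_Ioo hρ.ne).ge
      exact inner_unitNormal_radial_side hρ hf hcrit (mem_sideEdges hy hz)
    exact this hz
  -- The normal satisfies s = n · r = 0 on the sides, corners included by continuity, so s has C²
  -- approximants t that vanish there.
  obtain ⟨t, ht2, htl, ht0⟩ := exists_c1Lim_vanishing_sides hρ hs1 hs0
  obtain ⟨m, hm2, hml⟩ := exists_c1Lim hρ hn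
  have hm2' (k) : C2 ρ (m k) := (hm2 k).contDiffOn
  have hmr (k) : C2 ρ (fun q => inner ℝ (m k q) (radial (f q)) : _ → ℝ) := (hm2' k).inner ℝ hrad
  have hd (k) : C2 ρ (fun q => (inner ℝ (m k q) (radial (f q)) : ℝ) - t k q) :=
    (hmr k).sub (ht2 k)
  have hds (k) : C2 ρ (fun q => ((inner ℝ (m k q) (radial (f q)) : ℝ) - t k q) • radial (f q)) :=
    (hd k).smul hrad
  -- The correction replaces the r-component m · r, on the sides, by t = 0. It tends to (s - s) r =
  -- 0 in C¹, so the limit is still n.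
  refine ⟨fun k q => m k q - ((inner ℝ (m k q) (radial (f q)) : ℝ) - t k q) • radial (f q),
    fun k => (hm2' k).sub (hds k), ?_, fun k q hq => ?_⟩
  · have l0 := C1Lim.const hρ hrad.c1
    have l1 : C1Lim ρ (fun k q => (inner ℝ (m k q) (radial (f q)) : ℝ)) s :=
      hml.bilin hρ (innerSL ℝ) l0 (fun k => (hm2' k).c1) (fun _ => hrad.c1) hn hrad.c1
    have l2 := l1.sub hρ htl (fun k => (hmr k).c1) (fun k => (ht2 k).c1) hs1 hs1
    have hss : C1 ρ (fun q => s q - s q) := hs1.sub hs1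
    have l3 : C1Lim ρ (fun k q => ((inner ℝ (m k q) (radial (f q)) : ℝ) - t k q) • radial (f q))
        (fun q => (s q - s q) • radial (f q)) :=
      l2.bilin hρ (ContinuousLinearMap.lsmul ℝ ℝ) l0 (fun k => (hd k).c1) (fun _ => hrad.c1)
        hss hrad.c1
    refine (hml.sub hρ l3 (fun k => (hm2' k).c1) (fun k => (hds k).c1) hn
      (hss.smul hrad.c1)).congr fun q hq => ?_
    simp
  · obtain ⟨y, z⟩ := q
    rw [inner_sub_left, real_inner_smul_left, inner_radial_self_side hf hq, ht0 k y z hq.1]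
    ring

/-- The displacement of `x` by `t • w`, followed by a correction of the distance to the axis which,
if `w` is tangent to the cylinder at `x`, brings the point back to the cylinder. -/
def cylinderShift (x : ℝ × E3 × E3) : E3 :=
  x.2.1 + x.1 • x.2.2 +
    ((√(1 + x.1 ^ 2 * inner ℝ (radialL x.2.2) (radialL x.2.2)))⁻¹ - 1) •
      radialL (x.2.1 + x.1 • x.2.2)

lemma one_add_sq_mul_inner_pos (t : ℝ) (w : E3) : 0 < 1 + t ^ 2 * (inner ℝ w w : ℝ) :=
  add_pos_of_pos_of_nonneg one_pos (mul_nonneg (sq_nonneg t) real_inner_self_nonneg)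

lemma contDiff_cylinderShift : ContDiff ℝ ∞ cylinderShift := by
  have h1 : ContDiff ℝ ∞ fun x : ℝ × E3 × E3 => x.2.1 + x.1 • x.2.2 := by fun_prop
  have h2 : ContDiff ℝ ∞ fun x : ℝ × E3 × E3 => radialL x.2.2 := by fun_prop
  have h3 : ContDiff ℝ ∞ fun x : ℝ × E3 × E3 =>
      1 + x.1 ^ 2 * (inner ℝ (radialL x.2.2) (radialL x.2.2) : ℝ) :=
    contDiff_const.add ((contDiff_fst.pow 2).mul (h2.inner ℝ h2))
  refine h1.add ((((h3.sqrt fun x => (one_add_sq_mul_inner_pos _ _).ne').inv fun x =>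
    (Real.sqrt_pos.2 (one_add_sq_mul_inner_pos _ _)).ne').sub contDiff_const).smul
    (radialL.contDiff.comp h1))

lemma cylinderShift_zero_left (x w : E3) : cylinderShift (0, x, w) = x := by
  simp [cylinderShift]

lemma cylinderShift_zero_right (t : ℝ) (x : E3) : cylinderShift (t, x, 0) = x := by
  simp [cylinderShift, show radial 0 = 0 from radialL.map_zero]

lemma hasDerivAt_cylinderShift (x w : E3) :
    HasDerivAt (fun t => cylinderShift (t, x, w)) w 0 := by
  have h1 : HasDerivAt (fun t : ℝ => x + t • w) w 0 := by
    simpa using ((hasDerivAt_id (0 : ℝ)).smul_const w).const_add x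
  have h2 : HasDerivAt (fun t : ℝ => 1 + t ^ 2 * (inner ℝ (radialL w) (radialL w) : ℝ)) 0 0 := by
    simpa using (((hasDerivAt_id (0 : ℝ)).pow 2).mul_const
      (inner ℝ (radialL w) (radialL w) : ℝ)).const_add 1
  have h3 := ((h2.sqrt (one_add_sq_mul_inner_pos _ _).ne').inv
    (Real.sqrt_pos.2 (one_add_sq_mul_inner_pos _ _)).ne').sub_const 1
  exact (h1.add (h3.smul (radialL.hasFDerivAt.comp_hasDerivAt 0 h1))).congr_deriv (by simp)

lemma cylinderShift_two_coord (t : ℝ) (x w : E3) :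
    cylinderShift (t, x, w) 2 = x 2 + t * w 2 := by
  simp [cylinderShift]

/-- For w orthogonal to the radial vector, the squared radius of x + t w is 1 + t²|radial w|²,
exactly what the normalizing square root removes. -/
lemma cylinderShift_sq_add_sq {t : ℝ} {x w : E3} (hx : x 0 ^ 2 + x 1 ^ 2 = 1)
    (hw : inner ℝ w (radial x) = (0 : ℝ)) :
    cylinderShift (t, x, w) 0 ^ 2 + cylinderShift (t, x, w) 1 ^ 2 = 1 := by
  have hpos := one_add_sq_mul_inner_pos t (radialL w)
  have e := Real.sq_sqrt hpos.le
  have hne := (Real.sqrt_pos.2 hpos).ne'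
  set r := √(1 + t ^ 2 * (inner ℝ (radialL w) (radialL w) : ℝ)) with hr
  have e0 : cylinderShift (t, x, w) 0 = r⁻¹ * (x 0 + t * w 0) := by
    simp only [cylinderShift, ← hr]; simp; ring
  have e1 : cylinderShift (t, x, w) 1 = r⁻¹ * (x 1 + t * w 1) := by
    simp only [cylinderShift, ← hr]; simp; ring
  simp only [inner_coord, radialL_apply, radial_zero_coord, radial_one_coord,
    radial_two_coord] at hw e
  rw [e0, e1]
  field_simp
  linear_combination hx + 2 * t * hw - e

/-- Stable surfaces have nonnegative second variation along the fields that vanish on the wire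
edges, and on the side edges outside a compact set. -/
lemma IsSecondVariationStable.stabilityForm_nonneg (hρ : 0 < ρ) (hσ : 0 < σ)
    (hf : IsAdmissible ρ θ₀ f) (hcrit : ∀ g, IsAdmissibleField ρ θ₀ f g → firstVar ρ f g = 0)
    (hst : IsSecondVariationStable ρ θ₀ σ f) (hg : C2 ρ g) (h0 : ∀ q ∈ wireEdges ρ, g q = 0)
    (hs : ∀ q ∈ sideEdges ρ, inner ℝ (g q) (radial (f q)) = (0 : ℝ)) {K : Set (ℝ × ℝ)}
    (hK : IsCompact K) (hKs : K ⊆ sideEdges ρ) (hgK : ∀ q ∈ sideEdges ρ \ K, g q = 0) :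
    0 ≤ stabilityForm ρ f fun q => inner ℝ (g q) (unitNormal ρ f q) := by
  have hadm := isAdmissibleField_of_eq_zero hg
    (fun q hq h => h0 q (hf.mem_wireEdges hρ hq h)) hs
  obtain ⟨v, hv, hvg⟩ := hadm.exists_velocity hρ hf
  set G : ℕ → ℝ → ℝ × ℝ → E3 := fun i t q => timeDeriv cylinderShift i (t, f q, g q) with hGdef
  have hG : C2Jet ρ (-1) 1 G := c2Jet_of_contDiff hρ contDiff_cylinderShift hf.contDiffOn hg
  have hG0 (t : ℝ) (q) : G 0 t q = cylinderShift (t, f q, g q) := rfl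
  have hG00 : G 0 0 = f := by ext1 q; rw [hG0, cylinderShift_zero_left]
  have hd (q) : HasDerivAt (fun t => G 0 t q) (g q) 0 := hasDerivAt_cylinderShift (f q) (g q)
  have hzero {q} (hq : g q = 0) (t : ℝ) : G 0 t q = f q := by
    rw [hG0, hq, cylinderShift_zero_right]
  have hev := hG.eventually_injective_immersion hρ (by norm_num) (by norm_num)
    (by rw [hG00]; exact hf.injOn) (by rw [hG00]; exact hf.immersion)
  have hcont : ContinuousOn (fun x : ℝ × ℝ × ℝ => f x.2 2 + x.1 * g x.2 2)
      (Ioo (-1) 1 ×ˢ rect ρ) := by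
    have hm : MapsTo (Prod.snd : ℝ × ℝ × ℝ → ℝ × ℝ) (Ioo (-1) 1 ×ˢ rect ρ) (rect ρ) :=
      fun x hx => hx.2
    have c1 : Continuous fun p : E3 => p 2 := by fun_prop
    exact (c1.comp_continuousOn (hf.contDiffOn.continuousOn.comp continuousOn_snd hm)).add
      (continuousOn_fst.mul (c1.comp_continuousOn (hg.continuousOn.comp continuousOn_snd hm)))
  -- On the compact K the side heights are strictly between 0 and ρ, hence remain so for small
  -- times. On the sides off K nothing moves.
  have hht := exists_forall_small_time (Φ := fun t q => f q 2 + t * g q 2) (by norm_num) one_pos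
    hcont (isOpen_Ioo (a := (0 : ℝ)) (b := ρ)) hK (hKs.trans sideEdges_subset)
    (fun q hq => by simpa using height_mem_Ioo_of_mem_sideEdges hρ hf hcrit (hKs hq))
  obtain ⟨τ, hτ, hτ'⟩ := Metric.eventually_nhds_iff.1
    ((hev.and hht).and (Ioo_mem_nhds (show (-1 : ℝ) < 0 by norm_num) one_pos))
  have hball {t : ℝ} (ht : t ∈ Ioo (-τ) τ) : dist t 0 < τ := by
    rw [Real.dist_0_eq_abs, abs_lt]; exact ht
  have hτ1 : τ ≤ 1 := by
    by_contra! h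
    exact absurd (hτ' (y := 1) (by simpa using h)).2.2 (lt_irrefl _)
  have hGτ : C2Jet ρ (-τ) τ G := hG.mono (by linarith) hτ1
  have hGadm : ∀ t ∈ Ioo (-τ) τ, IsAdmissible ρ θ₀ (G 0 t) := by
    intro t ht
    obtain ⟨⟨⟨hinj, himm⟩, hh⟩, -⟩ := hτ' (hball ht)
    refine ⟨hGτ.c2 0 (by norm_num) t ht, hinj, himm, ?_, fun q hq => ?_⟩
    · rw [← hf.image_wireEdges]
      exact image_congr fun q hq => hzero (h0 q hq) t
    · by_cases hqK : q ∈ K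
      · refine ⟨cylinderShift_sq_add_sq (hf.mapsTo_sideEdges hq).1 (hs q hq), ?_⟩
        rw [hG0, cylinderShift_two_coord]
        exact ⟨(hh q hqK).1.le, (hh q hqK).2.le⟩
      · rw [hzero (hgK q ⟨hq, hqK⟩) t]
        exact hf.mapsTo_sideEdges hq
  have hτ0 : -τ < 0 := by linarith
  have h1 := hst v hv (-τ) τ (G 0) hτ0 hτ hGτ.isC2Family hGadm fun q hq =>
    ⟨by rw [hG00], by rw [hvg q hq]; exact hd q⟩
  rw [deriv_deriv_energy_eq hρ hf hcrit hadm hτ0 hτ hGτ.isC2Family hGadm fun q _ =>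
    ⟨by rw [hG00], hd q⟩] at h1
  exact nonneg_of_mul_nonneg_right h1 hσ

/-- The field u n is not usable: n is only C¹, and near the corners a displacement could leave the
tube. The truncation w of u and the C² substitutes N_k of n repair both defects, and the form passes
to the limits. -/
lemma IsSecondVariationStable.stabilityForm_nonneg_of_c2 (hρ : 0 < ρ) (hσ : 0 < σ)
    (hf : IsAdmissible ρ θ₀ f) (hcrit : ∀ g, IsAdmissibleField ρ θ₀ f g → firstVar ρ f g = 0)
    (hst : IsSecondVariationStable ρ θ₀ σ f) {u : ℝ × ℝ → ℝ} (hu : C2 ρ u)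
    (h0 : ∀ q ∈ wireEdges ρ, u q = 0) : 0 ≤ stabilityForm ρ f u := by
  have hr := hf.isRegular hρ
  have hn := hr.c1_unitNormal
  refine stabilityForm_nonneg_of_softThreshold hr hu.c1 fun δ hδ => ?_
  set w : ℝ × ℝ → ℝ := fun q => softThreshold δ (u q) with hw
  have hw2 : C2 ρ w := (contDiff_softThreshold δ).comp_contDiffOn hu
  have hw0 {q} (hq : |u q| ≤ δ) : w q = 0 := softThreshold_eq_zero hδ hq
  obtain ⟨N, hN2, hNl, hNr⟩ := exists_c1Lim_unitNormal hρ hf hcrit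
  -- The part of the sides where the truncation may be nonzero. It is compact and avoids the
  -- corners, because u vanishes there.
  set K : Set (ℝ × ℝ) := rect ρ ∩ {q | (q.1 = -1 ∨ q.1 = 1) ∧ δ ≤ |u q|} with hKdef
  have hKc : IsCompact K := by
    have e : K = (rect ρ ∩ {q | q.1 = -1 ∨ q.1 = 1}) ∩ (rect ρ ∩ (fun q => |u q|) ⁻¹' Ici δ) := by
      ext q
      simp only [hKdef, mem_inter_iff, mem_ofPred_eq, mem_preimage, mem_Ici]
      tauto
    rw [e]
    refine ((isCompact_rect ρ).inter_right ?_).inter_right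
      (hu.continuousOn.abs.preimage_isClosed_of_isClosed (isCompact_rect ρ).isClosed isClosed_Ici)
    exact (isClosed_eq continuous_fst continuous_const).union
      (isClosed_eq continuous_fst continuous_const)
  have hKs : K ⊆ sideEdges ρ := by
    rintro ⟨y, z⟩ ⟨⟨hy, hz⟩, hy', hδu⟩
    simp only at hz hy'
    have hne : (y, z) ∉ wireEdges ρ := fun h => by
      rw [h0 _ h, abs_zero] at hδu
      exact absurd hδu hδ.not_ge
    refine ⟨hy', lt_of_le_of_ne hz.1 fun h => hne ⟨hy, Or.inl h.symm⟩,
      lt_of_le_of_ne hz.2 fun h => hne ⟨hy, Or.inr h⟩⟩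
  -- The velocity is w N_k: tangent to the cylinder on the sides because N_k is, and zero on the
  -- wires because w is.
  have key (k : ℕ) : 0 ≤ stabilityForm ρ f fun q => w q * inner ℝ (N k q) (unitNormal ρ f q) := by
    have h := hst.stabilityForm_nonneg hρ hσ hf hcrit (g := fun q => w q • N k q)
      (hw2.smul (hN2 k)) (fun q hq => ?_) (fun q hq => ?_) hKc hKs (fun q hq => ?_)
    · simpa only [real_inner_smul_left] using h
    · rw [hw0 (by rw [h0 q hq, abs_zero]; exact hδ.le), zero_smul]
    · rw [real_inner_smul_left, hNr k q hq, mul_zero]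
    · rw [hw0 (le_of_not_ge fun h => hq.2 ⟨sideEdges_subset hq.1, hq.1.1, h⟩), zero_smul]
  have hin (k) : C1 ρ (fun q => inner ℝ (N k q) (unitNormal ρ f q) : _ → ℝ) := (hN2 k).c1.inner ℝ hn
  have hin' : C1 ρ (fun q => inner ℝ (unitNormal ρ f q) (unitNormal ρ f q) : _ → ℝ) :=
    hn.inner ℝ hn
  have l1 : C1Lim ρ (fun k q => (inner ℝ (N k q) (unitNormal ρ f q) : ℝ))
      (fun q => inner ℝ (unitNormal ρ f q) (unitNormal ρ f q)) :=
    hNl.bilin hρ (innerSL ℝ) (C1Lim.const hρ hn) (fun k => (hN2 k).c1) (fun _ => hn) hn hn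
  have l2 : C1Lim ρ (fun k q => w q * (inner ℝ (N k q) (unitNormal ρ f q) : ℝ))
      (fun q => w q * (inner ℝ (unitNormal ρ f q) (unitNormal ρ f q) : ℝ)) :=
    (C1Lim.const hρ hw2.c1).bilin hρ (ContinuousLinearMap.mul ℝ ℝ) l1 (fun _ => hw2.c1) hin
      hw2.c1 hin'
  have h := ge_of_tendsto' (tendsto_stabilityForm hr l2 fun k => hw2.c1.mul (hin k)) key
  rwa [stabilityForm_congr hρ (c' := w) fun q hq => ?_] at h
  have e : inner ℝ (unitNormal ρ f q) (unitNormal ρ f q) = (1 : ℝ) := (hr.isFrame hq).nn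
  simp only [e, mul_one]

/-- The normal component of an admissible velocity vanishes on the wires, as n is orthogonal to
them, but it is only C¹; positivity is therefore first extended from C² to C¹ functions. -/
lemma isSecondVariationStable_of_stabilityForm_nonneg (hρ : 0 < ρ) (hσ : 0 < σ)
    (hf : IsAdmissible ρ θ₀ f) (hcrit : ∀ g, IsAdmissibleField ρ θ₀ f g → firstVar ρ f g = 0)
    (h : ∀ u, C2 ρ u → (∀ q ∈ wireEdges ρ, u q = 0) → 0 ≤ stabilityForm ρ f u) :
    IsSecondVariationStable ρ θ₀ σ f := by
  intro v hv a b F ha hb hF hadm hFv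
  have hr := hf.isRegular hρ
  have hg := hv.field
  rw [deriv_deriv_energy_eq hρ hf hcrit hg ha hb hF hadm hFv]
  have hg2 : C2 ρ (v ∘ f) := hg.c2
  exact mul_nonneg hσ.le (stabilityForm_nonneg_of_c1 hr h (hg2.c1.inner ℝ hr.c1_unitNormal)
    fun q hq => hg.inner_unitNormal_wireEdges hρ hf hq)

end Stable

end SoapFilm

end

theorem proposition3p2 (ρ θ₀ σ : ℝ) (hρ : 0 < ρ) (hθ₀ : 0 ≤ θ₀) (hθ₀π : θ₀ < Real.pi)
    (hσ : 0 < σ) (f : ℝ × ℝ → SoapFilm.E3) (hf : SoapFilm.IsAdmissible ρ θ₀ f)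
    (hcrit : SoapFilm.IsCritical ρ θ₀ σ f) :
    SoapFilm.IsSecondVariationStable ρ θ₀ σ f ↔
      ∀ c : SoapFilm.E3 → ℝ, SoapFilm.IsC2OnSurface ρ f c →
        (∀ p ∈ SoapFilm.wires ρ θ₀, c p = 0) →
          SoapFilm.sideIntegral ρ f
              (fun q => inner ℝ (SoapFilm.sideTangent ρ f q) SoapFilm.zAxis ^ 2 * c (f q) ^ 2)
            ≤ SoapFilm.surfIntegral ρ f
              (fun q => ‖SoapFilm.surfGrad ρ f (c ∘ f) q‖ ^ 2
                + 2 * SoapFilm.gaussCurv ρ f q * c (f q) ^ 2) := by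
  have hcrit' (g) (hg : SoapFilm.IsAdmissibleField ρ θ₀ f g) : SoapFilm.firstVar ρ f g = 0 :=
    SoapFilm.firstVar_eq_zero hρ hσ hf hcrit hg
  have hr := hf.isRegular hρ
  constructor
  · intro hst c hc hc0
    rw [← sub_nonneg, ← SoapFilm.stabilityForm_eq_sub hr c]
    exact hst.stabilityForm_nonneg_of_c2 hρ hσ hf hcrit' hc fun q hq =>
      hc0 _ (hf.image_wireEdges ▸ Set.mem_image_of_mem f hq)
  · intro h
    refine SoapFilm.isSecondVariationStable_of_stabilityForm_nonneg hρ hσ hf hcrit'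
      fun u hu hu0 => ?_
    -- As f is injective, a function on the rectangle is the pull-back of a function on the surface.
    have hinv : Set.EqOn ((u ∘ Function.invFunOn f (SoapFilm.rect ρ)) ∘ f) u (SoapFilm.rect ρ) :=
      fun q hq => congrArg u (hf.injOn.leftInvOn_invFunOn hq)
    rw [← SoapFilm.stabilityForm_congr hρ hinv, SoapFilm.stabilityForm_eq_sub hr, sub_nonneg]
    refine h _ (hu.congr hinv) fun p hp => ?_
    rw [← hf.image_wireEdges] at hp
    obtain ⟨q, hq, rfl⟩ := hp
    exact (hinv (SoapFilm.wireEdges_subset hρ hq)).trans (hu0 q hq)
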